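/- Let $(M,g)$ be a connected closed Riemannian manifold of dimension $d\ge 2$, let $T'M=T^*M\setminus\{0\}$, let $\rho=\sqrt{\det g_{\mu\nu}}$ and $h(y,\eta)=(g^{\alpha\beta}(y)\eta_\alpha\eta_\beta)^{1/2}$. Let $\phi\in C^\infty(M\times T'M;\mathbb C)$ be positively homogeneous of degree $1$ in $\eta$ and such that (a) $\phi(x;y,\eta)=(x-y)^\alpha\eta_\alpha+O(\|x-y\|^2)$ in local coordinates, the same for $x$ and $y$; (b) $\operatorname{Im}\phi\ge 0$. Let $\mathfrak s\in S^0_{\rm ph}(T'M)$ be a polyhomogeneous symbol of order $0$, i.e. $\mathfrak s\in C^\infty(T'M;\mathbb C)$ with an asymptotic expansion $\mathfrak s\sim\sum_{k\ge 0}\mathfrak s_{-k}$, where $\mathfrak s_{-k}\in C^\infty(T'M;\mathbb C)$ is positively homogeneous in $\eta$ of degree $-k$. Let $\chi\in C^\infty(M\times T'M;\mathbb R)$ be a cut-off, i.e. $\chi=0$ where $h(y,\eta)\le 1/2$; $\chi=1$ on the intersection of $\{h(y,\eta)\ge 1\}$ with some conical neighbourhood of the diagonal $\{x=y\}$; and $\chi(x;y,t\eta)=\chi(x;y,\eta)$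 for $t\ge 1$ and $h(y,\eta)\ge 1$. Let $$v(x;y,\eta)=\rho(x)^{-1/2}\rho(y)^{1/2}\,[{\det}^2\phi_{x\eta}(x;y,\eta)]^{1/4},$$ where the branch of the root is continuous on the support of $\chi$ and such that $v=1$ for $x=y$. Consider the pseudodifferential operator $$(\mathfrak I_{\phi,\mathfrak s}f)(x)=(2\pi)^{-d}\int_{T'M}e^{i\phi(x;y,\eta)}\,\mathfrak s(y,\eta)\,\chi(x;y,\eta)\,v(x;y,\eta)\,f(y)\,dy\,d\eta ,\qquad f\in C^\infty(M),$$ the integral being understood as an oscillatory integral. If $\mathfrak I_{\phi,\mathfrak s}-\operatorname{Id}$ is an infinitely smoothing operator, i.e. an integral operator with kernel in $C^\infty(M\times M)$, then $\mathfrak s_{-1}(y,\eta)=0$ for all $(y,\eta)\in T'M$. -/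

import Mathlib

open Set Filter Topology MeasureTheory Bundle Manifold
open scoped ContDiff

noncomputable section

namespace SubprincipalIdentity

/-- The model space `ℝ^d`, used both for positions and (through the standard dual basis) for
the components of covectors. -/
abbrev Coord (d : ℕ) : Type := EuclideanSpace ℝ (Fin d)

/-- The standard basis vector `e_α` of `ℝ^d`. -/
def stdVec {d : ℕ} (α : Fin d) : Coord d := EuclideanSpace.single α (1 : ℝ)

section Manifolds

variable {d : ℕ} {M : Type*} [TopologicalSpace M] [ChartedSpace (Coord d) M]
  [IsManifold 𝓘(ℝ, Coord d) ∞ M]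

/-- The total space of the cotangent bundle `T*M`, with Mathlib's smooth vector bundle structure. -/
abbrev Cotangent (d : ℕ) (M : Type*) [TopologicalSpace M] [ChartedSpace (Coord d) M]
    [IsManifold 𝓘(ℝ, Coord d) ∞ M] : Type _ :=
  TotalSpace (Coord d →L[ℝ] ℝ) (fun y : M => TangentSpace 𝓘(ℝ, Coord d) y →L[ℝ] ℝ)

/-- The model with corners of the (boundaryless) manifold `T*M`. -/
abbrev cotangentModel (d : ℕ) :=
  (𝓘(ℝ, Coord d)).prod 𝓘(ℝ, Coord d →L[ℝ] ℝ)

/-- `T'M`: the cotangent bundle with the zero section removed. -/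
def puncturedCotangent (d : ℕ) (M : Type*) [TopologicalSpace M] [ChartedSpace (Coord d) M]
    [IsManifold 𝓘(ℝ, Coord d) ∞ M] : Set (Cotangent d M) :=
  {q | q.2 ≠ 0}

/-- Multiplication of a covector by a real number, the base point being kept. -/
def scale (t : ℝ) (q : Cotangent d M) : Cotangent d M := ⟨q.1, t • q.2⟩

/-! ### Local coordinates

`c : M` stands for the chart `chartAt c`; `x y p` below are coordinate vectors. -/

/-- The point of `M` with coordinates `y` in the chart at `c`. -/
abbrev chartPoint (c : M) (y : Coord d) : M := (extChartAt 𝓘(ℝ, Coord d) c).symm y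

/-- The open set of coordinate vectors of the chart at `c`. -/
abbrev chartDomain (d : ℕ) {M : Type*} [TopologicalSpace M] [ChartedSpace (Coord d) M] (c : M) :
    Set (Coord d) :=
  (extChartAt 𝓘(ℝ, Coord d) c).target

/-- The covector `∑ p_α dx^α` at the point with coordinates `y`, where `x^α` are the coordinate
functions of the chart at `c`. -/
def chartCovector (c : M) (y p : Coord d) : Cotangent d M :=
  ⟨chartPoint c y,
    (innerSL ℝ p).comp
      (mfderiv 𝓘(ℝ, Coord d) 𝓘(ℝ, Coord d) (extChartAt 𝓘(ℝ, Coord d) c) (chartPoint c y))⟩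

/-- The coordinate vector field `∂_α` of the chart at `c`, at the point with coordinates `y`. -/
def chartVector (c : M) (y : Coord d) (α : Fin d) :
    TangentSpace 𝓘(ℝ, Coord d) (chartPoint c y) :=
  mfderiv 𝓘(ℝ, Coord d) 𝓘(ℝ, Coord d) (extChartAt 𝓘(ℝ, Coord d) c).symm y (stdVec α)

/-! ### Riemannian objects -/

/-- A smooth Riemannian metric on `M`. -/
abbrev RiemMetric (d : ℕ) (M : Type*) [TopologicalSpace M] [ChartedSpace (Coord d) M]
    [IsManifold 𝓘(ℝ, Coord d) ∞ M] : Type _ :=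
  ContMDiffRiemannianMetric 𝓘(ℝ, Coord d) ∞ (Coord d)
    (fun y : M => TangentSpace 𝓘(ℝ, Coord d) y)

/-- `ρ(y) = √(det g_{μν}(y))` in the chart at `c`. -/
def rho (g : RiemMetric d M) (c : M) (y : Coord d) : ℝ :=
  Real.sqrt (Matrix.of fun μ ν : Fin d =>
    g.inner (chartPoint c y) (chartVector c y μ) (chartVector c y ν)).det

/-- The Riemannian measure of `g`, i.e. the measure which is `ρ(x) dx` in every chart. The measures
`ρ(x) dx` of the different charts agree on overlaps, so that their supremum is the
measure obtained by glueing them. -/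
def riemannianMeasure [MeasurableSpace M] (g : RiemMetric d M) : Measure M :=
  ⨆ c : M, Measure.map (chartPoint c)
    ((volume.restrict (chartDomain d c)).withDensity fun y => ENNReal.ofReal (rho g c y))

/-- The Gram matrix of `g` at `y` for a basis of `T_y M`. (As a vector space `T_y M` is `ℝ^d`, by
means of the chart at `y`; so the `stdVec α` are the coordinate vectors of this chart.) -/
def gram (g : RiemMetric d M) (y : M) : Matrix (Fin d) (Fin d) ℝ :=
  Matrix.of fun μ ν =>
    g.inner y (stdVec μ : TangentSpace 𝓘(ℝ, Coord d) y) (stdVec ν : TangentSpace 𝓘(ℝ, Coord d) y)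

/-- `h(y,η) = (g^{αβ}(y) η_α η_β)^{1/2}`, the length of a covector. -/
def covectorLength (g : RiemMetric d M) (q : Cotangent d M) : ℝ :=
  let η : Fin d → ℝ := fun α => q.2 (stdVec α : TangentSpace 𝓘(ℝ, Coord d) q.1)
  Real.sqrt (dotProduct η ((gram g q.1)⁻¹.mulVec η))

/-- `∫ F(y,η) dη / ((2π)^d ρ(y))` over `T*_y M`. The measure `dη / ρ(y)` on the fibre does not depend
on the coordinates, and its product with `ρ(y) dy` is the canonical measure `dy dη`. -/
def fibreIntegral (g : RiemMetric d M) (y : M) (F : Cotangent d M → ℂ) : ℂ :=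
  (((2 * Real.pi) ^ d * Real.sqrt (gram g y).det : ℝ) : ℂ)⁻¹ *
    ∫ p : Coord d, F ⟨y, (innerSL ℝ p : Coord d →L[ℝ] ℝ)⟩

/-- `z` is the value of the oscillatory integral `(2π)^{-d} ∫_{T*M} F(y,η) dy dη`: for each smooth
compactly supported `ψ` which equals `1` near `0`, the (convergent) integrals of
`ψ(ε h(y,η)) F(y,η)` tend to `z` when `ε → 0+`. -/
def HasOscillatoryIntegral [MeasurableSpace M] (g : RiemMetric d M) (F : Cotangent d M → ℂ)
    (z : ℂ) : Prop :=
  ∀ ψ : ℝ → ℝ, ContDiff ℝ ∞ ψ → HasCompactSupport ψ → (∀ᶠ t in 𝓝 0, ψ t = 1) →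
    Tendsto
      (fun ε : ℝ => ∫ y : M,
        fibreIntegral g y (fun q => (ψ (ε * covectorLength g q) : ℂ) * F q)
          ∂(riemannianMeasure g))
      (𝓝[>] 0) (𝓝 z)

/-! ### Phase functions, symbols, cut-offs, weights -/

/-- The phase functions: smooth on `M × T'M`, positively homogeneous of degree one in `η`,
`φ(x;y,η) = (x-y)^α η_α + O(‖x-y‖²)` in local coordinates (the same for `x` and `y`), `Im φ ≥ 0`.
Values on the zero section are irrelevant. -/
structure IsPhase (φ : M → Cotangent d M → ℂ) : Prop where
  smooth : ContMDiffOn ((𝓘(ℝ, Coord d)).prod (cotangentModel d)) 𝓘(ℝ, ℂ) ∞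
    (fun z : M × Cotangent d M => φ z.1 z.2) (univ ×ˢ puncturedCotangent d M)
  homogeneous : ∀ x, ∀ q ∈ puncturedCotangent d M, ∀ t : ℝ, 0 < t →
    φ x (scale t q) = (t : ℂ) * φ x q
  linear_part : ∀ c : M, ∀ y ∈ chartDomain d c, ∀ p : Coord d, p ≠ 0 →
    (fun x : Coord d => φ (chartPoint c x) (chartCovector c y p)
        - ((∑ α : Fin d, (x α - y α) * p α : ℝ) : ℂ))
      =O[𝓝 y] fun x => ‖x - y‖ ^ 2
  im_nonneg : ∀ x, ∀ q ∈ puncturedCotangent d M, 0 ≤ (φ x q).im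

/-- `r = O(|η|^m)` in the sense of symbols: in every chart, locally uniformly in `y`, each
derivative of order `a` in `y` and `b` in `η` is `O(|η|^{m-b})` for `|η| ≥ 1`. -/
def SymbolEstimates (m : ℤ) (r : Cotangent d M → ℂ) : Prop :=
  ∀ (c : M) (K : Set (Coord d)), IsCompact K → K ⊆ chartDomain d c → ∀ a b : ℕ,
    ∃ C : ℝ, ∀ y ∈ K, ∀ p : Coord d, 1 ≤ ‖p‖ →
      ‖iteratedFDeriv ℝ a
          (fun y' => iteratedFDeriv ℝ b (fun p' => r (chartCovector c y' p')) p) y‖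
        ≤ C * ‖p‖ ^ (m - b)

/-- `s ∈ S^0_{ph}(T'M)` with asymptotic expansion `s ∼ ∑ k, s_{-k}`; here `sk k` is the component
`s_{-k}`, which is positively homogeneous of degree `-k`. -/
structure IsPolyhomogeneous (s : Cotangent d M → ℂ) (sk : ℕ → Cotangent d M → ℂ) : Prop where
  smooth : ContMDiffOn (cotangentModel d) 𝓘(ℝ, ℂ) ∞ s (puncturedCotangent d M)
  smooth_component : ∀ k, ContMDiffOn (cotangentModel d) 𝓘(ℝ, ℂ) ∞ (sk k) (puncturedCotangent d M)
  homogeneous : ∀ k, ∀ q ∈ puncturedCotangent d M, ∀ t : ℝ, 0 < t →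
    sk k (scale t q) = (t : ℂ) ^ (-(k : ℤ)) * sk k q
  asymptotic : ∀ N : ℕ, SymbolEstimates (-(N : ℤ)) fun q => s q - ∑ k ∈ Finset.range N, sk k q

/-- Cut-offs `χ(x;y,η)` to a conical neighbourhood of the diagonal and away from small `η`.
As `χ` vanishes for `0 < |η| ≤ 1/2`, it is no restriction to extend it by zero to `η = 0`. -/
structure IsCutoff (g : RiemMetric d M) (χ : M → Cotangent d M → ℝ) : Prop where
  smooth : ContMDiff ((𝓘(ℝ, Coord d)).prod (cotangentModel d)) 𝓘(ℝ, ℝ) ∞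
    (fun z : M × Cotangent d M => χ z.1 z.2)
  eq_zero : ∀ x q, covectorLength g q ≤ 1 / 2 → χ x q = 0
  eq_one : ∃ U : Set (M × Cotangent d M), IsOpen U ∧
    (∀ q ∈ puncturedCotangent d M, (q.1, q) ∈ U) ∧
    (∀ x q, (x, q) ∈ U → ∀ t : ℝ, 0 < t → (x, scale t q) ∈ U) ∧
    ∀ x q, (x, q) ∈ U → 1 ≤ covectorLength g q → χ x q = 1
  homogeneous : ∀ x q, 1 ≤ covectorLength g q → ∀ t : ℝ, 1 ≤ t → χ x (scale t q) = χ x q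

/-- `det φ_{x^α η_β}` with `x` in the chart at `c` and `(y,η)` in the chart at `c'`. -/
def mixedDet (φ : M → Cotangent d M → ℂ) (c c' : M) (x y p : Coord d) : ℂ :=
  (Matrix.of fun α β : Fin d =>
    fderiv ℝ (fun x' : Coord d =>
      fderiv ℝ (fun p' : Coord d => φ (chartPoint c x') (chartCovector c' y p')) p (stdVec β))
      x (stdVec α)).det

/-- `v = ρ(x)^{-1/2} ρ(y)^{1/2} [det² φ_{xη}]^{1/4}` on the support of `χ`, with a continuous branch
of the fourth root for which `v = 1` on the diagonal `x = y`. The coordinates of `x` and of `y`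
may be different. -/
structure IsWeight (g : RiemMetric d M) (φ : M → Cotangent d M → ℂ) (χ : M → Cotangent d M → ℝ)
    (v : M → Cotangent d M → ℂ) : Prop where
  continuous : ContinuousOn (fun z : M × Cotangent d M => v z.1 z.2)
    (tsupport fun z : M × Cotangent d M => χ z.1 z.2)
  fourth_root : ∀ c c' : M, ∀ x ∈ chartDomain d c, ∀ y ∈ chartDomain d c', ∀ p : Coord d,
    (chartPoint c x, chartCovector c' y p) ∈
        tsupport (fun z : M × Cotangent d M => χ z.1 z.2) →
      ∃ w : ℂ, w ^ 4 = mixedDet φ c c' x y p ^ 2 ∧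
        v (chartPoint c x) (chartCovector c' y p) =
          ((rho g c x ^ (-(1 / 2) : ℝ) * rho g c' y ^ (1 / 2 : ℝ) : ℝ) : ℂ) * w
  diagonal : ∀ q ∈ puncturedCotangent d M, v q.1 q = 1

/-! ### Operators -/

/-- `T` is the operator
`(T f)(x) = ∫_{T'M} e^{i φ(x;y,η)} s(y,η) χ(x;y,η) v(x;y,η) f(y) dy dη / (2π)^d`
on `C^∞(M)`. -/
def IsOperatorOf [MeasurableSpace M] (g : RiemMetric d M) (φ : M → Cotangent d M → ℂ)
    (s : Cotangent d M → ℂ) (χ : M → Cotangent d M → ℝ) (v : M → Cotangent d M → ℂ)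
    (T : C^∞⟮𝓘(ℝ, Coord d), M; 𝓘(ℝ, ℂ), ℂ⟯ → M → ℂ) : Prop :=
  ∀ (f : C^∞⟮𝓘(ℝ, Coord d), M; 𝓘(ℝ, ℂ), ℂ⟯) (x : M),
    HasOscillatoryIntegral g
      (fun q => Complex.exp (Complex.I * φ x q) * s q * (χ x q : ℂ) * v x q * f q.1) (T f x)

/-- Infinitely smoothing operators: integral operators with a smooth kernel. -/
def IsSmoothing [MeasurableSpace M] (g : RiemMetric d M)
    (R : C^∞⟮𝓘(ℝ, Coord d), M; 𝓘(ℝ, ℂ), ℂ⟯ → M → ℂ) : Prop :=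
  ∃ k : M × M → ℂ,
    ContMDiff ((𝓘(ℝ, Coord d)).prod 𝓘(ℝ, Coord d)) 𝓘(ℝ, ℂ) ∞ k ∧
    ∀ (f : C^∞⟮𝓘(ℝ, Coord d), M; 𝓘(ℝ, ℂ), ℂ⟯) (x : M),
      R f x = ∫ y : M, k (x, y) * f y ∂(riemannianMeasure g)

end Manifolds

end SubprincipalIdentity

end

open SubprincipalIdentity

/-! The operator is tested on wave packets. Fix a point of `M`, use the chart there with coordinates
centred at the point, and let `f` be a packet at the origin of width `ε⁴` and frequency `ε⁻⁵ξ`, `|ξ|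
= 1`, with `f(0) = 1`. Since the operator is the identity plus a smooth kernel, its value on `f` at
the centre is `1 + O(‖f‖_{L¹}) = 1 + O(ε^{4d})`, and `4d ≥ 8`.

The same value is computed from the oscillatory integral. With `z = y - x` the phase is `-z·p +
W(z,p)`, where `W` is homogeneous of degree one in `p` and vanishes to second order at `z = 0`. Put
`z = ε⁴u`, `p = ε⁻⁵ζ`, `ζ = ξ + 2πετ`. The oscillation of the packet cancels the part `ε⁻¹u·ξ` of
`z·p`, the Jacobian cancels `(2π)^{-d}`, and `W = ε³M(ε⁴,u,ζ)` with `M` smooth. What remains is the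
integral over `τ` of the Fourier transforms in `u` of a bump times `exp(iε³M) V(ε⁴u,ζ) ∑ ε^{5k}
s_{-k}(ε⁴u,ζ)`. Frequencies `|τ| ≳ 1/ε` are negligible by nonstationary phase, and Fourier inversion
makes the integral over `τ` of a transform the value of the function at `u = 0`. The widths are
chosen so that `s_{-1}` enters at order `ε⁵`, before the square `ε⁶` of the phase term.

Modulo `ε` this gives `s_0 = 1`. Modulo `ε⁶` there remain `1`, the Hessian term `iε³ ∑ W_{ab}(ζ) u_a
u_b`, the gradient term `ε⁴ ∑ V_b(ζ) u_b`, and `ε⁵ s_{-1}(ξ)`. Multiplication by `u_a` is `(i/2π)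
∂_{τ_a}` on the transform; integrating by parts moves it onto `W_{ab}(ξ + 2πετ)` and gains a factor
`ε`. So the two middle terms add up to `ε⁴` times the integral of `∑_b (∑_a ∂_{p_a}W_{ab} + V_b)(ζ)`
against the transform of `u_b`.

The weight makes the bracket independent of `p`. On the diagonal the second `y`-derivatives of the
nonlinear part of the phase are minus the mixed `xy`-derivatives, so `∑_a ∂_{p_a}W_{ab} = -½ ∂_{y_b}
tr φ_{xη} = -½ ∂_{y_b} det φ_{xη}`, because `φ_{xη}` is the identity there. The square root of the
determinant in `v` contributes `+½ ∂_{y_b} det φ_{xη}` to `V_b`, and the densities contribute a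
constant. A constant times the transform of `u_b` integrates to the value of `u_b` at `0`, which is
zero. Hence `ε⁵ s_{-1}(ξ) = O(ε⁶)`.

The analysis is carried by `exists_nonstationary_bound`, `exists_near_expansion`,
`integral_mainTerm` and `IsLocalKernel.exists_norm_one_sub_le`, the cancellation by
`IsLocalPhase.subprincipalRelation`, and the passage from the manifold to coordinates by
`exists_isLocalKernel` and `IsOperatorOf.isIdentityModBounded`. -/

noncomputable section

set_option linter.unusedSectionVars false

namespace SubprincipalIdentity

/-! ### Oscillatory integrals with parameters -/

section NonstationaryPhase

variable {Q U : Type*} [NormedAddCommGroup Q] [NormedSpace ℝ Q]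
  [NormedAddCommGroup U] [NormedSpace ℝ U]

/-- The derivative of a function on `Q × U` in the second variable, in a direction which depends
on the first one. -/
def partialDir (e : Q → U) (f : Q × U → ℂ) (x : Q × U) : ℂ := fderiv ℝ f x (0, e x.1)

lemma ContDiffOn.partialDir {e : Q → U} (he : ContDiff ℝ ∞ e) {f : Q × U → ℂ} {O : Set (Q × U)}
    (hO : IsOpen O) (hf : ContDiffOn ℝ ∞ f O) :
    ContDiffOn ℝ ∞ (SubprincipalIdentity.partialDir e f) O := by
  have h1 : ContDiffOn ℝ ∞ (fderiv ℝ f) O := hf.fderiv_of_isOpen hO (by norm_num)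
  exact h1.clm_apply (by fun_prop)

lemma fderiv_comp_prodMk {f : Q × U → ℂ} {κ : Q} {u : U} (hf : DifferentiableAt ℝ f (κ, u))
    (w : U) : fderiv ℝ (fun u' => f (κ, u')) u w = fderiv ℝ f (κ, u) (0, w) := by
  have h := hf.hasFDerivAt.comp u ((hasFDerivAt_const κ u).prodMk (hasFDerivAt_id u))
  have h' := congrArg (fun L : U →L[ℝ] ℂ => L w) h.fderiv
  exact h'.trans (by simp)

variable [FiniteDimensional ℝ U] [MeasurableSpace U] [BorelSpace U]

/-- The integral of the derivative of a compactly supported function vanishes. -/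
lemma integral_fderiv_eq_zero_of_hasCompactSupport {μ : Measure U} [μ.IsAddHaarMeasure] {g : U → ℂ}
    (hg : ContDiff ℝ ∞ g) (hc : HasCompactSupport g) (w : U) : ∫ u, fderiv ℝ g u w ∂μ = 0 := by
  have h1 : Continuous fun u => fderiv ℝ g u w :=
    (hg.continuous_fderiv (by norm_num)).clm_apply continuous_const
  have h2 : HasCompactSupport fun u => fderiv ℝ g u w := hc.fderiv_apply ℝ w
  have := integral_mul_fderiv_eq_neg_fderiv_mul_of_integrable (μ := μ) (𝕜 := ℂ)
    (f := fun _ : U => (1 : ℂ)) (g := g) (v := w) (by simp)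
    (by simpa using h1.integrable_of_hasCompactSupport h2)
    (by simpa using hg.continuous.integrable_of_hasCompactSupport hc) (fun x _ => by fun_prop)
    (fun x _ => hg.differentiable (by norm_num) x)
  simpa using this

/-- Nonstationary phase, uniformly in parameters. -/
theorem exists_nonstationary_bound {μ : Measure U} [μ.IsAddHaarMeasure] {O : Set (Q × U)}
    (hO : IsOpen O) {K : Set Q} (hK : IsCompact K) {B : Set U} (hB : IsCompact B)
    (hKB : K ×ˢ B ⊆ O) {Ψ : Q × U → ℂ} (hΨ : ContDiffOn ℝ ∞ Ψ O) {e : Q → U}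
    (he : ContDiff ℝ ∞ e) (hne : ∀ x ∈ O, partialDir e Ψ x ≠ 0) (N : ℕ) :
    ∀ b : Q × U → ℂ, ContDiffOn ℝ ∞ b O → (∀ κ u, u ∉ B → b (κ, u) = 0) →
      ∃ C : ℝ, 0 ≤ C ∧ ∀ κ ∈ K, (∀ u ∈ B, 0 ≤ (Ψ (κ, u)).im) → ∀ L : ℝ, 0 < L →
        ‖∫ u, Complex.exp (Complex.I * L * Ψ (κ, u)) * b (κ, u) ∂μ‖ ≤ C / L ^ N := by
  induction N with
  | zero =>
    intro b hb hb0
    have hcont : ContinuousOn (fun x => ‖b x‖) (K ×ˢ B) := (hb.continuousOn.mono hKB).norm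
    obtain ⟨C, hC⟩ := (hK.prod hB).bddAbove_image hcont
    refine ⟨max C 0 * μ.real B, by positivity, fun κ hκ him L hL => ?_⟩
    have hsupp : ∫ u, Complex.exp (Complex.I * L * Ψ (κ, u)) * b (κ, u) ∂μ
        = ∫ u in B, Complex.exp (Complex.I * L * Ψ (κ, u)) * b (κ, u) ∂μ := by
      rw [setIntegral_eq_integral_of_forall_compl_eq_zero]
      intro u hu
      simp [hb0 κ u hu]
    rw [hsupp, pow_zero, div_one]
    refine norm_setIntegral_le_of_norm_le_const hB.measure_lt_top fun u hu => ?_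
    rw [norm_mul, Complex.norm_exp]
    have h1 : Real.exp (Complex.I * L * Ψ (κ, u)).re ≤ 1 := by
      rw [Real.exp_le_one_iff]
      have : (Complex.I * L * Ψ (κ, u)).re = -(L * (Ψ (κ, u)).im) := by
        simp [mul_assoc, Complex.mul_re]
      rw [this]
      have := mul_nonneg hL.le (him u hu)
      linarith
    have h2 : ‖b (κ, u)‖ ≤ C := hC ⟨(κ, u), ⟨hκ, hu⟩, rfl⟩
    calc _ ≤ 1 * ‖b (κ, u)‖ := by gcongr
      _ ≤ max C 0 := by rw [one_mul]; exact h2.trans (le_max_left _ _)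
  | succ N ih =>
    intro b hb hb0
    -- One integration by parts: the derivative of `exp(iLΨ) q` along `e` is `iL exp(iLΨ) b` plus
    -- `exp(iLΨ)` times the derivative of `q`. Its integral vanishes, so a factor `L` is gained and
    -- the induction hypothesis applies to the derivative of `q`.
    set q : Q × U → ℂ := fun x => b x * (partialDir e Ψ x)⁻¹ with hq
    have hD := ContDiffOn.partialDir he hO hΨ
    have hqs : ContDiffOn ℝ ∞ q O := hb.mul (hD.inv hne)
    have hq0 : ∀ κ u, u ∉ B → q (κ, u) = 0 := fun κ u hu => by simp [hq, hb0 κ u hu]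
    have hzero : ∀ κ u, u ∉ B → q =ᶠ[𝓝 (κ, u)] fun _ => 0 := fun κ u hu => by
      have : ∀ᶠ x : Q × U in 𝓝 (κ, u), x.2 ∈ Bᶜ :=
        continuous_snd.continuousAt.eventually (hB.isClosed.isOpen_compl.mem_nhds hu)
      filter_upwards [this] with x hx using hq0 x.1 x.2 hx
    obtain ⟨C, hC0, hC⟩ := ih (partialDir e q) (ContDiffOn.partialDir he hO hqs) (fun κ u hu => by
      have := (hzero κ u hu).fderiv_eq (𝕜 := ℝ)
      simp [partialDir, this])
    refine ⟨C, hC0, fun κ hκ him L hL => ?_⟩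
    set E : Q × U → ℂ := fun x => Complex.exp (Complex.I * L * Ψ x) with hE
    have hEs : ContDiffOn ℝ ∞ E O := (contDiffOn_const.mul hΨ).cexp
    have hEq : ∀ u, ContDiffAt ℝ ∞ (fun x => E x * q x) (κ, u) := fun u => by
      by_cases hu : u ∈ B
      · exact ((hEs.mul hqs).contDiffAt (hO.mem_nhds (hKB ⟨hκ, hu⟩)))
      · have : (fun x => E x * q x) =ᶠ[𝓝 (κ, u)] fun _ => 0 := by
          filter_upwards [hzero κ u hu] with x hx
          simp [hx]
        exact contDiffAt_const.congr_of_eventuallyEq this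
    have hg : ContDiff ℝ ∞ fun u => E (κ, u) * q (κ, u) := contDiff_iff_contDiffAt.2 fun u =>
      (hEq u).comp u (contDiffAt_const.prodMk contDiffAt_id)
    have hgc : HasCompactSupport fun u => E (κ, u) * q (κ, u) :=
      HasCompactSupport.intro hB fun u hu => by simp [hq0 κ u hu]
    have hint := integral_fderiv_eq_zero_of_hasCompactSupport (μ := μ) hg hgc (e κ)
    have hpt : ∀ u, fderiv ℝ (fun u => E (κ, u) * q (κ, u)) u (e κ)
        = Complex.I * L * (E (κ, u) * b (κ, u)) + E (κ, u) * partialDir e q (κ, u) := fun u => by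
      rw [fderiv_comp_prodMk (f := fun x => E x * q x)
        ((hEq u).differentiableAt (by norm_num)) (e κ)]
      by_cases hu : u ∈ B
      · have hx : (κ, u) ∈ O := hKB ⟨hκ, hu⟩
        have d1 : DifferentiableAt ℝ Ψ (κ, u) :=
          (hΨ.contDiffAt (hO.mem_nhds hx)).differentiableAt (by norm_num)
        have d2 : DifferentiableAt ℝ q (κ, u) :=
          (hqs.contDiffAt (hO.mem_nhds hx)).differentiableAt (by norm_num)
        have d3 := (d1.hasFDerivAt.const_mul (Complex.I * L)).cexp
        rw [show fderiv ℝ (fun x => E x * q x) (κ, u) = _ from (d3.mul d2.hasFDerivAt).fderiv]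
        have hne' := hne _ hx
        have : q (κ, u) * partialDir e Ψ (κ, u) = b (κ, u) := inv_mul_cancel_right₀ hne' _
        rw [← this]
        simp only [partialDir, hE, add_apply, smul_apply,
          smul_eq_mul]
        ring
      · have h0 : (fun x => E x * q x) =ᶠ[𝓝 (κ, u)] fun _ => 0 := by
          filter_upwards [hzero κ u hu] with x hx
          simp [hx]
        rw [h0.fderiv_eq (𝕜 := ℝ)]
        have := (hzero κ u hu).fderiv_eq (𝕜 := ℝ)
        simp [partialDir, this, hb0 κ u hu]
    have hcont1 : Integrable (fun u => E (κ, u) * b (κ, u)) μ := by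
      have hs : ContDiff ℝ ∞ fun u => E (κ, u) * b (κ, u) := contDiff_iff_contDiffAt.2 fun u => by
        by_cases hu : u ∈ B
        · exact ((hEs.mul hb).contDiffAt (hO.mem_nhds (hKB ⟨hκ, hu⟩))).comp u
            (contDiffAt_const.prodMk contDiffAt_id)
        · have : (fun u => E (κ, u) * b (κ, u)) =ᶠ[𝓝 u] fun _ => 0 := by
            filter_upwards [hB.isClosed.isOpen_compl.mem_nhds hu] with x hx
            simp [hb0 κ x hx]
          exact contDiffAt_const.congr_of_eventuallyEq this
      exact hs.continuous.integrable_of_hasCompactSupport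
        (HasCompactSupport.intro hB fun u hu => by simp [hb0 κ u hu])
    have hcont2 : Integrable (fun u => fderiv ℝ (fun u => E (κ, u) * q (κ, u)) u (e κ)) μ :=
      ((hg.continuous_fderiv (by norm_num)).clm_apply
        continuous_const).integrable_of_hasCompactSupport (hgc.fderiv_apply ℝ _)
    have hcont3 : Integrable (fun u => E (κ, u) * partialDir e q (κ, u)) μ := by
      have := hcont2.sub (hcont1.const_mul (Complex.I * L))
      refine this.congr (ae_of_all _ fun u => ?_)
      simp only [Pi.sub_apply, hpt]
      ring
    simp_rw [hpt] at hint
    rw [integral_add (hcont1.const_mul _) hcont3, integral_const_mul] at hint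
    have hkey : (Complex.I * L) * ∫ u, E (κ, u) * b (κ, u) ∂μ
        = -∫ u, E (κ, u) * partialDir e q (κ, u) ∂μ := eq_neg_of_add_eq_zero_left hint
    have hnorm := congrArg norm hkey
    rw [norm_mul, norm_neg, norm_mul, Complex.norm_I, one_mul, Complex.norm_real,
      Real.norm_of_nonneg hL.le] at hnorm
    have := hC κ hκ him L hL
    rw [← hnorm] at this
    rw [pow_succ, ← div_div, le_div_iff₀ hL, mul_comm]
    exact this

end NonstationaryPhase

/-! ### Hadamard's lemma -/

section Hadamard

variable {Q : Type*} [NormedAddCommGroup Q] [NormedSpace ℝ Q]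

/-- Integrals over `[0, 1]` depend smoothly on parameters. -/
lemma contDiff_integral_unitInterval {F : Q × ℝ → ℂ} (hF : ContDiff ℝ ∞ F) :
    ContDiff ℝ ∞ fun x => ∫ s in (0 : ℝ)..1, F (x, s) := by
  let ρ : ContDiffBump (0 : ℝ) := ⟨1, 2, one_pos, one_lt_two⟩
  -- The integral is the convolution at `0` of the indicator of `(0, 1]` with `y ↦ ρ(y) F(x, -y)`.
  -- The bump `ρ` is `1` where it matters and supplies the compact support.
  have h := contDiffOn_convolution_right_with_param_comp (μ := volume) (n := ⊤)
    (ContinuousLinearMap.lsmul ℝ ℝ : ℝ →L[ℝ] ℂ →L[ℝ] ℂ) (s := (univ : Set Q))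
    (v := fun _ => (0 : ℝ)) contDiffOn_const (f := (Ioc (0 : ℝ) 1).indicator fun _ => (1 : ℝ))
    (g := fun x y => ρ y • F (x, -y)) (k := Metric.closedBall 0 2) isOpen_univ
    (isCompact_closedBall _ _) (fun p x _ hx => by
      have : ρ x = 0 := ρ.zero_of_le_dist (by
        simpa using (not_le.1 (Metric.mem_closedBall.not.1 hx)).le)
      simp [this])
    ((integrable_indicator_iff measurableSet_Ioc).2
      (integrableOn_const (by simp))).locallyIntegrable
    (by
      have h1 : ContDiff ℝ ∞ fun x : Q × ℝ => ρ x.2 • F (x.1, -x.2) :=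
        (ρ.contDiff.comp contDiff_snd).smul (hF.comp (by fun_prop))
      exact h1.contDiffOn)
  rw [contDiffOn_univ] at h
  convert h using 2 with x
  rw [convolution_def, intervalIntegral.integral_of_le zero_le_one,
    ← integral_indicator measurableSet_Ioc]
  refine integral_congr_ae (ae_of_all _ fun t => ?_)
  by_cases ht : t ∈ Ioc (0 : ℝ) 1
  · have : ρ (-t) = 1 := ρ.one_of_mem_closedBall (by
      simpa [abs_of_pos ht.1] using ht.2)
    simp [ht, this]
  · simp [ht]

/-- Hadamard's lemma with parameters. -/
lemma exists_eq_mul_of_eq_zero {G : ℝ × Q → ℂ} (hG : ContDiff ℝ ∞ G) (h0 : ∀ q, G (0, q) = 0) :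
    ∃ G₁ : ℝ × Q → ℂ, ContDiff ℝ ∞ G₁ ∧ (∀ t q, G (t, q) = t * G₁ (t, q)) ∧
      ∀ q, G₁ (0, q) = fderiv ℝ G (0, q) (1, 0) := by
  have hd : ContDiff ℝ ∞ fun x : ℝ × Q => fderiv ℝ G x (1, 0) :=
    (hG.fderiv_right (m := ∞) (by norm_num)).clm_apply contDiff_const
  refine ⟨fun x => ∫ s in (0 : ℝ)..1, fderiv ℝ G (s * x.1, x.2) (1, 0), ?_, fun t q => ?_,
    fun q => by simp⟩
  · exact contDiff_integral_unitInterval (Q := ℝ × Q)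
      (F := fun y => fderiv ℝ G (y.2 * y.1.1, y.1.2) (1, 0))
      (hd.comp (by fun_prop))
  · have hder : ∀ s ∈ uIcc (0 : ℝ) 1, HasDerivAt (fun s : ℝ => G (s * t, q))
        (t * fderiv ℝ G (s * t, q) (1, 0)) s := fun s _ => by
      have h1 : HasDerivAt (fun s : ℝ => ((s * t, q) : ℝ × Q)) (t, 0) s := by
        simpa using ((hasDerivAt_id s).mul_const t).prodMk (hasDerivAt_const s q)
      have h2 := (hG.differentiable (by norm_num) (s * t, q)).hasFDerivAt.comp_hasDerivAt s h1
      have h3 : fderiv ℝ G (s * t, q) (t, 0) = t * fderiv ℝ G (s * t, q) (1, 0) := by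
        rw [← Complex.real_smul, ← map_smul]
        simp
      rwa [h3] at h2
    have hc : Continuous fun s : ℝ => (t : ℂ) * fderiv ℝ G (s * t, q) (1, 0) :=
      continuous_const.mul (hd.continuous.comp (by fun_prop))
    have := intervalIntegral.integral_eq_sub_of_hasDerivAt hder (hc.intervalIntegrable 0 1)
    rw [intervalIntegral.integral_const_mul] at this
    simp [h0] at this
    exact this.symm

end Hadamard

/-! ### Smooth functions on a ball times the punctured space -/

section ConicFunctions

variable {E : Type*} [NormedAddCommGroup E] [InnerProductSpace ℝ E] [FiniteDimensional ℝ E]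

/-- The product of a ball around `0` and the punctured space. -/
def conicDomain (E : Type*) [NormedAddCommGroup E] (r : ℝ) : Set (E × E) :=
  Metric.ball 0 r ×ˢ {0}ᶜ

lemma isOpen_conicDomain (r : ℝ) : IsOpen (conicDomain E r) :=
  Metric.isOpen_ball.prod isOpen_compl_singleton

/-- A smooth cut-off supported in `conicDomain E r`, equal to `1` for `‖z‖ ≤ r / 2` and
`1 / 4 ≤ ‖p‖ ≤ 4`. -/
lemma exists_conic_cutoff {r : ℝ} (hr : 0 < r) :
    ∃ κ : E × E → ℝ, ContDiff ℝ ∞ κ ∧ tsupport κ ⊆ conicDomain E r ∧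
      ∀ z p : E, ‖z‖ ≤ r / 2 → 1 / 4 ≤ ‖p‖ → ‖p‖ ≤ 4 → κ (z, p) = 1 := by
  let b₁ : ContDiffBump (0 : E) := ⟨r / 2, 3 * r / 4, by positivity, by linarith⟩
  let b₂ : ContDiffBump (0 : E) := ⟨4, 5, by norm_num, by norm_num⟩
  let b₃ : ContDiffBump (0 : E) := ⟨1 / 16, 1 / 8, by norm_num, by norm_num⟩
  refine ⟨fun x => b₁ x.1 * (b₂ x.2 * (1 - b₃ x.2)), ?_, ?_, ?_⟩
  · exact (b₁.contDiff.comp contDiff_fst).mul ((b₂.contDiff.comp contDiff_snd).mul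
      (contDiff_const.sub (b₃.contDiff.comp contDiff_snd)))
  · have hclosed : IsClosed (Metric.closedBall (0 : E) (3 * r / 4) ×ˢ
        (Metric.ball (0 : E) (1 / 16))ᶜ) :=
      Metric.isClosed_closedBall.prod Metric.isOpen_ball.isClosed_compl
    refine (closure_minimal ?_ hclosed).trans ?_
    · rintro ⟨z, p⟩ h
      rw [Function.mem_support] at h
      refine ⟨?_, fun hp => h ?_⟩
      · by_contra hz
        refine h ?_
        have : b₁ z = 0 := b₁.zero_of_le_dist (by
          simpa using (not_le.1 (Metric.mem_closedBall.not.1 hz)).le)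
        simp [this]
      · have : b₃ p = 1 := b₃.one_of_mem_closedBall (Metric.ball_subset_closedBall hp)
        simp [this]
    · rintro ⟨z, p⟩ ⟨hz, hp⟩
      refine ⟨Metric.closedBall_subset_ball (by linarith) hz, ?_⟩
      rintro rfl
      exact hp (by simp)
  · intro z p hz hp hp'
    have h1 : b₁ z = 1 := b₁.one_of_mem_closedBall (by simpa using hz)
    have h2 : b₂ p = 1 := b₂.one_of_mem_closedBall (by simpa using hp')
    have h3 : b₃ p = 0 := b₃.zero_of_le_dist (by
      simp only [dist_zero_right]; exact le_trans (by norm_num) hp)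
    simp [h1, h2, h3]

lemma contDiff_of_contDiffAt_tsupport {F G : Type*} [NormedAddCommGroup F] [NormedSpace ℝ F]
    [NormedAddCommGroup G] [NormedSpace ℝ G] {f : G → F}
    (hf : ∀ x ∈ tsupport f, ContDiffAt ℝ ∞ f x) : ContDiff ℝ ∞ f :=
  contMDiff_iff_contDiff.1 (contMDiff_of_tsupport fun x hx => (hf x hx).contMDiffAt)

/-- Extension of a smooth function from a compact part of `conicDomain E r`. -/
lemma exists_contDiff_extension {F : Type*} [NormedAddCommGroup F] [NormedSpace ℝ F] {r : ℝ}
    (hr : 0 < r) :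
    ∃ κ : E × E → ℝ, ContDiff ℝ ∞ κ ∧
      (∀ f : E × E → F, ContDiffOn ℝ ∞ f (conicDomain E r) →
        ContDiff ℝ ∞ fun x => κ x • f x) ∧ tsupport κ ⊆ conicDomain E r ∧
      ∀ z p : E, ‖z‖ ≤ r / 2 → 1 / 4 ≤ ‖p‖ → ‖p‖ ≤ 4 → κ (z, p) = 1 := by
  obtain ⟨κ, hκ, hs, h1⟩ := exists_conic_cutoff (E := E) hr
  exact ⟨κ, hκ, fun f hf => contDiff_of_contDiffAt_tsupport fun x hx => by
    have hx' : x ∈ conicDomain E r := hs (tsupport_smul_subset_left κ f hx)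
    exact hκ.contDiffAt.smul (hf.contDiffAt ((isOpen_conicDomain r).mem_nhds hx')), hs, h1⟩

/-- Complex functions which are smooth on `conicDomain E r` and positively homogeneous of degree `k`
in the second variable. -/
structure IsConic (r : ℝ) (k : ℤ) (f : E × E → ℂ) : Prop where
  smooth : ContDiffOn ℝ ∞ f (conicDomain E r)
  homogeneous : ∀ z ∈ Metric.ball (0 : E) r, ∀ p : E, p ≠ 0 → ∀ t : ℝ, 0 < t →
    f (z, t • p) = (t : ℂ) ^ k * f (z, p)

lemma IsConic.mul {r : ℝ} {k l : ℤ} {f g : E × E → ℂ} (hf : IsConic r k f) (hg : IsConic r l g) :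
    IsConic r (k + l) fun x => f x * g x where
  smooth := hf.smooth.mul hg.smooth
  homogeneous z hz p hp t ht := by
    rw [hf.homogeneous z hz p hp t ht, hg.homogeneous z hz p hp t ht,
      zpow_add₀ (by exact_mod_cast ht.ne')]
    ring

/-- A phase perturbation: homogeneous of degree one, vanishing to second order at `z = 0`, with
nonnegative imaginary part. -/
structure IsPerturbation (r : ℝ) (W : E × E → ℂ) : Prop extends IsConic r 1 W where
  eq_zero : ∀ p : E, p ≠ 0 → W (0, p) = 0
  hasFDerivAt : ∀ p : E, p ≠ 0 → HasFDerivAt (fun z => W (z, p)) (0 : E →L[ℝ] ℂ) 0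
  im_nonneg : ∀ z ∈ Metric.ball (0 : E) r, ∀ p : E, p ≠ 0 → 0 ≤ (W (z, p)).im

/-- A function vanishing to second order at `z = 0` is `t ^ 2` times a smooth function of
`(t, u, ζ)` at `z = t u`. -/
lemma IsPerturbation.exists_quotient {r : ℝ} (hr : 0 < r) {W : E × E → ℂ}
    (hW : IsPerturbation r W) :
    ∃ M : ℝ × E × E → ℂ, ContDiff ℝ ∞ M ∧
      (∀ (t : ℝ) (u ζ : E), ‖t • u‖ ≤ r / 2 → 1 / 4 ≤ ‖ζ‖ → ‖ζ‖ ≤ 4 →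
        W (t • u, ζ) = (t : ℂ) ^ 2 * M (t, u, ζ)) := by
  obtain ⟨κ, hκ, hext, hs, h1⟩ := exists_contDiff_extension (E := E) (F := ℂ) hr
  have hsm := hext W hW.smooth
  -- After the cut-off the function is smooth everywhere, and its second-order vanishing at `z = 0`
  -- also holds at `ζ = 0`, outside the support of `κ`.
  have hz : ∀ ζ : E, κ (0, ζ) • W (0, ζ) = 0 := fun ζ => by
    by_cases h : ζ = 0
    · have : κ (0, ζ) = 0 := image_eq_zero_of_notMem_tsupport fun h' => (hs h').2 h
      simp [this]
    · simp [hW.eq_zero ζ h]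
  have hd : ∀ ζ : E, HasFDerivAt (fun z => κ (z, ζ) • W (z, ζ)) (0 : E →L[ℝ] ℂ) 0 := fun ζ => by
    by_cases h : ζ = 0
    · have : (fun z => κ (z, ζ) • W (z, ζ)) = fun _ => 0 := funext fun z => by
        have : κ (z, ζ) = 0 := image_eq_zero_of_notMem_tsupport fun h' => (hs h').2 h
        simp [this]
      rw [this]
      exact hasFDerivAt_const 0 0
    · have h2 : HasFDerivAt (fun z => κ (z, ζ)) _ 0 :=
        ((hκ.comp (contDiff_id.prodMk contDiff_const)).differentiable (by norm_num) 0).hasFDerivAt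
      have h3 := h2.smul (hW.hasFDerivAt ζ h)
      refine h3.congr_fderiv ?_
      simp [hW.eq_zero ζ h]
  obtain ⟨G₁, hG₁, hG₁t, hG₁0⟩ := exists_eq_mul_of_eq_zero (Q := E × E)
    (G := fun x => κ (x.1 • x.2.1, x.2.2) • W (x.1 • x.2.1, x.2.2))
    (hsm.comp (f := fun x : ℝ × E × E => (x.1 • x.2.1, x.2.2)) (by fun_prop))
    (fun q => by simpa using hz q.2)
  -- A second division by `t` is possible because `G₁` at `t = 0` is the first `t`-derivative, which
  -- vanishes with the `z`-derivative at `z = 0`.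
  obtain ⟨G₂, hG₂, hG₂t, -⟩ := exists_eq_mul_of_eq_zero hG₁ (fun q => by
    rw [hG₁0]
    have hc : HasDerivAt (fun t : ℝ => κ (t • q.1, q.2) • W (t • q.1, q.2)) 0 0 := by
      have h4 : HasDerivAt (fun t : ℝ => t • q.1) q.1 0 := by
        simpa using (hasDerivAt_id (0 : ℝ)).smul_const q.1
      have h5 : HasFDerivAt (fun z => κ (z, q.2) • W (z, q.2)) (0 : E →L[ℝ] ℂ)
        ((fun t : ℝ => t • q.1) 0) := by simpa using hd q.2
      exact h5.comp_hasDerivAt 0 h4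
    have h6 : DifferentiableAt ℝ
        (fun x : ℝ × E × E => κ (x.1 • x.2.1, x.2.2) • W (x.1 • x.2.1, x.2.2)) (0, q) :=
      (hsm.comp (f := fun x : ℝ × E × E => (x.1 • x.2.1, x.2.2))
        (by fun_prop)).differentiable (by norm_num) _
    have h7 : HasDerivAt (fun t : ℝ => ((t, q) : ℝ × E × E)) (1, 0) 0 :=
      (hasDerivAt_id 0).prodMk (hasDerivAt_const 0 q)
    have h8 := h6.hasFDerivAt.comp_hasDerivAt 0 h7
    exact h8.unique hc)
  refine ⟨G₂, hG₂, fun t u ζ htu hζ hζ' => ?_⟩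
  have := hG₁t t (u, ζ)
  simp only [h1 _ _ htu hζ hζ', one_smul] at this
  rw [this, hG₂t, pow_two, mul_assoc]

end ConicFunctions

/-! ### Wave packets -/

section WavePackets

variable {d : ℕ}

/-- A bump function supported in the unit ball. -/
def unitBump (d : ℕ) : ContDiffBump (0 : Coord d) := ⟨1 / 2, 1, by norm_num, by norm_num⟩

lemma unitBump_eq_zero {u : Coord d} (hu : u ∉ Metric.closedBall (0 : Coord d) 1) :
    unitBump d u = 0 :=
  (unitBump d).zero_of_le_dist (not_le.1 (Metric.mem_closedBall.not.1 hu)).le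

lemma unitBump_zero : unitBump d 0 = 1 :=
  (unitBump d).one_of_mem_closedBall (by simp [unitBump])

/-- The character `e^{-2πi⟨u,τ⟩}`. -/
def osc (τ u : Coord d) : ℂ := Complex.exp (((-2 * Real.pi * inner ℝ u τ : ℝ) : ℂ) * Complex.I)

lemma norm_osc (τ u : Coord d) : ‖osc τ u‖ = 1 := Complex.norm_exp_ofReal_mul_I _

lemma continuous_osc (τ : Coord d) : Continuous (osc τ) := by
  unfold osc
  fun_prop

/-- Rapid decay of Fourier integrals with parameters. -/
lemma exists_fourier_bound {P : Type*} [NormedAddCommGroup P] [NormedSpace ℝ P] {K : Set P}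
    (hK : IsCompact K) {S : P × Coord d → ℂ} (hS : ContDiff ℝ ∞ S) (N : ℕ) :
    ∃ C : ℝ, 0 ≤ C ∧ ∀ κ ∈ K, ∀ τ : Coord d,
      ‖∫ u, osc τ u * ((unitBump d u : ℂ) * S (κ, u))‖ ≤ C / (1 + ‖τ‖) ^ N := by
  have hKB : IsCompact (K ×ˢ Metric.closedBall (0 : Coord d) 1) :=
    hK.prod (isCompact_closedBall _ _)
  obtain ⟨C₁, hC₁⟩ := hKB.bddAbove_image hS.continuous.norm.continuousOn
  have hsm : ContDiff ℝ ∞ fun x : (Coord d × P) × Coord d =>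
      (unitBump d x.2 : ℂ) * S (x.1.2, x.2) :=
    (Complex.ofRealCLM.contDiff.comp ((unitBump d).contDiff.comp contDiff_snd)).mul
      (hS.comp (by fun_prop))
  -- The direction of `τ` is a parameter on the unit sphere and `‖τ‖` is the large parameter; the
  -- phase has derivative `-2π` along that direction.
  set Ψ : (Coord d × P) × Coord d → ℂ :=
    fun x => ((-2 * Real.pi * inner ℝ x.2 x.1.1 : ℝ) : ℂ) with hΨ
  have hΨs : ContDiff ℝ ∞ Ψ := by
    refine Complex.ofRealCLM.contDiff.comp ?_
    exact contDiff_const.mul (contDiff_snd.inner ℝ contDiff_fst.fst)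
  have hpd : ∀ x, partialDir (fun κ : Coord d × P => κ.1) Ψ x
      = ((-2 * Real.pi * inner ℝ x.1.1 x.1.1 : ℝ) : ℂ) := fun x => by
    have h1 := fderiv_comp_prodMk (hΨs.differentiable (by norm_num) (x.1, x.2)) x.1.1
    rw [partialDir, ← h1]
    have h2 : HasFDerivAt (fun u : Coord d => Ψ (x.1, u))
        (Complex.ofRealCLM.comp ((-2 * Real.pi) • (innerSL ℝ x.1.1))) x.2 := by
      have : (fun u : Coord d => Ψ (x.1, u))
          = Complex.ofRealCLM.comp ((-2 * Real.pi) • (innerSL ℝ x.1.1)) := by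
        ext u
        simp [hΨ, real_inner_comm]
      rw [this]
      exact ContinuousLinearMap.hasFDerivAt _
    rw [h2.fderiv]
    simp
  have hOo : IsOpen {x : (Coord d × P) × Coord d | x.1.1 ≠ 0} :=
    isOpen_ne_fun (by fun_prop) (by fun_prop)
  obtain ⟨C₂, hC₂0, hC₂⟩ := exists_nonstationary_bound (μ := (volume : Measure (Coord d)))
    hOo ((isCompact_sphere (0 : Coord d) 1).prod hK) (isCompact_closedBall (0 : Coord d) 1)
    (by
      rintro ⟨⟨e, p⟩, u⟩ ⟨⟨he, -⟩, -⟩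
      simp only [Metric.mem_sphere, dist_zero_right] at he
      simp only [mem_ofPred_eq]
      rintro rfl
      simp at he)
    hΨs.contDiffOn (e := fun κ => κ.1) contDiff_fst
    (fun x hx => by
      rw [hpd]
      have hx' : x.1.1 ≠ 0 := hx
      have : inner ℝ x.1.1 x.1.1 ≠ 0 := inner_self_ne_zero.2 hx'
      exact_mod_cast mul_ne_zero (by simp [Real.pi_ne_zero]) this) N _ hsm.contDiffOn
    (fun κ u hu => by simp [unitBump_eq_zero hu])
  set V := (volume : Measure (Coord d)).real (Metric.closedBall (0 : Coord d) 1)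
  refine ⟨2 ^ N * (max C₁ 0 * V + C₂), by positivity, fun κ hκ τ => ?_⟩
  rcases le_or_gt ‖τ‖ 1 with hτ | hτ
  · have h1 : ‖∫ u, osc τ u * ((unitBump d u : ℂ) * S (κ, u))‖ ≤ max C₁ 0 * V := by
      rw [← setIntegral_eq_integral_of_forall_compl_eq_zero
        (s := Metric.closedBall (0 : Coord d) 1) fun u hu => by simp [unitBump_eq_zero hu]]
      refine norm_setIntegral_le_of_norm_le_const measure_closedBall_lt_top fun u hu => ?_
      have h2 : ‖S (κ, u)‖ ≤ C₁ := hC₁ ⟨(κ, u), ⟨hκ, hu⟩, rfl⟩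
      have h3 : ‖(unitBump d u : ℂ)‖ ≤ 1 := by
        rw [Complex.norm_real, Real.norm_of_nonneg (unitBump d).nonneg]
        exact (unitBump d).le_one
      rw [norm_mul, norm_osc, one_mul, norm_mul]
      calc _ ≤ 1 * C₁ := by gcongr
        _ ≤ _ := by rw [one_mul]; exact le_max_left _ _
    refine h1.trans ?_
    rw [le_div_iff₀ (by positivity)]
    have : (1 + ‖τ‖) ^ N ≤ 2 ^ N := by gcongr; linarith
    calc _ ≤ (max C₁ 0 * V) * 2 ^ N := by gcongr
      _ ≤ _ := by
        have : 0 ≤ (2 : ℝ) ^ N * C₂ := by positivity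
        linarith
  · have h0 : 0 < ‖τ‖ := by linarith
    have h1 := hC₂ (‖τ‖⁻¹ • τ, κ) ⟨by simp [norm_smul, h0.ne'], hκ⟩ (fun u _ => by simp [hΨ]) ‖τ‖ h0
    have h2 : ∀ u, Complex.exp (Complex.I * ‖τ‖ * Ψ ((‖τ‖⁻¹ • τ, κ), u)) = osc τ u := fun u => by
      rw [osc]
      congr 1
      have : (‖τ‖ : ℂ) ≠ 0 := by exact_mod_cast h0.ne'
      simp only [hΨ, inner_smul_right]
      push_cast
      field_simp
    simp only [h2] at h1
    refine h1.trans ?_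
    rw [div_le_div_iff₀ (by positivity) (by positivity)]
    have : (1 + ‖τ‖) ^ N ≤ (2 * ‖τ‖) ^ N := by gcongr; linarith
    rw [mul_pow] at this
    have h3 : 0 ≤ max C₁ 0 * V := by positivity
    calc C₂ * (1 + ‖τ‖) ^ N ≤ C₂ * (2 ^ N * ‖τ‖ ^ N) := by gcongr
      _ ≤ (max C₁ 0 * V + C₂) * (2 ^ N * ‖τ‖ ^ N) := by gcongr; linarith
      _ = _ := by ring

/-- The covector `ε^{-5}(ξ + 2πετ)`. -/
def freq (ξ : Coord d) (ε : ℝ) (τ : Coord d) : Coord d :=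
  (ε ^ 5)⁻¹ • (ξ + (2 * Real.pi * ε) • τ)

/-- A length function on covectors: smooth, positive and homogeneous of degree one. -/
structure IsConicLength (r : ℝ) (H : Coord d × Coord d → ℝ) : Prop where
  smooth : ContDiffOn ℝ ∞ H (conicDomain (Coord d) r)
  homogeneous : ∀ z ∈ Metric.ball (0 : Coord d) r, ∀ p : Coord d, p ≠ 0 → ∀ t : ℝ, 0 < t →
    H (z, t • p) = t * H (z, p)
  pos : ∀ z ∈ Metric.ball (0 : Coord d) r, ∀ p : Coord d, p ≠ 0 → 0 < H (z, p)

/-- Covectors far from the frequency of the wave packet. -/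
theorem exists_far_bound {r : ℝ} (hr : 0 < r) {W A : Coord d × Coord d → ℂ}
    (hW : IsPerturbation r W) {k : ℕ} (hA : IsConic r (-k) A) {H : Coord d × Coord d → ℝ}
    (hH : IsConicLength r H) {ψ : ℝ → ℝ} (hψ : ContDiff ℝ ∞ ψ) (hψc : HasCompactSupport ψ)
    {ξ : Coord d} (hξ : ‖ξ‖ = 1) (N : ℕ) :
    ∃ C : ℝ, 0 ≤ C ∧ ∃ ε₀ : ℝ, 0 < ε₀ ∧ ∀ ε : ℝ, 0 < ε → ε ≤ ε₀ → ∀ θ : ℝ, 0 < θ →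
      ∀ τ : Coord d, 1 ≤ 4 * Real.pi * ε * ‖τ‖ → 1 ≤ ‖freq ξ ε τ‖ →
        ‖∫ u, osc τ u * (Complex.exp (Complex.I * W (ε ^ 4 • u, freq ξ ε τ)) *
          ((ψ (θ * H (ε ^ 4 • u, freq ξ ε τ)) : ℂ) * A (ε ^ 4 • u, freq ξ ε τ) *
            (unitBump d u : ℂ)))‖ ≤ C / ‖τ‖ ^ N := by
  obtain ⟨M, hM, hMW⟩ := hW.exists_quotient hr
  obtain ⟨κ, hκ, hext, hs, h1⟩ := exists_contDiff_extension (E := Coord d) (F := ℂ) hr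
  obtain ⟨κ', hκ', hext', hs', h1'⟩ := exists_contDiff_extension (E := Coord d) (F := ℝ) hr
  have hAs := hext A hA.smooth
  have hHs := hext' H hH.smooth
  -- lower bound for `H`
  have hcomp : IsCompact (Metric.closedBall (0 : Coord d) (r / 2) ×ˢ Metric.sphere (0 : Coord d) 1) :=
    (isCompact_closedBall _ _).prod (isCompact_sphere _ _)
  have hsub : Metric.closedBall (0 : Coord d) (r / 2) ×ˢ Metric.sphere (0 : Coord d) 1
      ⊆ conicDomain (Coord d) r := by
    rintro ⟨z, p⟩ ⟨hz, hp⟩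
    refine ⟨Metric.closedBall_subset_ball (by linarith) hz, ?_⟩
    rintro rfl
    simp at hp
  obtain ⟨x₀, hx₀, hmin⟩ := hcomp.exists_isMinOn ⟨(0, ξ), by simp; linarith, by simp [hξ]⟩
    (hH.smooth.continuousOn.mono hsub)
  have hh0 : 0 < H x₀ := hH.pos x₀.1 (hsub hx₀).1 x₀.2 (hsub hx₀).2
  obtain ⟨T, hT⟩ := hψc.isCompact.isBounded.subset_closedBall 0
  -- When `θ‖p‖ > Θ` the regularisation vanishes on the whole support of the bump. So `θ‖p‖` may be
  -- treated as a parameter in `[0, Θ]`, which makes the estimate uniform in `θ`.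
  set Θ : ℝ := max T 0 / H x₀
  -- bound for the derivative of `M`
  have hMd : Continuous fun x : (ℝ × Coord d × Coord d) × Coord d =>
      fderiv ℝ M x.1 (0, x.2, 0) :=
    ((hM.continuous_fderiv (by norm_num)).comp continuous_fst).clm_apply (by fun_prop)
  have hcomp2 : IsCompact ((Icc (0 : ℝ) 1 ×ˢ Metric.closedBall (0 : Coord d) 1 ×ˢ
      Metric.sphere (0 : Coord d) 1) ×ˢ Metric.sphere (0 : Coord d) 1) :=
    (isCompact_Icc.prod ((isCompact_closedBall _ _).prod (isCompact_sphere _ _))).prod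
      (isCompact_sphere _ _)
  obtain ⟨CM, hCM⟩ := hcomp2.bddAbove_image hMd.norm.continuousOn
  -- For `σ ≤ σ₀` the contribution of `σM` to the derivative of the phase is at most `1`, less than
  -- the `2π` coming from the linear part.
  set σ₀ : ℝ := 1 / (max CM 0 + 1) with hσ₀
  have hσ₀pos : 0 < σ₀ := by positivity
  -- the phase and the amplitude
  set Ψ : (Coord d × ℝ × ℝ × Coord d × ℝ) × Coord d → ℂ := fun x =>
    ((-2 * Real.pi * inner ℝ x.2 x.1.1 : ℝ) : ℂ) + (x.1.2.1 : ℂ) * M (x.1.2.2.1, x.2, x.1.2.2.2.1)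
    with hΨ
  have hΨ1 : ContDiff ℝ ∞ fun x : (Coord d × ℝ × ℝ × Coord d × ℝ) × Coord d =>
      ((-2 * Real.pi * inner ℝ x.2 x.1.1 : ℝ) : ℂ) :=
    Complex.ofRealCLM.contDiff.comp (contDiff_const.mul (contDiff_snd.inner ℝ contDiff_fst.fst))
  have hM' : ContDiff ℝ ∞ fun x : (Coord d × ℝ × ℝ × Coord d × ℝ) × Coord d =>
      M (x.1.2.2.1, x.2, x.1.2.2.2.1) := hM.comp (by fun_prop)
  have hΨs : ContDiff ℝ ∞ Ψ :=
    hΨ1.add ((Complex.ofRealCLM.contDiff.comp contDiff_fst.snd.fst).mul hM')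
  have hpd : ∀ x, partialDir (fun κ : Coord d × ℝ × ℝ × Coord d × ℝ => κ.1) Ψ x
      = ((-2 * Real.pi * inner ℝ x.1.1 x.1.1 : ℝ) : ℂ)
        + (x.1.2.1 : ℂ) * fderiv ℝ M (x.1.2.2.1, x.2, x.1.2.2.2.1) (0, x.1.1, 0) := fun x => by
    have h2 := fderiv_comp_prodMk (hΨs.differentiable (by norm_num) (x.1, x.2)) x.1.1
    rw [partialDir, ← h2]
    have h3 : HasFDerivAt (fun u : Coord d => ((-2 * Real.pi * inner ℝ u x.1.1 : ℝ) : ℂ))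
        (Complex.ofRealCLM.comp ((-2 * Real.pi) • (innerSL ℝ x.1.1))) x.2 := by
      have : (fun u : Coord d => ((-2 * Real.pi * inner ℝ u x.1.1 : ℝ) : ℂ))
          = Complex.ofRealCLM.comp ((-2 * Real.pi) • (innerSL ℝ x.1.1)) := by
        ext u
        simp [real_inner_comm]
      rw [this]
      exact ContinuousLinearMap.hasFDerivAt _
    have h5 := (hasFDerivAt_const (𝕜 := ℝ) x.1.2.2.1 x.2).prodMk
      ((hasFDerivAt_id (𝕜 := ℝ) x.2).prodMk (hasFDerivAt_const (𝕜 := ℝ) x.1.2.2.2.1 x.2))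
    have h6 := (hM.differentiable (by norm_num) (x.1.2.2.1, x.2, x.1.2.2.2.1)).hasFDerivAt
    have h4 := (h6.comp x.2 h5).const_mul (x.1.2.1 : ℂ)
    rw [show fderiv ℝ (fun u : Coord d => Ψ (x.1, u)) x.2 = _ from (h3.add h4).fderiv]
    simp
  set b : (Coord d × ℝ × ℝ × Coord d × ℝ) × Coord d → ℂ := fun x =>
    (ψ (x.1.2.2.2.2 * (κ' (x.1.2.2.1 • x.2, x.1.2.2.2.1) • H (x.1.2.2.1 • x.2, x.1.2.2.2.1))) : ℂ) *
      (κ (x.1.2.2.1 • x.2, x.1.2.2.2.1) • A (x.1.2.2.1 • x.2, x.1.2.2.2.1)) *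
        (unitBump d x.2 : ℂ) with hb
  have hbs : ContDiff ℝ ∞ b := by
    refine ((Complex.ofRealCLM.contDiff.comp (hψ.comp ?_)).mul ?_).mul
      (Complex.ofRealCLM.contDiff.comp ((unitBump d).contDiff.comp contDiff_snd))
    · exact contDiff_fst.snd.snd.snd.snd.mul (hHs.comp
        (f := fun x : (Coord d × ℝ × ℝ × Coord d × ℝ) × Coord d =>
          (x.1.2.2.1 • x.2, x.1.2.2.2.1)) (by fun_prop))
    · exact hAs.comp (f := fun x : (Coord d × ℝ × ℝ × Coord d × ℝ) × Coord d =>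
          (x.1.2.2.1 • x.2, x.1.2.2.2.1)) (by fun_prop)
  have hOo : IsOpen {x | partialDir (fun κ : Coord d × ℝ × ℝ × Coord d × ℝ => κ.1) Ψ x ≠ 0} := by
    refine isOpen_ne_fun ?_ continuous_const
    have := ContDiffOn.partialDir (e := fun κ : Coord d × ℝ × ℝ × Coord d × ℝ => κ.1)
      contDiff_fst isOpen_univ hΨs.contDiffOn
    exact continuousOn_univ.1 this.continuousOn
  have hKc : IsCompact (Metric.sphere (0 : Coord d) 1 ×ˢ Icc (0 : ℝ) σ₀ ×ˢ Icc (0 : ℝ) 1 ×ˢ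
      Metric.sphere (0 : Coord d) 1 ×ˢ Icc (0 : ℝ) Θ) :=
    (isCompact_sphere _ _).prod (isCompact_Icc.prod (isCompact_Icc.prod
      ((isCompact_sphere _ _).prod isCompact_Icc)))
  obtain ⟨C, hC0, hC⟩ := exists_nonstationary_bound (μ := (volume : Measure (Coord d)))
    hOo hKc (isCompact_closedBall (0 : Coord d) 1)
    (by
      rintro ⟨⟨e, σ, t, w, θ⟩, u⟩ ⟨⟨he, hσ, ht, hw, -⟩, hu⟩
      simp only [mem_ofPred_eq, hpd]
      have h3 : ‖fderiv ℝ M (t, u, w) (0, e, 0)‖ ≤ CM :=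
        hCM ⟨((t, u, w), e), ⟨⟨ht, hu, hw⟩, he⟩, rfl⟩
      have h4 : σ * ‖fderiv ℝ M (t, u, w) (0, e, 0)‖ ≤ 1 := by
        calc _ ≤ σ₀ * (max CM 0 + 1) := by
              apply mul_le_mul hσ.2 _ (norm_nonneg _) hσ₀pos.le
              exact h3.trans ((le_max_left _ _).trans (by linarith))
          _ = 1 := by rw [hσ₀]; field_simp
      simp only [Metric.mem_sphere, dist_zero_right] at he
      rw [real_inner_self_eq_norm_sq, he]
      intro h5
      have h6 := congrArg norm (eq_neg_of_add_eq_zero_right h5)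
      rw [norm_neg, norm_mul, Complex.norm_real, Complex.norm_real,
        Real.norm_of_nonneg hσ.1] at h6
      rw [h6] at h4
      have h7 : ‖(-2 * Real.pi * 1 ^ 2 : ℝ)‖ = 2 * Real.pi := by
        rw [Real.norm_eq_abs]
        simp [abs_mul, abs_of_pos Real.pi_pos]
      rw [h7] at h4
      linarith [Real.pi_gt_three])
    hΨs.contDiffOn (e := fun κ => κ.1) contDiff_fst (fun x hx => hx) N b hbs.contDiffOn
    (fun κ u hu => by simp [hb, unitBump_eq_zero hu])
  have hpi := Real.pi_pos
  refine ⟨C, hC0, min 1 (min (r / 2) (σ₀ / (6 * Real.pi))), by positivity,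
    fun ε hε hε0 θ hθ τ hτ hp => ?_⟩
  have he1 : ε ≤ 1 := hε0.trans (min_le_left _ _)
  have he2 : ε ≤ r / 2 := hε0.trans ((min_le_right _ _).trans (min_le_left _ _))
  have he3 : ε ≤ σ₀ / (6 * Real.pi) := hε0.trans ((min_le_right _ _).trans (min_le_right _ _))
  have he4 : ε ^ 4 ≤ ε := by
    calc ε ^ 4 ≤ ε ^ 1 := pow_le_pow_of_le_one hε.le he1 (by norm_num)
      _ = ε := pow_one ε
  have hτ0 : 0 < ‖τ‖ := by
    by_contra h
    have : ‖τ‖ = 0 := le_antisymm (not_lt.1 h) (norm_nonneg _)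
    rw [this] at hτ
    norm_num at hτ
  set p := freq ξ ε τ with hpdef
  have hp0 : 0 < ‖p‖ := by linarith
  set w : Coord d := ‖p‖⁻¹ • p with hw
  have hw1 : ‖w‖ = 1 := by simp [hw, norm_smul, hp0.ne']
  have hpw : p = ‖p‖ • w := by rw [hw, smul_smul, mul_inv_cancel₀ hp0.ne', one_smul]
  have hw0 : w ≠ 0 := by rintro h; simp [h] at hw1
  -- By homogeneity and the quotient `M`, `W(ε⁴u, p) = ‖p‖ ε⁸ M(ε⁴, u, w) = ‖τ‖ σ M(ε⁴, u, w)`. At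
  -- far frequencies `‖p‖ ≤ 6πε⁻⁴‖τ‖`, whence `σ ≤ 6πε⁴` is small.
  set σ : ℝ := ‖p‖ * ε ^ 8 / ‖τ‖ with hσ
  have hpn : ‖p‖ ≤ (ε ^ 5)⁻¹ * (6 * Real.pi * ε * ‖τ‖) := by
    rw [hpdef, freq, norm_smul, Real.norm_of_nonneg (by positivity)]
    gcongr
    calc _ ≤ ‖ξ‖ + ‖(2 * Real.pi * ε) • τ‖ := norm_add_le _ _
      _ = 1 + 2 * Real.pi * ε * ‖τ‖ := by
        rw [hξ, norm_smul, Real.norm_of_nonneg (by positivity)]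
      _ ≤ _ := by linarith
  have hσ1 : σ ≤ σ₀ := by
    calc σ ≤ ((ε ^ 5)⁻¹ * (6 * Real.pi * ε * ‖τ‖)) * ε ^ 8 / ‖τ‖ := by rw [hσ]; gcongr
      _ = 6 * Real.pi * ε ^ 4 := by field_simp
      _ ≤ 6 * Real.pi * (σ₀ / (6 * Real.pi)) := by gcongr; exact he4.trans he3
      _ = σ₀ := by field_simp
  have hball : ∀ u ∈ Metric.closedBall (0 : Coord d) 1, ‖ε ^ 4 • u‖ ≤ r / 2 := fun u hu => by
    rw [norm_smul, Real.norm_of_nonneg (by positivity)]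
    have : ‖u‖ ≤ 1 := by simpa using hu
    calc ε ^ 4 * ‖u‖ ≤ ε ^ 4 * 1 := by gcongr
      _ ≤ r / 2 := by linarith
  have hball' : ∀ u ∈ Metric.closedBall (0 : Coord d) 1,
      ε ^ 4 • u ∈ Metric.ball (0 : Coord d) r := fun u hu => by
    have := hball u hu
    simp only [Metric.mem_ball, dist_zero_right]
    linarith
  have hHp : ∀ u ∈ Metric.closedBall (0 : Coord d) 1,
      H (ε ^ 4 • u, p) = ‖p‖ * H (ε ^ 4 • u, w) := fun u hu => by
    conv_lhs => rw [hpw]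
    exact hH.homogeneous _ (hball' u hu) _ hw0 _ hp0
  rcases le_or_gt (θ * ‖p‖) Θ with hΘ | hΘ
  · have hMu : ∀ u ∈ Metric.closedBall (0 : Coord d) 1,
        W (ε ^ 4 • u, p) = (‖τ‖ : ℂ) * ((σ : ℂ) * M (ε ^ 4, u, w)) := fun u hu => by
      conv_lhs => rw [hpw]
      rw [hW.homogeneous _ (hball' u hu) _ hw0 _ hp0,
        hMW (ε ^ 4) u w (hball u hu) (by rw [hw1]; norm_num) (by rw [hw1]; norm_num), zpow_one, hσ]
      have : (‖τ‖ : ℂ) ≠ 0 := by exact_mod_cast hτ0.ne'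
      push_cast
      field_simp
    have hΨu : ∀ u ∈ Metric.closedBall (0 : Coord d) 1,
        (‖τ‖ : ℂ) * Ψ ((‖τ‖⁻¹ • τ, σ, ε ^ 4, w, θ * ‖p‖), u)
          = ((-2 * Real.pi * inner ℝ u τ : ℝ) : ℂ) + W (ε ^ 4 • u, p) := fun u hu => by
      rw [hMu u hu, hΨ]
      have : (‖τ‖ : ℂ) ≠ 0 := by exact_mod_cast hτ0.ne'
      simp only [inner_smul_right]
      push_cast
      field_simp
    have him : ∀ u ∈ Metric.closedBall (0 : Coord d) 1,
        0 ≤ (Ψ ((‖τ‖⁻¹ • τ, σ, ε ^ 4, w, θ * ‖p‖), u)).im := fun u hu => by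
      have h2 := congrArg Complex.im (hΨu u hu)
      replace h2 := (Complex.im_ofReal_mul _ _).symm.trans
        (h2.trans ((Complex.add_im _ _).trans (by rw [Complex.ofReal_im, zero_add])))
      have h3 := hW.im_nonneg _ (hball' u hu) p (norm_pos_iff.1 hp0)
      rw [← h2] at h3
      exact nonneg_of_mul_nonneg_right h3 hτ0
    have hfin := hC (‖τ‖⁻¹ • τ, σ, ε ^ 4, w, θ * ‖p‖)
      ⟨by simp [norm_smul, hτ0.ne'], ⟨by positivity, hσ1⟩, ⟨by positivity, by linarith⟩,
        by simp [hw1], ⟨by positivity, hΘ⟩⟩ him ‖τ‖ hτ0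
    have hint : ∫ u, osc τ u * (Complex.exp (Complex.I * W (ε ^ 4 • u, p)) *
          ((ψ (θ * H (ε ^ 4 • u, p)) : ℂ) * A (ε ^ 4 • u, p) * (unitBump d u : ℂ)))
        = ((‖p‖ : ℂ) ^ (-(k : ℤ))) * ∫ u, Complex.exp (Complex.I * ‖τ‖ *
          Ψ ((‖τ‖⁻¹ • τ, σ, ε ^ 4, w, θ * ‖p‖), u)) * b ((‖τ‖⁻¹ • τ, σ, ε ^ 4, w, θ * ‖p‖), u) := by
      rw [← integral_const_mul]
      refine integral_congr_ae (ae_of_all _ fun u => ?_)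
      by_cases hu : u ∈ Metric.closedBall (0 : Coord d) 1
      · have h2 : osc τ u * Complex.exp (Complex.I * W (ε ^ 4 • u, p))
            = Complex.exp (Complex.I * ‖τ‖ *
              Ψ ((‖τ‖⁻¹ • τ, σ, ε ^ 4, w, θ * ‖p‖), u)) := by
          rw [osc, ← Complex.exp_add, mul_assoc Complex.I, hΨu u hu]
          congr 1
          ring
        have h3 : A (ε ^ 4 • u, p) = (‖p‖ : ℂ) ^ (-(k : ℤ)) * A (ε ^ 4 • u, w) := by
          conv_lhs => rw [hpw]
          exact hA.homogeneous _ (hball' u hu) _ hw0 _ hp0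
        simp only [hb, hHp u hu, h3,
          h1 (ε ^ 4 • u) w (hball u hu) (by rw [hw1]; norm_num) (by rw [hw1]; norm_num),
          h1' (ε ^ 4 • u) w (hball u hu) (by rw [hw1]; norm_num) (by rw [hw1]; norm_num), one_smul,
          ← mul_assoc]
        linear_combination ((ψ (θ * ‖p‖ * H (ε ^ 4 • u, w)) : ℂ) * (‖p‖ : ℂ) ^ (-(k : ℤ)) *
          A (ε ^ 4 • u, w) * (unitBump d u : ℂ)) * h2
      · simp [hb, unitBump_eq_zero hu]
    rw [hint, norm_mul]
    have h2 : ‖(‖p‖ : ℂ) ^ (-(k : ℤ))‖ ≤ 1 := by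
      rw [norm_zpow, Complex.norm_real, norm_norm, zpow_neg, zpow_natCast]
      exact inv_le_one_of_one_le₀ (one_le_pow₀ hp)
    calc _ ≤ 1 * (C / ‖τ‖ ^ N) := by gcongr
      _ = _ := one_mul _
  · have hint : ∫ u, osc τ u * (Complex.exp (Complex.I * W (ε ^ 4 • u, p)) *
          ((ψ (θ * H (ε ^ 4 • u, p)) : ℂ) * A (ε ^ 4 • u, p) * (unitBump d u : ℂ))) = 0 := by
      rw [← integral_zero (Coord d) ℂ]
      refine integral_congr_ae (ae_of_all _ fun u => ?_)
      by_cases hu : u ∈ Metric.closedBall (0 : Coord d) 1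
      · have h2 : H x₀ ≤ H (ε ^ 4 • u, w) :=
          hmin (show (ε ^ 4 • u, w) ∈ _ from ⟨by simpa using hball u hu, by simp [hw1]⟩)
        have h3 : max T 0 < θ * H (ε ^ 4 • u, p) := by
          rw [hHp u hu, ← mul_assoc]
          calc max T 0 = Θ * H x₀ := by simp only [Θ]; field_simp
            _ < θ * ‖p‖ * H x₀ := by gcongr
            _ ≤ _ := by gcongr
        have h4 : ψ (θ * H (ε ^ 4 • u, p)) = 0 := image_eq_zero_of_notMem_tsupport fun h => by
          have := hT h
          simp only [Metric.mem_closedBall, dist_zero_right, Real.norm_eq_abs] at this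
          have h5 := (le_abs_self _).trans this
          linarith [le_max_left T 0]
        simp [h4]
      · simp [unitBump_eq_zero hu]
    rw [hint, norm_zero]
    positivity

end WavePackets

/-! ### Expansion of the packet integrals at frequencies near `ξ` -/

section NearFrequencies

variable {d : ℕ}

/-- Fourier moments of the bump function. -/
def moment (m : Coord d → ℂ) (τ : Coord d) : ℂ := ∫ u, osc τ u * ((unitBump d u : ℂ) * m u)

lemma integrable_moment {m : Coord d → ℂ} (hm : Continuous m) (τ : Coord d) :
    Integrable fun u => osc τ u * ((unitBump d u : ℂ) * m u) := by
  refine Continuous.integrable_of_hasCompactSupport ?_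
    (HasCompactSupport.intro (isCompact_closedBall (0 : Coord d) 1) fun u hu => by
      simp [unitBump_eq_zero hu])
  exact (continuous_osc τ).mul
    ((Complex.continuous_ofReal.comp (unitBump d).continuous).mul hm)

lemma norm_freq_base {ξ : Coord d} (hξ : ‖ξ‖ = 1) {ε : ℝ} (hε : 0 < ε) {τ : Coord d}
    (hτ : 4 * Real.pi * ε * ‖τ‖ ≤ 1) :
    ξ + (2 * Real.pi * ε) • τ ∈ Metric.closedBall ξ (1 / 2) ∧
      1 / 2 ≤ ‖ξ + (2 * Real.pi * ε) • τ‖ ∧ ‖ξ + (2 * Real.pi * ε) • τ‖ ≤ 3 / 2 := by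
  have hpi := Real.pi_pos
  have h1 : ‖(2 * Real.pi * ε) • τ‖ ≤ 1 / 2 := by
    rw [norm_smul, Real.norm_of_nonneg (by positivity)]
    linarith
  refine ⟨by simpa using h1, ?_, ?_⟩
  · have := norm_sub_le (ξ + (2 * Real.pi * ε) • τ) ((2 * Real.pi * ε) • τ)
    rw [add_sub_cancel_right, hξ] at this
    linarith
  · have := norm_add_le ξ ((2 * Real.pi * ε) • τ)
    linarith

lemma norm_smul_le_of_mem_unitBall {ε : ℝ} (hε : 0 < ε) (he1 : ε ≤ 1) {R : ℝ} (he2 : ε ≤ R)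
    {u : Coord d} (hu : u ∈ Metric.closedBall (0 : Coord d) 1) : ‖ε ^ 4 • u‖ ≤ R := by
  have he4 : ε ^ 4 ≤ ε := by
    calc ε ^ 4 ≤ ε ^ 1 := pow_le_pow_of_le_one hε.le he1 (by norm_num)
      _ = ε := pow_one ε
  rw [norm_smul, Real.norm_of_nonneg (by positivity)]
  have : ‖u‖ ≤ 1 := by simpa using hu
  calc ε ^ 4 * ‖u‖ ≤ ε ^ 4 * 1 := by gcongr
    _ ≤ R := by linarith

/-- The integrand at frequencies near `ξ`, after rescaling. -/
lemma near_integrand {r : ℝ} {W A : Coord d × Coord d → ℂ}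
    (hW : IsPerturbation r W) {k : ℕ} (hA : IsConic r (-k) A) {M : ℝ × Coord d × Coord d → ℂ}
    (hMW : ∀ (t : ℝ) (u ζ : Coord d), ‖t • u‖ ≤ r / 2 → 1 / 4 ≤ ‖ζ‖ → ‖ζ‖ ≤ 4 →
      W (t • u, ζ) = (t : ℂ) ^ 2 * M (t, u, ζ)) (hr : 0 < r) {ξ τ : Coord d} {ε : ℝ} (hε : 0 < ε)
    {u : Coord d} (hu : ‖ε ^ 4 • u‖ ≤ r / 2) (h1 : 1 / 2 ≤ ‖ξ + (2 * Real.pi * ε) • τ‖)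
    (h2 : ‖ξ + (2 * Real.pi * ε) • τ‖ ≤ 3 / 2) :
    Complex.exp (Complex.I * W (ε ^ 4 • u, freq ξ ε τ)) * A (ε ^ 4 • u, freq ξ ε τ)
      = (ε : ℂ) ^ (5 * k) * (Complex.exp (Complex.I * ((ε : ℂ) ^ 3 *
          M (ε ^ 4, u, ξ + (2 * Real.pi * ε) • τ))) *
          A (ε ^ 4 • u, ξ + (2 * Real.pi * ε) • τ)) := by
  have hz : ε ^ 4 • u ∈ Metric.ball (0 : Coord d) r := by
    simp only [Metric.mem_ball, dist_zero_right]
    linarith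
  have h0 : ξ + (2 * Real.pi * ε) • τ ≠ 0 := by
    intro h
    rw [h, norm_zero] at h1
    norm_num at h1
  have hεc : (ε : ℂ) ≠ 0 := by exact_mod_cast hε.ne'
  rw [freq, hW.homogeneous _ hz _ h0 _ (by positivity), hA.homogeneous _ hz _ h0 _ (by positivity),
    hMW _ _ _ hu (by linarith) (by linarith)]
  have h3 : (((ε ^ 5)⁻¹ : ℝ) : ℂ) ^ (1 : ℤ) * (((ε ^ 4 : ℝ) : ℂ) ^ 2 *
      M (ε ^ 4, u, ξ + (2 * Real.pi * ε) • τ)) = (ε : ℂ) ^ 3 *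
      M (ε ^ 4, u, ξ + (2 * Real.pi * ε) • τ) := by
    push_cast
    rw [zpow_one]
    field_simp
  have h4 : (((ε ^ 5)⁻¹ : ℝ) : ℂ) ^ (-(k : ℤ)) = (ε : ℂ) ^ (5 * k) := by
    push_cast
    rw [zpow_neg, zpow_natCast, inv_pow, inv_inv, pow_mul]
  rw [h3, h4]
  ring

/-- Frequencies near `ξ`: leading order. -/
theorem exists_near_bound {r : ℝ} (hr : 0 < r) {W A : Coord d × Coord d → ℂ}
    (hW : IsPerturbation r W) {k : ℕ} (hA : IsConic r (-k) A) {ξ : Coord d} (hξ : ‖ξ‖ = 1)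
    (N : ℕ) :
    ∃ C : ℝ, 0 ≤ C ∧ ∃ ε₀ : ℝ, 0 < ε₀ ∧ ∀ ε : ℝ, 0 < ε → ε ≤ ε₀ → ∀ τ : Coord d,
      4 * Real.pi * ε * ‖τ‖ ≤ 1 →
        ‖(∫ u, osc τ u * (Complex.exp (Complex.I * W (ε ^ 4 • u, freq ξ ε τ)) *
          (A (ε ^ 4 • u, freq ξ ε τ) * (unitBump d u : ℂ)))) -
          (ε : ℂ) ^ (5 * k) * (A (0, ξ + (2 * Real.pi * ε) • τ) * moment (fun _ => 1) τ)‖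
          ≤ C * ε ^ (5 * k + 1) / (1 + ‖τ‖) ^ N := by
  obtain ⟨M, hM, hMW⟩ := hW.exists_quotient hr
  obtain ⟨κ, hκ, hext, hs, h1⟩ := exists_contDiff_extension (E := Coord d) (F := ℂ) hr
  have hAs := hext A hA.smooth
  -- The difference between the rescaled integrand and its value at `ε = 0` is `ε` times a function
  -- smooth in `(ε, ζ, u)`. Its Fourier transform in `u` decays rapidly, uniformly for `(ε, ζ)` in a
  -- compact set.
  obtain ⟨S, hS, hSt, -⟩ := exists_eq_mul_of_eq_zero (Q := (Coord d × Coord d))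
    (G := fun x => Complex.exp (Complex.I * ((x.1 : ℂ) ^ 3 * M (x.1 ^ 4, x.2.2, x.2.1))) *
      (κ (x.1 ^ 4 • x.2.2, x.2.1) • A (x.1 ^ 4 • x.2.2, x.2.1)) - κ (0, x.2.1) • A (0, x.2.1))
    (by
      refine ((contDiff_const.mul (((Complex.ofRealCLM.contDiff.comp contDiff_fst).pow 3).mul
        (hM.comp (by fun_prop)))).cexp.mul (hAs.comp
          (f := fun x : ℝ × Coord d × Coord d => (x.1 ^ 4 • x.2.2, x.2.1)) (by fun_prop))).sub
        (hAs.comp (f := fun x : ℝ × Coord d × Coord d => ((0 : Coord d), x.2.1)) (by fun_prop)))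
    (fun q => by simp)
  obtain ⟨C, hC0, hC⟩ := exists_fourier_bound (P := ℝ × Coord d)
    ((isCompact_Icc (a := (0 : ℝ)) (b := 1)).prod (isCompact_closedBall ξ (1 / 2)))
    (S := fun x => S (x.1.1, x.1.2, x.2)) (hS.comp (by fun_prop)) N
  refine ⟨C, hC0, min 1 (r / 2), by positivity, fun ε hε hε0 τ hτ => ?_⟩
  have he1 : ε ≤ 1 := hε0.trans (min_le_left _ _)
  have he2 : ε ≤ r / 2 := hε0.trans (min_le_right _ _)
  obtain ⟨hζ, hζ1, hζ2⟩ := norm_freq_base hξ hε hτ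
  have hk : ∀ z : Coord d, ‖z‖ ≤ r / 2 → κ (z, ξ + (2 * Real.pi * ε) • τ) = 1 := fun z hz =>
    h1 _ _ hz (by linarith) (by linarith)
  have hpt : ∀ u, osc τ u * (Complex.exp (Complex.I * W (ε ^ 4 • u, freq ξ ε τ)) *
      (A (ε ^ 4 • u, freq ξ ε τ) * (unitBump d u : ℂ)))
      = (ε : ℂ) ^ (5 * k) * (A (0, ξ + (2 * Real.pi * ε) • τ) *
          (osc τ u * ((unitBump d u : ℂ) * 1)))
        + (ε : ℂ) ^ (5 * k + 1) * (osc τ u * ((unitBump d u : ℂ) *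
          S (ε, ξ + (2 * Real.pi * ε) • τ, u))) := fun u => by
    by_cases hu : u ∈ Metric.closedBall (0 : Coord d) 1
    · have hu' := norm_smul_le_of_mem_unitBall hε he1 he2 hu
      have h2 := near_integrand hW hA hMW hr hε hu' hζ1 hζ2
      have h3 := hSt ε (ξ + (2 * Real.pi * ε) • τ, u)
      simp only [hk _ hu', hk 0 (by simp; linarith), one_smul] at h3
      rw [show (ε : ℂ) ^ (5 * k + 1) = (ε : ℂ) ^ (5 * k) * ε from pow_succ _ _]
      linear_combination osc τ u * (unitBump d u : ℂ) * h2 +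
        (ε : ℂ) ^ (5 * k) * osc τ u * (unitBump d u : ℂ) * h3
    · simp [unitBump_eq_zero hu]
  simp_rw [hpt]
  rw [integral_add (((integrable_moment continuous_const τ).const_mul _).const_mul _)
    ((integrable_moment (m := fun u => S (ε, ξ + (2 * Real.pi * ε) • τ, u))
      (hS.continuous.comp (by fun_prop)) τ).const_mul _), integral_const_mul, integral_const_mul,
    integral_const_mul, moment, add_sub_cancel_left, norm_mul, norm_pow, Complex.norm_real,
    Real.norm_of_nonneg hε.le]
  have := hC (ε, ξ + (2 * Real.pi * ε) • τ) ⟨⟨hε.le, he1⟩, hζ⟩ τ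
  calc _ ≤ ε ^ (5 * k + 1) * (C / (1 + ‖τ‖) ^ N) := by gcongr
    _ = _ := by ring

/-- Half of the second derivatives of `W` at `z = 0`. -/
def hessCoeff (W : Coord d × Coord d → ℂ) (a b : Fin d) (p : Coord d) : ℂ :=
  2⁻¹ * fderiv ℝ (fun x => fderiv ℝ W x (stdVec b, 0)) (0, p) (stdVec a, 0)

/-- The first derivatives of `V` at `z = 0`. -/
def gradCoeff (V : Coord d × Coord d → ℂ) (b : Fin d) (p : Coord d) : ℂ :=
  fderiv ℝ V (0, p) (stdVec b, 0)

lemma sum_smul_stdVec (u : Coord d) : ∑ a, u a • (stdVec a : Coord d) = u := by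
  ext i
  simp [stdVec, Finset.sum_apply, Pi.single_apply]

lemma clm_prod_apply_eq_sum (L : Coord d × Coord d →L[ℝ] ℂ) (u : Coord d) :
    L (u, 0) = ∑ a, (u a : ℂ) * L (stdVec a, 0) := by
  have : ((u, 0) : Coord d × Coord d) = ∑ a, u a • ((stdVec a, 0) : Coord d × Coord d) := by
    conv_lhs => rw [← sum_smul_stdVec u]
    ext <;> simp [Prod.fst_sum, Prod.snd_sum]
  rw [this, map_sum]
  exact Finset.sum_congr rfl fun a _ => by rw [map_smul, Complex.real_smul]

lemma zero_mem_conicDomain {r : ℝ} (hr : 0 < r) {p : Coord d} (hp : p ≠ 0) :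
    (0, p) ∈ conicDomain (Coord d) r := ⟨by simpa using hr, hp⟩

/-- Differentiating `W(tu, ζ) = t² M(t, u, ζ)` twice at `t = 0` gives `2M(0, u, ζ)` on the right and
the second derivative of `W` along `u` on the left. This identifies the coefficient of `ε³`. -/
lemma quotient_zero {r : ℝ} (hr : 0 < r) {W : Coord d × Coord d → ℂ}
    (hW : ContDiffOn ℝ ∞ W (conicDomain (Coord d) r)) {M : ℝ × Coord d × Coord d → ℂ}
    (hM : ContDiff ℝ ∞ M)
    (hMW : ∀ (t : ℝ) (u ζ : Coord d), ‖t • u‖ ≤ r / 2 → 1 / 4 ≤ ‖ζ‖ → ‖ζ‖ ≤ 4 →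
      W (t • u, ζ) = (t : ℂ) ^ 2 * M (t, u, ζ)) {ζ : Coord d} (h1 : 1 / 4 ≤ ‖ζ‖) (h2 : ‖ζ‖ ≤ 4)
    (u : Coord d) :
    M (0, u, ζ) = ∑ b, ∑ a, hessCoeff W a b ζ * ((u a : ℂ) * (u b : ℂ)) := by
  have hζ0 : ζ ≠ 0 := by rintro rfl; norm_num at h1
  have hO := isOpen_conicDomain (E := Coord d) r
  have hcur : ∀ t : ℝ, HasDerivAt (fun t : ℝ => ((t • u, ζ) : Coord d × Coord d)) (u, 0) t :=
    fun t => by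
      simpa using ((hasDerivAt_id t).smul_const u).prodMk (hasDerivAt_const t ζ)
  have hd : ContDiffOn ℝ ∞ (fun x => fderiv ℝ W x (u, 0)) (conicDomain (Coord d) r) :=
    (hW.fderiv_of_isOpen hO (m := ∞) (by norm_num)).clm_apply contDiffOn_const
  have hev : ∀ᶠ t : ℝ in 𝓝 0, ‖t • u‖ < r / 2 := by
    have : Continuous fun t : ℝ => ‖t • u‖ := by fun_prop
    exact this.continuousAt.eventually_lt continuousAt_const (by simpa using hr)
  have hMt : ∀ t : ℝ, HasDerivAt (fun t : ℝ => M (t, u, ζ)) (fderiv ℝ M (t, u, ζ) (1, 0)) t :=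
    fun t => (hM.differentiable (by norm_num) (t, u, ζ)).hasFDerivAt.comp_hasDerivAt t
      ((hasDerivAt_id t).prodMk (hasDerivAt_const t (u, ζ)))
  have hof : ∀ t : ℝ, HasDerivAt (fun t : ℝ => (t : ℂ)) 1 t := fun t => by
    simpa using (hasDerivAt_id t).ofReal_comp
  have hfirst : ∀ᶠ t : ℝ in 𝓝 0, fderiv ℝ W (t • u, ζ) (u, 0)
      = 2 * (t : ℂ) * M (t, u, ζ) + (t : ℂ) ^ 2 * fderiv ℝ M (t, u, ζ) (1, 0) := by
    filter_upwards [hev.eventually_nhds] with t ht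
    have hmem : (t • u, ζ) ∈ conicDomain (Coord d) r := by
      refine ⟨?_, hζ0⟩
      have := ht.self_of_nhds
      simp only [Metric.mem_ball, dist_zero_right]
      linarith
    have e1 := ((hW.contDiffAt (hO.mem_nhds hmem)).differentiableAt
      (by norm_num)).hasFDerivAt.comp_hasDerivAt t (hcur t)
    have e2 : HasDerivAt (fun t : ℝ => (t : ℂ) ^ 2 * M (t, u, ζ)) _ t :=
      ((hof t).pow 2).mul (hMt t)
    have e3 : (W ∘ fun t : ℝ => (t • u, ζ)) =ᶠ[𝓝 t] fun t : ℝ => (t : ℂ) ^ 2 * M (t, u, ζ) := by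
      filter_upwards [ht] with s hs using hMW s u ζ hs.le h1 h2
    have := e1.unique (e2.congr_of_eventuallyEq e3)
    rw [this]
    simp
  have hL : HasDerivAt (fun t : ℝ => fderiv ℝ W (t • u, ζ) (u, 0))
      (fderiv ℝ (fun x => fderiv ℝ W x (u, 0)) (0, ζ) (u, 0)) 0 := by
    have e1 : DifferentiableAt ℝ (fun x => fderiv ℝ W x (u, 0)) (0, ζ) :=
      (hd.contDiffAt (hO.mem_nhds (zero_mem_conicDomain hr hζ0))).differentiableAt (by norm_num)
    have e2 : HasFDerivAt (𝕜 := ℝ) (fun x => fderiv ℝ W x (u, 0))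
      (fderiv ℝ (fun x => fderiv ℝ W x (u, 0)) (0, ζ))
      ((fun t : ℝ => ((t • u, ζ) : Coord d × Coord d)) 0) := by simpa using e1.hasFDerivAt
    exact e2.comp_hasDerivAt 0 (hcur 0)
  have hdM : Differentiable ℝ fun t : ℝ => fderiv ℝ M (t, u, ζ) (1, 0) := by
    have e1 : ContDiff ℝ ∞ fun x => fderiv ℝ M x (1, 0) :=
      (hM.fderiv_right (m := ∞) (by norm_num)).clm_apply contDiff_const
    exact (e1.comp (f := fun t : ℝ => (t, u, ζ)) (by fun_prop)).differentiable (by norm_num)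
  have hR : HasDerivAt (fun t : ℝ => 2 * (t : ℂ) * M (t, u, ζ)
      + (t : ℂ) ^ 2 * fderiv ℝ M (t, u, ζ) (1, 0)) (2 * M (0, u, ζ)) 0 := by
    have e1 := (((hof 0).const_mul (2 : ℂ)).mul (hMt 0)).add
      (((hof 0).pow 2).mul (hdM 0).hasDerivAt)
    refine e1.congr_deriv ?_
    simp
  have hfin := hL.unique (hR.congr_of_eventuallyEq hfirst)
  have hexp : (fun x => fderiv ℝ W x (u, 0)) = fun x => ∑ b, (u b : ℂ) * fderiv ℝ W x (stdVec b, 0) :=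
    funext fun x => clm_prod_apply_eq_sum _ u
  have hdb : ∀ b, DifferentiableAt ℝ (fun x => fderiv ℝ W x (stdVec b, 0)) (0, ζ) := fun b =>
    (((hW.fderiv_of_isOpen hO (m := ∞) (by norm_num)).clm_apply contDiffOn_const).contDiffAt
      (hO.mem_nhds (zero_mem_conicDomain hr hζ0))).differentiableAt (by norm_num)
  rw [hexp, fderiv_fun_sum (fun b _ => (hdb b).const_mul _)] at hfin
  simp_rw [fderiv_const_mul (hdb _)] at hfin
  have h3 : M (0, u, ζ) = 2⁻¹ * (2 * M (0, u, ζ)) := by ring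
  rw [h3, ← hfin]
  simp only [sum_apply, smul_apply, smul_eq_mul, Finset.mul_sum]
  refine Finset.sum_congr rfl fun b _ => ?_
  rw [clm_prod_apply_eq_sum _ u, Finset.mul_sum, Finset.mul_sum]
  refine Finset.sum_congr rfl fun a _ => ?_
  rw [hessCoeff]
  ring

/-- The first-order analogue of `quotient_zero`, identifying the coefficient of `ε⁴` that comes from
the weight. -/
lemma slope_zero {r : ℝ} (hr : 0 < r) {V : Coord d × Coord d → ℂ}
    (hV : ContDiffOn ℝ ∞ V (conicDomain (Coord d) r)) {V₁ : ℝ × Coord d × Coord d → ℂ}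
    (hV₁ : ContDiff ℝ ∞ V₁)
    (hVV : ∀ (t : ℝ) (u ζ : Coord d), ‖t • u‖ ≤ r / 2 → 1 / 4 ≤ ‖ζ‖ → ‖ζ‖ ≤ 4 →
      V (t • u, ζ) - V (0, ζ) = (t : ℂ) * V₁ (t, ζ, u)) {ζ : Coord d} (h1 : 1 / 4 ≤ ‖ζ‖)
    (h2 : ‖ζ‖ ≤ 4) (u : Coord d) :
    V₁ (0, ζ, u) = ∑ b, gradCoeff V b ζ * (u b : ℂ) := by
  have hζ0 : ζ ≠ 0 := by rintro rfl; norm_num at h1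
  have hO := isOpen_conicDomain (E := Coord d) r
  have hcur : HasDerivAt (fun t : ℝ => ((t • u, ζ) : Coord d × Coord d)) (u, 0) 0 := by
    simpa using ((hasDerivAt_id (0 : ℝ)).smul_const u).prodMk (hasDerivAt_const (0 : ℝ) ζ)
  have hev : ∀ᶠ t : ℝ in 𝓝 0, ‖t • u‖ < r / 2 := by
    have : Continuous fun t : ℝ => ‖t • u‖ := by fun_prop
    exact this.continuousAt.eventually_lt continuousAt_const (by simpa using hr)
  have hof : HasDerivAt (fun t : ℝ => (t : ℂ)) 1 0 := by
    simpa using (hasDerivAt_id (0 : ℝ)).ofReal_comp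
  have e1 : HasFDerivAt (𝕜 := ℝ) V (fderiv ℝ V (0, ζ))
      ((fun t : ℝ => ((t • u, ζ) : Coord d × Coord d)) 0) := by
    simpa using ((hV.contDiffAt (hO.mem_nhds (zero_mem_conicDomain hr hζ0))).differentiableAt
      (by norm_num)).hasFDerivAt
  have e2 := (e1.comp_hasDerivAt 0 hcur).sub_const (V (0, ζ))
  have e3 : HasDerivAt (fun t : ℝ => V₁ (t, ζ, u)) (fderiv ℝ V₁ (0, ζ, u) (1, 0)) 0 :=
    (hV₁.differentiable (by norm_num) (0, ζ, u)).hasFDerivAt.comp_hasDerivAt 0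
      ((hasDerivAt_id 0).prodMk (hasDerivAt_const 0 (ζ, u)))
  have e4 := hof.mul e3
  have e5 := e2.unique (e4.congr_of_eventuallyEq (by
    filter_upwards [hev] with t ht using hVV t u ζ ht.le h1 h2))
  simp only [Complex.ofReal_zero, zero_mul, add_zero, one_mul] at e5
  rw [← e5, clm_prod_apply_eq_sum]
  exact Finset.sum_congr rfl fun b _ => by rw [gradCoeff, mul_comm]

lemma integral_add_const_mul {α : Type*} [MeasurableSpace α] {μ : Measure α}
    {f₁ f₂ f₃ f₄ : α → ℂ} (h₁ : Integrable f₁ μ) (h₂ : Integrable f₂ μ) (h₃ : Integrable f₃ μ)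
    (h₄ : Integrable f₄ μ) (c₂ c₃ c₄ : ℂ) :
    ∫ u, (f₁ u + c₂ * f₂ u + c₃ * f₃ u + c₄ * f₄ u) ∂μ
      = (∫ u, f₁ u ∂μ) + c₂ * (∫ u, f₂ u ∂μ) + c₃ * (∫ u, f₃ u ∂μ) + c₄ * ∫ u, f₄ u ∂μ := by
  have j₂ : Integrable (fun u => f₁ u + c₂ * f₂ u) μ := h₁.add (h₂.const_mul _)
  have j₃ : Integrable (fun u => f₁ u + c₂ * f₂ u + c₃ * f₃ u) μ := j₂.add (h₃.const_mul _)
  rw [integral_add j₃ (h₄.const_mul _), integral_add j₂ (h₃.const_mul _),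
    integral_add h₁ (h₂.const_mul _), integral_const_mul, integral_const_mul, integral_const_mul]

/-- Frequencies near `ξ`: expansion to higher order. -/
theorem exists_near_expansion {r : ℝ} (hr : 0 < r) {W V : Coord d × Coord d → ℂ}
    (hW : IsPerturbation r W) (hV : IsConic r 0 V) (hV1 : ∀ p : Coord d, p ≠ 0 → V (0, p) = 1)
    {ξ : Coord d} (hξ : ‖ξ‖ = 1) (N : ℕ) :
    ∃ C : ℝ, 0 ≤ C ∧ ∃ ε₀ : ℝ, 0 < ε₀ ∧ ∀ ε : ℝ, 0 < ε → ε ≤ ε₀ → ∀ τ : Coord d,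
      4 * Real.pi * ε * ‖τ‖ ≤ 1 →
        ‖(∫ u, osc τ u * (Complex.exp (Complex.I * W (ε ^ 4 • u, freq ξ ε τ)) *
          (V (ε ^ 4 • u, freq ξ ε τ) * (unitBump d u : ℂ)))) -
          (moment (fun _ => 1) τ +
            Complex.I * (ε : ℂ) ^ 3 * ∑ b, ∑ a, hessCoeff W a b (ξ + (2 * Real.pi * ε) • τ) *
              moment (fun u => (u a : ℂ) * (u b : ℂ)) τ +
            (ε : ℂ) ^ 4 * ∑ b, gradCoeff V b (ξ + (2 * Real.pi * ε) • τ) *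
              moment (fun u => (u b : ℂ)) τ)‖
          ≤ C * ε ^ 6 / (1 + ‖τ‖) ^ N := by
  obtain ⟨M, hM, hMW⟩ := hW.exists_quotient hr
  obtain ⟨κ, hκ, hext, hs, h1⟩ := exists_contDiff_extension (E := Coord d) (F := ℂ) hr
  have hVs := hext V hV.smooth
  -- Difference quotients in `t`, to be used at `t = ε⁴`: replacing `M` by its value at `t = 0`
  -- costs `ε³·ε⁴`, and linearising `V` costs `ε⁸`.
  obtain ⟨M₁, hM₁, hM₁t, -⟩ := exists_eq_mul_of_eq_zero (Q := Coord d × Coord d)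
    (G := fun x => M (x.1, x.2) - M (0, x.2))
    ((hM.comp (by fun_prop)).sub (hM.comp (by fun_prop))) (fun q => by simp)
  obtain ⟨V₁, hV₁, hV₁t, -⟩ := exists_eq_mul_of_eq_zero (Q := Coord d × Coord d)
    (G := fun x => κ (x.1 • x.2.2, x.2.1) • V (x.1 • x.2.2, x.2.1) - κ (0, x.2.1) • V (0, x.2.1))
    ((hVs.comp (f := fun x : ℝ × Coord d × Coord d => (x.1 • x.2.2, x.2.1)) (by fun_prop)).sub
        (hVs.comp (f := fun x : ℝ × Coord d × Coord d => ((0 : Coord d), x.2.1)) (by fun_prop)))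
    (fun q => by simp)
  obtain ⟨V₂, hV₂, hV₂t, -⟩ := exists_eq_mul_of_eq_zero (Q := Coord d × Coord d)
    (G := fun x => V₁ (x.1, x.2) - V₁ (0, x.2))
    ((hV₁.comp (by fun_prop)).sub (hV₁.comp (by fun_prop))) (fun q => by simp)
  -- Two divisions by `t` give `exp(itq) = 1 + itq + t² E₂(t, q)` with `E₂` smooth. With `t = ε³`
  -- and `q = M` the error is `ε⁶`, which fixes the order of the whole expansion.
  obtain ⟨E₁, hE₁, hE₁t, hE₁0⟩ := exists_eq_mul_of_eq_zero (Q := ℂ)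
    (G := fun x => Complex.exp (Complex.I * ((x.1 : ℂ) * x.2)) - 1)
    ((contDiff_const.mul ((Complex.ofRealCLM.contDiff.comp contDiff_fst).mul
      contDiff_snd)).cexp.sub contDiff_const) (fun q => by simp)
  have hE₁0' : ∀ q, E₁ (0, q) = Complex.I * q := fun q => by
    have hof : HasDerivAt (fun t : ℝ => (t : ℂ)) 1 0 := by
      simpa using (hasDerivAt_id (0 : ℝ)).ofReal_comp
    have e1 := (((hof.mul_const q).const_mul Complex.I).cexp).sub_const 1
    have e3 : HasDerivAt (fun t : ℝ => E₁ (t, q)) (fderiv ℝ E₁ (0, q) (1, 0)) 0 :=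
      (hE₁.differentiable (by norm_num) (0, q)).hasFDerivAt.comp_hasDerivAt 0
        ((hasDerivAt_id 0).prodMk (hasDerivAt_const 0 q))
    have e5 := e1.unique ((hof.mul e3).congr_of_eventuallyEq
      (Eventually.of_forall fun t => hE₁t t q))
    simpa using e5.symm
  obtain ⟨E₂, hE₂, hE₂t, -⟩ := exists_eq_mul_of_eq_zero (Q := ℂ)
    (G := fun x => E₁ (x.1, x.2) - Complex.I * x.2)
    ((hE₁.comp (by fun_prop)).sub (contDiff_const.mul contDiff_snd))
    (fun q => by simp [hE₁0'])
  -- the remainder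
  let R : ℝ × Coord d × Coord d → ℂ := fun x =>
    Complex.I * (x.1 : ℂ) * M₁ (x.1 ^ 4, x.2.2, x.2.1)
      + E₂ (x.1 ^ 3, M (x.1 ^ 4, x.2.2, x.2.1)) * (1 + (x.1 : ℂ) ^ 4 * V₁ (x.1 ^ 4, x.2.1, x.2.2))
      + Complex.I * (x.1 : ℂ) * M (x.1 ^ 4, x.2.2, x.2.1) * V₁ (x.1 ^ 4, x.2.1, x.2.2)
      + (x.1 : ℂ) ^ 2 * V₂ (x.1 ^ 4, x.2.1, x.2.2)
  have hR : ContDiff ℝ ∞ R := by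
    have c1 : ContDiff ℝ ∞ fun x : ℝ × Coord d × Coord d => (x.1 : ℂ) :=
      Complex.ofRealCLM.contDiff.comp contDiff_fst
    have c2 : ContDiff ℝ ∞ fun x : ℝ × Coord d × Coord d => M (x.1 ^ 4, x.2.2, x.2.1) :=
      hM.comp (by fun_prop)
    have c3 : ContDiff ℝ ∞ fun x : ℝ × Coord d × Coord d => V₁ (x.1 ^ 4, x.2.1, x.2.2) :=
      hV₁.comp (by fun_prop)
    have c4 : ContDiff ℝ ∞ fun x : ℝ × Coord d × Coord d => M₁ (x.1 ^ 4, x.2.2, x.2.1) :=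
      hM₁.comp (by fun_prop)
    have c5 : ContDiff ℝ ∞ fun x : ℝ × Coord d × Coord d => V₂ (x.1 ^ 4, x.2.1, x.2.2) :=
      hV₂.comp (by fun_prop)
    have c6 : ContDiff ℝ ∞ fun x : ℝ × Coord d × Coord d =>
        E₂ (x.1 ^ 3, M (x.1 ^ 4, x.2.2, x.2.1)) :=
      hE₂.comp ((contDiff_fst.pow 3).prodMk c2)
    exact ((((contDiff_const.mul c1).mul c4).add (c6.mul (contDiff_const.add ((c1.pow 4).mul
      c3)))).add (((contDiff_const.mul c1).mul c2).mul c3)).add ((c1.pow 2).mul c5)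
  obtain ⟨C, hC0, hC⟩ := exists_fourier_bound (P := ℝ × Coord d)
    ((isCompact_Icc (a := (0 : ℝ)) (b := 1)).prod (isCompact_closedBall ξ (1 / 2)))
    (S := fun x => R (x.1.1, x.1.2, x.2)) (hR.comp (by fun_prop)) N
  refine ⟨C, hC0, min 1 (r / 2), by positivity, fun ε hε hε0 τ hτ => ?_⟩
  have he1 : ε ≤ 1 := hε0.trans (min_le_left _ _)
  have he2 : ε ≤ r / 2 := hε0.trans (min_le_right _ _)
  obtain ⟨hζ, hζ1, hζ2⟩ := norm_freq_base hξ hε hτ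
  set ζ := ξ + (2 * Real.pi * ε) • τ with hζdef
  have hζ0 : ζ ≠ 0 := by intro h; rw [h, norm_zero] at hζ1; norm_num at hζ1
  have hVV : ∀ (t : ℝ) (u ζ : Coord d), ‖t • u‖ ≤ r / 2 → 1 / 4 ≤ ‖ζ‖ → ‖ζ‖ ≤ 4 →
      V (t • u, ζ) - V (0, ζ) = (t : ℂ) * V₁ (t, ζ, u) := fun t u ζ ht h3 h4 => by
    have := hV₁t t (ζ, u)
    simpa only [h1 _ _ ht h3 h4, h1 0 ζ (by simp; linarith) h3 h4, one_smul] using this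
  have hpt : ∀ u, osc τ u * (Complex.exp (Complex.I * W (ε ^ 4 • u, freq ξ ε τ)) *
      (V (ε ^ 4 • u, freq ξ ε τ) * (unitBump d u : ℂ)))
      = osc τ u * ((unitBump d u : ℂ) * 1) +
        Complex.I * (ε : ℂ) ^ 3 * ∑ b, ∑ a, hessCoeff W a b ζ *
          (osc τ u * ((unitBump d u : ℂ) * ((u a : ℂ) * (u b : ℂ)))) +
        (ε : ℂ) ^ 4 * ∑ b, gradCoeff V b ζ * (osc τ u * ((unitBump d u : ℂ) * (u b : ℂ))) +
        (ε : ℂ) ^ 6 * (osc τ u * ((unitBump d u : ℂ) * R (ε, ζ, u))) := fun u => by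
    by_cases hu : u ∈ Metric.closedBall (0 : Coord d) 1
    · have hu' := norm_smul_le_of_mem_unitBall hε he1 he2 hu
      have h2 := near_integrand (k := 0) hW (by simpa using hV) hMW hr hε hu' hζ1 hζ2
      have q1 := quotient_zero hr hW.smooth hM hMW (ζ := ζ) (by linarith) (by linarith) u
      have q2 := slope_zero hr hV.smooth hV₁ hVV (ζ := ζ) (by linarith) (by linarith) u
      have q3 := hVV (ε ^ 4) u ζ hu' (by linarith) (by linarith)
      rw [hV1 ζ hζ0] at q3
      have q4 := hV₂t (ε ^ 4) (ζ, u)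
      have q5 := hM₁t (ε ^ 4) (u, ζ)
      have q6 := hE₁t (ε ^ 3) (M (ε ^ 4, u, ζ))
      have q7 := hE₂t (ε ^ 3) (M (ε ^ 4, u, ζ))
      have s1 : ∑ b, ∑ a, hessCoeff W a b ζ *
          (osc τ u * ((unitBump d u : ℂ) * ((u a : ℂ) * (u b : ℂ))))
          = osc τ u * (unitBump d u : ℂ) * M (0, u, ζ) := by
        rw [q1, Finset.mul_sum]
        refine Finset.sum_congr rfl fun b _ => ?_
        rw [Finset.mul_sum]
        exact Finset.sum_congr rfl fun a _ => by ring
      have s2 : ∑ b, gradCoeff V b ζ * (osc τ u * ((unitBump d u : ℂ) * (u b : ℂ)))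
          = osc τ u * (unitBump d u : ℂ) * V₁ (0, ζ, u) := by
        rw [q2, Finset.mul_sum]
        exact Finset.sum_congr rfl fun a _ => by ring
      rw [s1, s2]
      simp only [Nat.mul_zero, pow_zero, one_mul, ← hζdef] at h2
      simp only [Complex.ofReal_pow] at q3 q4 q5 q6 q7
      have q8 : Complex.exp (Complex.I * ((ε : ℂ) ^ 3 * M (ε ^ 4, u, ζ)))
          = 1 + (ε : ℂ) ^ 3 * (Complex.I * M (ε ^ 4, u, ζ)) +
            (ε : ℂ) ^ 6 * E₂ (ε ^ 3, M (ε ^ 4, u, ζ)) := by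
        linear_combination q6 + (ε : ℂ) ^ 3 * q7
      have q9 : V (ε ^ 4 • u, ζ) = 1 + (ε : ℂ) ^ 4 * V₁ (ε ^ 4, ζ, u) := by
        linear_combination q3
      rw [q8, q9] at h2
      simp only [R]
      linear_combination osc τ u * (unitBump d u : ℂ) * h2
        + osc τ u * (unitBump d u : ℂ) * (ε : ℂ) ^ 4 * q4
        + osc τ u * (unitBump d u : ℂ) * Complex.I * (ε : ℂ) ^ 3 * q5
    · simp [unitBump_eq_zero hu]
  have i1 : ∀ a b : Fin d, Integrable fun u : Coord d => hessCoeff W a b ζ *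
          (osc τ u * ((unitBump d u : ℂ) * ((u a : ℂ) * (u b : ℂ)))) := fun a b =>
    (integrable_moment (m := fun u => (u a : ℂ) * (u b : ℂ)) (by fun_prop) τ).const_mul _
  have i2 : ∀ b : Fin d, Integrable fun u : Coord d => gradCoeff V b ζ *
          (osc τ u * ((unitBump d u : ℂ) * (u b : ℂ))) := fun b =>
    (integrable_moment (m := fun u => (u b : ℂ)) (by fun_prop) τ).const_mul _
  have i3 := integrable_moment (m := fun _ => 1) continuous_const τ
  have i4 := integrable_moment (m := fun u => R (ε, ζ, u)) (hR.continuous.comp (by fun_prop)) τ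
  have i5 : Integrable fun u : Coord d => ∑ b, ∑ a, hessCoeff W a b ζ *
          (osc τ u * ((unitBump d u : ℂ) * ((u a : ℂ) * (u b : ℂ)))) :=
    integrable_finsetSum _ fun b _ => integrable_finsetSum _ fun a _ => i1 a b
  have i6 : Integrable fun u : Coord d => ∑ b, gradCoeff V b ζ *
          (osc τ u * ((unitBump d u : ℂ) * (u b : ℂ))) :=
    integrable_finsetSum _ fun b _ => i2 b
  simp_rw [hpt]
  rw [integral_add_const_mul i3 i5 i6 i4,
    integral_finsetSum _ fun b _ => integrable_finsetSum _ fun a _ => i1 a b,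
    integral_finsetSum _ fun b _ => i2 b]
  simp_rw [integral_finsetSum _ fun a _ => i1 a _, integral_const_mul]
  simp only [moment]
  rw [add_sub_cancel_left, norm_mul, norm_pow, Complex.norm_real, Real.norm_of_nonneg hε.le]
  have := hC (ε, ζ) ⟨⟨hε.le, he1⟩, hζ⟩ τ
  calc _ ≤ ε ^ 6 * (C / (1 + ‖τ‖) ^ N) := by gcongr
    _ = _ := by ring

end NearFrequencies

/-! ### Fourier moments and the cancellation of the terms of order `ε³` and `ε⁴` -/

section MainTerm

variable {d : ℕ}

open scoped FourierTransform SchwartzMap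

lemma integrable_inv_one_add_norm_pow {N : ℕ} (hN : d < N) :
    Integrable fun τ : Coord d => 1 / (1 + ‖τ‖) ^ N := by
  have h := integrable_one_add_norm (E := Coord d) (μ := volume) (r := N) (by simpa using hN)
  refine h.congr (ae_of_all _ fun τ => ?_)
  simp only
  rw [Real.rpow_neg (by positivity), Real.rpow_natCast, one_div]

/-- The bump makes any smooth factor a Schwartz function, so that Fourier inversion and the
differentiation rules apply to moments. -/
lemma exists_schwartz_moment {m : Coord d → ℂ} (hm : ContDiff ℝ ∞ m) :
    ∃ f : 𝓢(Coord d, ℂ), (∀ u, f u = (unitBump d u : ℂ) * m u) ∧ ∀ τ, 𝓕 f τ = moment m τ := by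
  have h1 : HasCompactSupport fun u : Coord d => (unitBump d u : ℂ) * m u :=
    HasCompactSupport.intro (isCompact_closedBall (0 : Coord d) 1) fun u hu => by
      simp [unitBump_eq_zero hu]
  have h2 : ContDiff ℝ ∞ fun u : Coord d => (unitBump d u : ℂ) * m u :=
    (Complex.ofRealCLM.contDiff.comp (unitBump d).contDiff).mul hm
  refine ⟨h1.toSchwartzMap h2, fun u => rfl, fun τ => ?_⟩
  rw [SchwartzMap.fourier_coe, Real.fourier_eq', moment]
  rfl

lemma integrable_moment_transform {m : Coord d → ℂ} (hm : ContDiff ℝ ∞ m) :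
    Integrable (moment m) := by
  obtain ⟨f, -, hf⟩ := exists_schwartz_moment hm
  exact (𝓕 f).integrable.congr (ae_of_all _ hf)

lemma contDiff_moment {m : Coord d → ℂ} (hm : ContDiff ℝ ∞ m) : ContDiff ℝ ∞ (moment m) := by
  obtain ⟨f, -, hf⟩ := exists_schwartz_moment hm
  have : moment m = ⇑(𝓕 f : 𝓢(Coord d, ℂ)) := funext fun τ => (hf τ).symm
  rw [this]
  exact SchwartzMap.smooth' _

/-- Fourier inversion at the origin, where the bump equals `1`. -/
lemma integral_moment {m : Coord d → ℂ} (hm : ContDiff ℝ ∞ m) : ∫ τ, moment m τ = m 0 := by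
  obtain ⟨f, hf, hf'⟩ := exists_schwartz_moment hm
  have h1 : 𝓕⁻ (𝓕 f) = f := FourierTransform.fourierInv_fourier_eq f
  have h2 := congrArg (fun g : 𝓢(Coord d, ℂ) => g 0) h1
  simp only [hf, unitBump_zero, Complex.ofReal_one, one_mul] at h2
  rw [← h2, SchwartzMap.fourierInv_coe, Real.fourierInv_eq']
  simp [hf']

lemma exists_moment_bound {m : Coord d → ℂ} (hm : ContDiff ℝ ∞ m) (N : ℕ) :
    ∃ C : ℝ, 0 ≤ C ∧ ∀ τ, ‖moment m τ‖ ≤ C / (1 + ‖τ‖) ^ N := by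
  obtain ⟨C, h0, hC⟩ := exists_fourier_bound (P := ℝ) (isCompact_singleton (x := (0 : ℝ)))
    (S := fun x : ℝ × Coord d => m x.2) (hm.comp contDiff_snd) N
  exact ⟨C, h0, hC 0 rfl⟩

/-- Differentiating a Fourier transform multiplies the function by `-2πi u_a`; read backwards, a
factor `u_a` in a moment is a `τ`-derivative that can be integrated by parts. -/
lemma fderiv_moment {m : Coord d → ℂ} (hm : ContDiff ℝ ∞ m) (a : Fin d) (τ : Coord d) :
    fderiv ℝ (moment m) τ (stdVec a)
      = -(2 * Real.pi * Complex.I) * moment (fun u => (u a : ℂ) * m u) τ := by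
  obtain ⟨f, hf, hf'⟩ := exists_schwartz_moment hm
  have hm2 : ContDiff ℝ ∞ fun u : Coord d => (u a : ℂ) * m u :=
    (Complex.ofRealCLM.contDiff.comp (contDiff_piLp_apply 2)).mul hm
  have h1 := congrArg (fun g : 𝓢(Coord d, ℂ) => g τ)
    (SchwartzMap.lineDerivOp_fourier_eq f (stdVec a))
  have h2 : moment m = ⇑(𝓕 f : 𝓢(Coord d, ℂ)) := funext fun τ => (hf' τ).symm
  rw [h2]
  refine Eq.trans ?_ (h1.trans ?_)
  · rfl
  · simp only [SchwartzMap.fourier_coe, Real.fourier_eq', moment]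
    rw [← integral_const_mul]
    refine integral_congr_ae (ae_of_all _ fun u => ?_)
    have h3 : (fun x : Coord d => inner ℝ x (stdVec a)).HasTemperateGrowth := by fun_prop
    have h4 := SchwartzMap.smulLeftCLM_apply_apply (F := ℂ) h3 f u
    rw [hf, stdVec, EuclideanSpace.inner_single_right] at h4
    simp only [neg_smul, neg_apply, smul_apply, smul_eq_mul, osc, stdVec, h4, Complex.real_smul]
    simp
    ring

/-- Integration by parts in the frequency. -/
lemma integral_comp_mul_moment {g : Coord d → ℂ} (hg : ContDiff ℝ ∞ g) (hgc : HasCompactSupport g)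
    {m : Coord d → ℂ} (hm : ContDiff ℝ ∞ m) (a : Fin d) (ξ : Coord d) {ε : ℝ} (hε : 0 < ε) :
    ∫ τ, g (ξ + (2 * Real.pi * ε) • τ) * moment (fun u => (u a : ℂ) * m u) τ
      = -(Complex.I * ε) * ∫ τ, fderiv ℝ g (ξ + (2 * Real.pi * ε) • τ) (stdVec a) * moment m τ := by
  have hpi := Real.pi_pos
  have hc : (0 : ℝ) < 2 * Real.pi * ε := by positivity
  have haff : ∀ τ : Coord d, HasFDerivAt (fun τ : Coord d => ξ + (2 * Real.pi * ε) • τ)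
      ((2 * Real.pi * ε) • ContinuousLinearMap.id ℝ (Coord d)) τ := fun τ =>
    ((hasFDerivAt_id τ).const_smul (2 * Real.pi * ε)).const_add ξ
  set G : Coord d → ℂ := fun τ => g (ξ + (2 * Real.pi * ε) • τ) with hG
  have hGs : ContDiff ℝ ∞ G := hg.comp (by fun_prop)
  have hGd : ∀ τ, fderiv ℝ G τ (stdVec a)
      = ((2 * Real.pi * ε : ℝ) : ℂ) * fderiv ℝ g (ξ + (2 * Real.pi * ε) • τ) (stdVec a) := fun τ => by
    have := ((hg.differentiable (by norm_num) _).hasFDerivAt.comp τ (haff τ)).fderiv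
    rw [show fderiv ℝ G τ = _ from this]
    simp
  have hGc : HasCompactSupport G := by
    let e : Coord d ≃ₜ Coord d :=
      (Homeomorph.smulOfNeZero (2 * Real.pi * ε) hc.ne').trans (Homeomorph.addLeft ξ)
    exact hgc.comp_homeomorph e
  have hms := contDiff_moment hm
  have hmd : Continuous fun τ => fderiv ℝ (moment m) τ (stdVec a) :=
    (hms.continuous_fderiv (by norm_num)).clm_apply continuous_const
  have hGd' : Continuous fun τ => fderiv ℝ G τ (stdVec a) :=
    (hGs.continuous_fderiv (by norm_num)).clm_apply continuous_const
  have key := integral_mul_fderiv_eq_neg_fderiv_mul_of_integrable (μ := (volume : Measure (Coord d)))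
    (f := G) (g := moment m) (v := stdVec a)
    ((hGd'.mul hms.continuous).integrable_of_hasCompactSupport
      ((hGc.fderiv_apply ℝ _).mul_right))
    ((hGs.continuous.mul hmd).integrable_of_hasCompactSupport hGc.mul_right)
    ((hGs.continuous.mul hms.continuous).integrable_of_hasCompactSupport hGc.mul_right)
    (fun x _ => hGs.differentiable (by norm_num) x) (fun x _ => hms.differentiable (by norm_num) x)
  simp_rw [fderiv_moment hm, hGd] at key
  have e1 : ∫ τ, G τ * (-(2 * Real.pi * Complex.I) * moment (fun u => (u a : ℂ) * m u) τ)
      = -(2 * Real.pi * Complex.I) * ∫ τ, G τ * moment (fun u => (u a : ℂ) * m u) τ := by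
    rw [← integral_const_mul]
    exact integral_congr_ae (ae_of_all _ fun τ => by ring)
  have e2 : ∫ τ, ((2 * Real.pi * ε : ℝ) : ℂ) * fderiv ℝ g (ξ + (2 * Real.pi * ε) • τ) (stdVec a) *
        moment m τ = ((2 * Real.pi * ε : ℝ) : ℂ) *
        ∫ τ, fderiv ℝ g (ξ + (2 * Real.pi * ε) • τ) (stdVec a) * moment m τ := by
    rw [← integral_const_mul]
    exact integral_congr_ae (ae_of_all _ fun τ => by ring)
  rw [e1, e2] at key
  have hne : (2 * Real.pi * Complex.I : ℂ) ≠ 0 := by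
    simp [Real.pi_ne_zero]
  apply mul_left_cancel₀ hne
  push_cast at key
  linear_combination (-1 : ℂ) * key + (2 * Real.pi * ε *
    ∫ τ, fderiv ℝ g (ξ + (2 * Real.pi * ε) • τ) (stdVec a) * moment m τ) * Complex.I_mul_I

lemma contDiffOn_hessCoeff {r : ℝ} (hr : 0 < r) {W : Coord d × Coord d → ℂ}
    (hW : ContDiffOn ℝ ∞ W (conicDomain (Coord d) r)) (a b : Fin d) :
    ContDiffOn ℝ ∞ (hessCoeff W a b) {0}ᶜ := by
  have hO := isOpen_conicDomain (E := Coord d) r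
  have h1 : ContDiffOn ℝ ∞ (fun x => fderiv ℝ W x (stdVec b, 0)) (conicDomain (Coord d) r) :=
    (hW.fderiv_of_isOpen hO (m := ∞) (by norm_num)).clm_apply contDiffOn_const
  have h2 : ContDiffOn ℝ ∞ (fun x => fderiv ℝ (fun x => fderiv ℝ W x (stdVec b, 0)) x (stdVec a, 0))
      (conicDomain (Coord d) r) :=
    (h1.fderiv_of_isOpen hO (m := ∞) (by norm_num)).clm_apply contDiffOn_const
  exact contDiffOn_const.mul (h2.comp (f := fun p : Coord d => ((0 : Coord d), p)) (by fun_prop)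
    fun p hp => zero_mem_conicDomain hr hp)

lemma contDiffOn_gradCoeff {r : ℝ} (hr : 0 < r) {V : Coord d × Coord d → ℂ}
    (hV : ContDiffOn ℝ ∞ V (conicDomain (Coord d) r)) (b : Fin d) :
    ContDiffOn ℝ ∞ (gradCoeff V b) {0}ᶜ := by
  have hO := isOpen_conicDomain (E := Coord d) r
  have h1 : ContDiffOn ℝ ∞ (fun x => fderiv ℝ V x (stdVec b, 0)) (conicDomain (Coord d) r) :=
    (hV.fderiv_of_isOpen hO (m := ∞) (by norm_num)).clm_apply contDiffOn_const
  exact h1.comp (f := fun p : Coord d => ((0 : Coord d), p)) (by fun_prop)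
    fun p hp => zero_mem_conicDomain hr hp

/-- The relation between the weight `V` and the phase perturbation `W` which expresses that the
subprincipal terms cancel. -/
def SubprincipalRelation (W V : Coord d × Coord d → ℂ) : Prop :=
  ∃ β : Fin d → ℂ, ∀ p : Coord d, p ≠ 0 → ∀ b,
    gradCoeff V b p = β b - ∑ a, fderiv ℝ (hessCoeff W a b) p (stdVec a)

/-- The main part of the frequency distribution of a wave packet. -/
def mainTerm (g : Fin d → Fin d → Coord d → ℂ) (h : Fin d → Coord d → ℂ) (ξ : Coord d) (ε : ℝ)
    (τ : Coord d) : ℂ :=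
  moment (fun _ => 1) τ +
    Complex.I * (ε : ℂ) ^ 3 * ∑ b, ∑ a, g a b (ξ + (2 * Real.pi * ε) • τ) *
      moment (fun u => (u a : ℂ) * (u b : ℂ)) τ +
    (ε : ℂ) ^ 4 * ∑ b, h b (ξ + (2 * Real.pi * ε) • τ) * moment (fun u => (u b : ℂ)) τ

lemma contDiff_coord (b : Fin d) : ContDiff ℝ ∞ fun u : Coord d => (u b : ℂ) :=
  Complex.ofRealCLM.contDiff.comp (contDiff_piLp_apply 2)

lemma integrable_comp_mul_moment {f m : Coord d → ℂ} (hf : Continuous f)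
    (hfc : HasCompactSupport f) (hm : ContDiff ℝ ∞ m) (ξ : Coord d) (ε : ℝ) :
    Integrable fun τ => f (ξ + (2 * Real.pi * ε) • τ) * moment m τ := by
  obtain ⟨C, hC⟩ := hf.bounded_above_of_compact_support hfc
  exact (integrable_moment_transform hm).bdd_mul (c := C)
    (hf.comp (by fun_prop)).aestronglyMeasurable (ae_of_all _ fun τ => hC _)

lemma continuous_fderiv_stdVec {g : Coord d → ℂ} (hg : ContDiff ℝ ∞ g) (a : Fin d) :
    Continuous fun p => fderiv ℝ g p (stdVec a) :=
  (hg.continuous_fderiv (by norm_num)).clm_apply continuous_const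

/-- Integration by parts turns the term with `iε³` into one with `iε³·(-iε) = ε⁴`, which joins the
gradient term. Subtracting `β b` changes nothing, since the moment of `u_b` integrates to the value
of `u_b` at the origin. -/
lemma integral_mainTerm {g : Fin d → Fin d → Coord d → ℂ} {h : Fin d → Coord d → ℂ}
    (hgs : ∀ a b, ContDiff ℝ ∞ (g a b)) (hgc : ∀ a b, HasCompactSupport (g a b))
    (hhs : ∀ b, ContDiff ℝ ∞ (h b)) (hhc : ∀ b, HasCompactSupport (h b)) (ξ : Coord d) {ε : ℝ}
    (hε : 0 < ε) (β : Fin d → ℂ) :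
    Integrable (mainTerm g h ξ ε) ∧ ∫ τ, mainTerm g h ξ ε τ = 1 + (ε : ℂ) ^ 4 * ∑ b,
      ∫ τ, ((∑ a, fderiv ℝ (g a b) (ξ + (2 * Real.pi * ε) • τ) (stdVec a)) +
        h b (ξ + (2 * Real.pi * ε) • τ) - β b) * moment (fun u => (u b : ℂ)) τ := by
  have ig : ∀ a b, Integrable fun τ => g a b (ξ + (2 * Real.pi * ε) • τ) *
      moment (fun u => (u a : ℂ) * (u b : ℂ)) τ := fun a b =>
    integrable_comp_mul_moment (hgs a b).continuous (hgc a b)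
      ((contDiff_coord a).mul (contDiff_coord b)) ξ ε
  have ih : ∀ b, Integrable fun τ => h b (ξ + (2 * Real.pi * ε) • τ) *
      moment (fun u => (u b : ℂ)) τ := fun b =>
    integrable_comp_mul_moment (hhs b).continuous (hhc b) (contDiff_coord b) ξ ε
  have idg : ∀ a b, Integrable fun τ => fderiv ℝ (g a b) (ξ + (2 * Real.pi * ε) • τ) (stdVec a) *
      moment (fun u => (u b : ℂ)) τ := fun a b =>
    integrable_comp_mul_moment (f := fun p => fderiv ℝ (g a b) p (stdVec a))
      (continuous_fderiv_stdVec (hgs a b) a)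
      ((hgc a b).fderiv_apply ℝ (stdVec a)) (contDiff_coord b) ξ ε
  have i0 : Integrable (moment (d := d) fun _ => 1) := integrable_moment_transform contDiff_const
  have igb : ∀ b, Integrable fun τ => ∑ a, g a b (ξ + (2 * Real.pi * ε) • τ) *
      moment (fun u => (u a : ℂ) * (u b : ℂ)) τ := fun b =>
    integrable_finsetSum _ fun a _ => ig a b
  have igs : Integrable fun τ => ∑ b, ∑ a, g a b (ξ + (2 * Real.pi * ε) • τ) *
      moment (fun u => (u a : ℂ) * (u b : ℂ)) τ := integrable_finsetSum _ fun b _ => igb b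
  have ihs : Integrable fun τ => ∑ b, h b (ξ + (2 * Real.pi * ε) • τ) *
      moment (fun u => (u b : ℂ)) τ := integrable_finsetSum _ fun b _ => ih b
  refine ⟨(i0.add (igs.const_mul (Complex.I * (ε : ℂ) ^ 3))).add (ihs.const_mul ((ε : ℂ) ^ 4)), ?_⟩
  have e0 := integral_add_const_mul i0 igs ihs (integrable_zero (Coord d) ℂ volume)
    (Complex.I * (ε : ℂ) ^ 3) ((ε : ℂ) ^ 4) 0
  rw [integral_moment contDiff_const, integral_finsetSum _ fun b _ => igb b,
    integral_finsetSum _ fun b _ => ih b] at e0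
  have e1 : ∀ b, ∫ τ, ((∑ a, fderiv ℝ (g a b) (ξ + (2 * Real.pi * ε) • τ) (stdVec a)) +
        h b (ξ + (2 * Real.pi * ε) • τ) - β b) * moment (fun u => (u b : ℂ)) τ
      = (∑ a, ∫ τ, fderiv ℝ (g a b) (ξ + (2 * Real.pi * ε) • τ) (stdVec a) *
          moment (fun u => (u b : ℂ)) τ) + ∫ τ, h b (ξ + (2 * Real.pi * ε) • τ) *
            moment (fun u => (u b : ℂ)) τ := fun b => by
    have j1 : Integrable fun τ => ∑ a, fderiv ℝ (g a b) (ξ + (2 * Real.pi * ε) • τ) (stdVec a) *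
        moment (fun u => (u b : ℂ)) τ := integrable_finsetSum _ fun a _ => idg a b
    have j3 : Integrable fun τ => moment (d := d) (fun u => (u b : ℂ)) τ :=
      integrable_moment_transform (contDiff_coord b)
    have e2 := integral_add_const_mul j1 (ih b) j3 (integrable_zero (Coord d) ℂ volume) 1 (-β b) 0
    rw [integral_moment (contDiff_coord b), integral_finsetSum _ fun a _ => idg a b] at e2
    simp only [PiLp.zero_apply, Complex.ofReal_zero, mul_zero, add_zero, one_mul, zero_mul] at e2
    rw [← e2]
    refine integral_congr_ae (ae_of_all _ fun τ => ?_)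
    simp only [← Finset.sum_mul]
    ring
  have e3 : ∀ b, ∫ τ, ∑ a, g a b (ξ + (2 * Real.pi * ε) • τ) *
      moment (fun u => (u a : ℂ) * (u b : ℂ)) τ = -(Complex.I * ε) * ∑ a,
        ∫ τ, fderiv ℝ (g a b) (ξ + (2 * Real.pi * ε) • τ) (stdVec a) *
          moment (fun u => (u b : ℂ)) τ := fun b => by
    rw [integral_finsetSum _ fun a _ => ig a b, Finset.mul_sum]
    exact Finset.sum_congr rfl fun a _ =>
      integral_comp_mul_moment (hgs a b) (hgc a b) (contDiff_coord b) a ξ hε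
  simp only [e3, zero_mul, add_zero, ← Finset.mul_sum] at e0
  rw [show ∫ τ, mainTerm g h ξ ε τ = _ from e0]
  simp only [e1, Finset.sum_add_distrib]
  linear_combination (-(ε : ℂ) ^ 4 * ∑ b, ∑ a, ∫ τ, fderiv ℝ (g a b)
    (ξ + (2 * Real.pi * ε) • τ) (stdVec a) * moment (fun u => (u b : ℂ)) τ) * Complex.I_mul_I

/-- The factor `D - β` vanishes unless `4πε‖τ‖ > 1`, and there the constant `c` is at most `c
(4πε‖τ‖)²`. Two extra powers of decay of the moment absorb `‖τ‖²`, which leaves `ε²`. -/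
lemma norm_integral_sub_mul_moment_le {D : Coord d → ℂ} {β : ℂ} {c C : ℝ} (hc : 0 ≤ c) (hC : 0 ≤ C)
    {ξ : Coord d} (hξ : ‖ξ‖ = 1) (hD : ∀ p, ‖p - ξ‖ ≤ 1 / 2 → D p = β)
    (hDc : ∀ p, ‖D p - β‖ ≤ c) {m : Coord d → ℂ} (hm : ∀ τ, ‖moment m τ‖ ≤ C / (1 + ‖τ‖) ^ (d + 3))
    {ε : ℝ} (hε : 0 < ε) :
    ‖∫ τ, (D (ξ + (2 * Real.pi * ε) • τ) - β) * moment m τ‖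
      ≤ ε ^ 2 * (c * (4 * Real.pi) ^ 2 * C * ∫ τ : Coord d, 1 / (1 + ‖τ‖) ^ (d + 1)) := by
  have hpi := Real.pi_pos
  have hle : ∀ τ : Coord d, ‖(D (ξ + (2 * Real.pi * ε) • τ) - β) * moment m τ‖
      ≤ (ε ^ 2 * (c * (4 * Real.pi) ^ 2 * C)) * (1 / (1 + ‖τ‖) ^ (d + 1)) := fun τ => by
    have e1 : ‖D (ξ + (2 * Real.pi * ε) • τ) - β‖ ≤ c * (4 * Real.pi * ε * ‖τ‖) ^ 2 := by
      rcases le_or_gt (4 * Real.pi * ε * ‖τ‖) 1 with h1 | h1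
      · rw [hD _ (by simpa [dist_eq_norm] using (norm_freq_base hξ hε h1).1), sub_self, norm_zero]
        positivity
      · exact (hDc _).trans (le_mul_of_one_le_right hc (one_le_pow₀ h1.le))
    have e2 : ‖τ‖ ^ 2 * (1 + ‖τ‖) ^ (d + 1) ≤ (1 + ‖τ‖) ^ (d + 3) := by
      rw [show d + 3 = 2 + (d + 1) by ring, pow_add _ 2]
      gcongr
      linarith
    rw [norm_mul]
    calc _ ≤ (c * (4 * Real.pi * ε * ‖τ‖) ^ 2) * (C / (1 + ‖τ‖) ^ (d + 3)) :=
          mul_le_mul e1 (hm τ) (norm_nonneg _) (by positivity)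
      _ = (ε ^ 2 * (c * (4 * Real.pi) ^ 2 * C)) * (‖τ‖ ^ 2 / (1 + ‖τ‖) ^ (d + 3)) := by ring
      _ ≤ _ := by
          refine mul_le_mul_of_nonneg_left ?_ (by positivity)
          rw [div_le_div_iff₀ (by positivity) (by positivity), one_mul]
          exact e2
  refine (norm_integral_le_of_norm_le ((integrable_inv_one_add_norm_pow
    (Nat.lt_succ_self d)).const_mul _) (ae_of_all _ hle)).trans (le_of_eq ?_)
  rw [integral_const_mul]
  ring

/-- The Hessian and gradient coefficients are singular at `p = 0`; cut off near `ξ`, they become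
test functions to which `integral_mainTerm` applies. Near `ξ` the subprincipal relation makes the
bracket equal to `β`, so the deviation from `1` is `ε⁴·O(ε²)`. -/
theorem exists_mainTerm {r : ℝ} (hr : 0 < r) {W V : Coord d × Coord d → ℂ}
    (hW : ContDiffOn ℝ ∞ W (conicDomain (Coord d) r))
    (hV : ContDiffOn ℝ ∞ V (conicDomain (Coord d) r)) (hrel : SubprincipalRelation W V)
    {ξ : Coord d} (hξ : ‖ξ‖ = 1) :
    ∃ (g : Fin d → Fin d → Coord d → ℂ) (h : Fin d → Coord d → ℂ) (C : ℝ), 0 ≤ C ∧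
      (∀ a b p, ‖p - ξ‖ ≤ 1 / 2 → g a b p = hessCoeff W a b p) ∧
      (∀ b p, ‖p - ξ‖ ≤ 1 / 2 → h b p = gradCoeff V b p) ∧
      (∀ a b p, ‖g a b p‖ ≤ C) ∧ (∀ b p, ‖h b p‖ ≤ C) ∧
      ∀ ε : ℝ, 0 < ε → Integrable (mainTerm g h ξ ε) ∧ ‖(∫ τ, mainTerm g h ξ ε τ) - 1‖ ≤ C * ε ^ 6 := by
  obtain ⟨β, hβ⟩ := hrel
  have hpi := Real.pi_pos
  -- The inner radius exceeds `1 / 2`, so that the derivatives of the cut-off coefficients are also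
  -- correct on the closed ball of radius `1 / 2`; the outer one is below `‖ξ‖ = 1`, which keeps the
  -- support away from `0`.
  let κ : ContDiffBump ξ := ⟨5 / 8, 3 / 4, by norm_num, by norm_num⟩
  have hκs : tsupport κ ⊆ {0}ᶜ := by
    rw [κ.tsupport_eq]
    rintro p hp rfl
    simp only [Metric.mem_closedBall, dist_zero_left, hξ, κ] at hp
    norm_num at hp
  have hκ1 : ∀ p : Coord d, ‖p - ξ‖ ≤ 5 / 8 → κ p = 1 := fun p hp =>
    κ.one_of_mem_closedBall (by simpa [dist_eq_norm] using hp)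
  have hsm : ∀ f : Coord d → ℂ, ContDiffOn ℝ ∞ f {0}ᶜ → ContDiff ℝ ∞ fun p => κ p • f p :=
    fun f hf => contDiff_of_contDiffAt_tsupport fun x hx => by
      have hx' : x ∈ ({0}ᶜ : Set (Coord d)) := hκs (tsupport_smul_subset_left κ f hx)
      exact κ.contDiffAt.smul (hf.contDiffAt (isOpen_compl_singleton.mem_nhds hx'))
  have hcs : ∀ f : Coord d → ℂ, HasCompactSupport fun p => κ p • f p := fun f =>
    κ.hasCompactSupport.smul_right
  set g : Fin d → Fin d → Coord d → ℂ := fun a b p => κ p • hessCoeff W a b p with hg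
  set h : Fin d → Coord d → ℂ := fun b p => κ p • gradCoeff V b p with hh
  have hgs : ∀ a b, ContDiff ℝ ∞ (g a b) := fun a b => hsm _ (contDiffOn_hessCoeff hr hW a b)
  have hhs : ∀ b, ContDiff ℝ ∞ (h b) := fun b => hsm _ (contDiffOn_gradCoeff hr hV b)
  have hgc : ∀ a b, HasCompactSupport (g a b) := fun a b => hcs _
  have hhc : ∀ b, HasCompactSupport (h b) := fun b => hcs _
  have hgd : ∀ a b, Continuous fun p => fderiv ℝ (g a b) p (stdVec a) := fun a b =>
    continuous_fderiv_stdVec (hgs a b) a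
  -- bounds
  have hbd : ∀ f : Coord d → ℂ, Continuous f → HasCompactSupport f → ∃ C : ℝ, 0 ≤ C ∧
      ∀ p, ‖f p‖ ≤ C := fun f hf hfc => by
    obtain ⟨C, hC⟩ := hf.bounded_above_of_compact_support hfc
    exact ⟨C, (norm_nonneg _).trans (hC 0), hC⟩
  choose Cg hCg0 hCg using fun a b => hbd (g a b) (hgs a b).continuous (hgc a b)
  choose Ch hCh0 hCh using fun b => hbd (h b) (hhs b).continuous (hhc b)
  choose Cd hCd0 hCd using fun a b => hbd _ (hgd a b) ((hgc a b).fderiv_apply ℝ (stdVec a))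
  -- moments
  choose Cm hCm0 hCm using fun b => exists_moment_bound (contDiff_coord b) (d + 3)
  set J : ℝ := ∫ τ : Coord d, 1 / (1 + ‖τ‖) ^ (d + 1) with hJ
  have hJ0 : 0 ≤ J := integral_nonneg fun τ => by positivity
  set D : Fin d → Coord d → ℂ := fun b p => (∑ a, fderiv ℝ (g a b) p (stdVec a)) + h b p with hD
  have hDβ : ∀ b p, ‖p - ξ‖ ≤ 1 / 2 → D b p = β b := fun b p hp => by
    have hp0 : p ≠ 0 := by
      rintro rfl
      rw [zero_sub, norm_neg, hξ] at hp
      norm_num at hp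
    have h1 : ∀ a, fderiv ℝ (g a b) p = fderiv ℝ (hessCoeff W a b) p := fun a => by
      apply Filter.EventuallyEq.fderiv_eq
      have : ∀ᶠ q in 𝓝 p, ‖q - ξ‖ < 5 / 8 :=
        (by fun_prop : Continuous fun q : Coord d => ‖q - ξ‖).continuousAt.eventually_lt
          continuousAt_const (by linarith)
      filter_upwards [this] with q hq
      simp [hg, hκ1 q hq.le]
    have h2 : h b p = gradCoeff V b p := by simp [hh, hκ1 p (by linarith)]
    simp only [hD, h1, h2, hβ p hp0 b]
    ring
  set CD : Fin d → ℝ := fun b => (∑ a, Cd a b) + Ch b + ‖β b‖ with hCD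
  have hCD0 : ∀ b, 0 ≤ CD b := fun b =>
    add_nonneg (add_nonneg (Finset.sum_nonneg fun a _ => hCd0 a b) (hCh0 b)) (norm_nonneg _)
  have hDb : ∀ b p, ‖D b p - β b‖ ≤ CD b := fun b p => by
    refine (norm_sub_le _ _).trans ?_
    simp only [hD, hCD]
    gcongr
    refine (norm_add_le _ _).trans (add_le_add ((norm_sum_le _ _).trans ?_) (hCh b p))
    exact Finset.sum_le_sum fun a _ => hCd a b p
  refine ⟨g, h, (∑ a, ∑ b, Cg a b) + (∑ b, Ch b) + ∑ b, CD b * (4 * Real.pi) ^ 2 * Cm b * J,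
    ?_, fun a b p hp => by simp [hg, hκ1 p (by linarith)],
    fun b p hp => by simp [hh, hκ1 p (by linarith)], fun a b p => ?_, fun b p => ?_,
    fun ε hε => ?_⟩
  · have n1 : 0 ≤ ∑ a, ∑ b, Cg a b := Finset.sum_nonneg fun a _ => Finset.sum_nonneg fun b _ => hCg0 a b
    have n2 : 0 ≤ ∑ b, Ch b := Finset.sum_nonneg fun b _ => hCh0 b
    have n3 : 0 ≤ ∑ b, CD b * (4 * Real.pi) ^ 2 * Cm b * J := Finset.sum_nonneg fun b _ =>
      mul_nonneg (mul_nonneg (mul_nonneg (hCD0 b) (sq_nonneg _)) (hCm0 b)) hJ0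
    exact add_nonneg (add_nonneg n1 n2) n3
  · have n2 : 0 ≤ ∑ b, Ch b := Finset.sum_nonneg fun b _ => hCh0 b
    have n3 : 0 ≤ ∑ b, CD b * (4 * Real.pi) ^ 2 * Cm b * J := Finset.sum_nonneg fun b _ =>
      mul_nonneg (mul_nonneg (mul_nonneg (hCD0 b) (sq_nonneg _)) (hCm0 b)) hJ0
    have n4 : Cg a b ≤ ∑ a, ∑ b, Cg a b :=
      (Finset.single_le_sum (f := fun b => Cg a b) (fun b _ => hCg0 a b) (Finset.mem_univ b)).trans
        (Finset.single_le_sum (f := fun a => ∑ b, Cg a b)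
          (fun a _ => Finset.sum_nonneg fun b _ => hCg0 a b) (Finset.mem_univ a))
    linarith [hCg a b p]
  · have n1 : 0 ≤ ∑ a, ∑ b, Cg a b := Finset.sum_nonneg fun a _ => Finset.sum_nonneg fun b _ => hCg0 a b
    have n3 : 0 ≤ ∑ b, CD b * (4 * Real.pi) ^ 2 * Cm b * J := Finset.sum_nonneg fun b _ =>
      mul_nonneg (mul_nonneg (mul_nonneg (hCD0 b) (sq_nonneg _)) (hCm0 b)) hJ0
    have n4 : Ch b ≤ ∑ b, Ch b :=
      Finset.single_le_sum (f := fun b => Ch b) (fun b _ => hCh0 b) (Finset.mem_univ b)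
    linarith [hCh b p]
  obtain ⟨hint, hval⟩ := integral_mainTerm hgs hgc hhs hhc ξ hε β
  refine ⟨hint, ?_⟩
  rw [hval, add_sub_cancel_left, norm_mul, norm_pow, Complex.norm_real, Real.norm_of_nonneg hε.le]
  have hb : ∀ b, ‖∫ τ, (D b (ξ + (2 * Real.pi * ε) • τ) - β b) * moment (fun u => (u b : ℂ)) τ‖
      ≤ ε ^ 2 * (CD b * (4 * Real.pi) ^ 2 * Cm b * J) := fun b =>
    norm_integral_sub_mul_moment_le (hCD0 b) (hCm0 b) hξ (hDβ b) (hDb b) (hCm b) hε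
  have n1 : 0 ≤ ∑ a, ∑ b, Cg a b := Finset.sum_nonneg fun a _ => Finset.sum_nonneg fun b _ => hCg0 a b
  have n2 : 0 ≤ ∑ b, Ch b := Finset.sum_nonneg fun b _ => hCh0 b
  calc _ ≤ ε ^ 4 * ∑ b, ε ^ 2 * (CD b * (4 * Real.pi) ^ 2 * Cm b * J) := by
        gcongr
        exact (norm_sum_le _ _).trans (Finset.sum_le_sum fun b _ => hb b)
    _ = (∑ b, CD b * (4 * Real.pi) ^ 2 * Cm b * J) * ε ^ 6 := by
        rw [← Finset.mul_sum]
        ring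
    _ ≤ _ := by
        gcongr
        linarith

end MainTerm

/-! ### Approximations of the packet integrals in powers of `ε`, uniform in `τ` -/

section PacketAsymptotics

variable {d : ℕ}

/-- The contribution of the frequency `τ` to the action of `e^{iφ} A` on a wave packet. -/
def packetIntegral (W A : Coord d × Coord d → ℂ) (ξ : Coord d) (ε : ℝ) (τ : Coord d) : ℂ :=
  ∫ u, osc τ u * (Complex.exp (Complex.I * W (ε ^ 4 • u, freq ξ ε τ)) *
    (A (ε ^ 4 • u, freq ξ ε τ) * (unitBump d u : ℂ)))

/-- `T` is an approximation of `packetIntegral W A ξ` up to `O(ε ^ m)` at frequencies near `ξ`, and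
is itself `O(ε ^ m)` at the other ones. -/
def IsApprox (W A : Coord d × Coord d → ℂ) (ξ : Coord d) (m : ℕ) (T : ℝ → Coord d → ℂ) : Prop :=
  ∃ C : ℝ, 0 ≤ C ∧ ∃ ε₀ : ℝ, 0 < ε₀ ∧ ∀ ε : ℝ, 0 < ε → ε ≤ ε₀ → ∀ τ : Coord d,
    (4 * Real.pi * ε * ‖τ‖ ≤ 1 →
      ‖packetIntegral W A ξ ε τ - T ε τ‖ ≤ C * (ε ^ m / (1 + ‖τ‖) ^ (d + 1))) ∧
    (1 ≤ 4 * Real.pi * ε * ‖τ‖ → ‖T ε τ‖ ≤ C * (ε ^ m / (1 + ‖τ‖) ^ (d + 1)))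

/-- At far frequencies `1/‖τ‖` is at most `4πε`, so surplus decay in `τ` is converted into powers of
`ε`. -/
lemma one_div_pow_le_of_far {ε : ℝ} {τ : Coord d} (hε : 0 < ε) (h : 1 ≤ 4 * Real.pi * ε * ‖τ‖)
    (m : ℕ) : 1 / (1 + ‖τ‖) ^ m ≤ (4 * Real.pi) ^ m * ε ^ m := by
  have hpi := Real.pi_pos
  rw [div_le_iff₀ (by positivity), ← mul_pow, ← mul_pow]
  refine one_le_pow₀ (h.trans ?_)
  have : 0 < 4 * Real.pi * ε := by positivity
  nlinarith

/-- Fourier moments are negligible at far frequencies. -/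
lemma exists_moment_far_bound {m : Coord d → ℂ} (hm : ContDiff ℝ ∞ m) (n : ℕ) :
    ∃ C : ℝ, 0 ≤ C ∧ ∀ ε : ℝ, 0 < ε → ∀ τ : Coord d, 1 ≤ 4 * Real.pi * ε * ‖τ‖ →
      ‖moment m τ‖ ≤ C * (ε ^ n / (1 + ‖τ‖) ^ (d + 1)) := by
  obtain ⟨C, hC0, hC⟩ := exists_moment_bound hm (d + 1 + n)
  have hpi := Real.pi_pos
  refine ⟨C * (4 * Real.pi) ^ n, by positivity, fun ε hε τ hτ => (hC τ).trans ?_⟩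
  have h1 := one_div_pow_le_of_far hε hτ n
  calc C / (1 + ‖τ‖) ^ (d + 1 + n)
      = C * ((1 / (1 + ‖τ‖) ^ n) * (1 / (1 + ‖τ‖) ^ (d + 1))) := by
        rw [pow_add]; field_simp
    _ ≤ C * (((4 * Real.pi) ^ n * ε ^ n) * (1 / (1 + ‖τ‖) ^ (d + 1))) := by gcongr
    _ = _ := by ring

/-- The amplitude is frozen at `ξ`: by a Lipschitz bound this costs `ε‖τ‖`, and one extra power of
decay of the moment absorbs `‖τ‖`. The prefactor `ε^{5k}` is the homogeneity `-k` at frequency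
`ε⁻⁵`. -/
lemma isApprox_const {r : ℝ} (hr : 0 < r) {W A : Coord d × Coord d → ℂ}
    (hW : IsPerturbation r W) {k : ℕ} (hA : IsConic r (-k) A) {ξ : Coord d} (hξ : ‖ξ‖ = 1) :
    IsApprox W A ξ (5 * k + 1) fun ε τ => (ε : ℂ) ^ (5 * k) * A (0, ξ) * moment (fun _ => 1) τ := by
  obtain ⟨C₁, hC₁0, ε₁, hε₁, hC₁⟩ := exists_near_bound hr hW hA hξ (d + 1)
  obtain ⟨C₂, hC₂0, hC₂⟩ := exists_moment_bound (d := d) (m := fun _ => 1) contDiff_const (d + 2)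
  obtain ⟨C₃, hC₃0, hC₃⟩ := exists_moment_far_bound (d := d) (m := fun _ => 1) contDiff_const 1
  have hpi := Real.pi_pos
  -- Lipschitz bound of `A (0, ·)` near `ξ`
  have hsub : Metric.closedBall ξ (1 / 2) ⊆ ({0}ᶜ : Set (Coord d)) := by
    rintro p hp rfl
    simp only [Metric.mem_closedBall, dist_zero_left, hξ] at hp
    norm_num at hp
  have hA0 : ContDiffOn ℝ ∞ (fun p : Coord d => A (0, p)) {0}ᶜ :=
    hA.smooth.comp (f := fun p : Coord d => ((0 : Coord d), p)) (by fun_prop)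
      fun p hp => zero_mem_conicDomain hr hp
  have hdc : ContinuousOn (fun p => fderiv ℝ (fun p : Coord d => A (0, p)) p)
      (Metric.closedBall ξ (1 / 2)) :=
    (hA0.continuousOn_fderiv_of_isOpen isOpen_compl_singleton (by norm_num)).mono hsub
  obtain ⟨L, hL⟩ := (isCompact_closedBall ξ (1 / 2)).bddAbove_image hdc.norm
  have hLip : ∀ p ∈ Metric.closedBall ξ (1 / 2), ‖A (0, p) - A (0, ξ)‖ ≤ max L 0 * ‖p - ξ‖ :=
    fun p hp => (convex_closedBall ξ (1 / 2)).norm_image_sub_le_of_norm_fderiv_le (𝕜 := ℝ)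
      (f := fun p : Coord d => A (0, p)) (fun q hq => (hA0.contDiffAt
        (isOpen_compl_singleton.mem_nhds (hsub hq))).differentiableAt (by norm_num))
      (fun q hq => (hL ⟨q, hq, rfl⟩).trans (le_max_left _ _))
      (Metric.mem_closedBall_self (by norm_num)) hp
  refine ⟨C₁ + max L 0 * (2 * Real.pi) * C₂ + ‖A (0, ξ)‖ * C₃, by positivity, ε₁, hε₁,
    fun ε hε hε0 τ => ⟨fun hτ => ?_, fun hτ => ?_⟩⟩
  · have h1 := hC₁ ε hε hε0 τ hτ
    obtain ⟨hζ, -, -⟩ := norm_freq_base hξ hε hτ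
    have h2 := hLip _ hζ
    rw [add_sub_cancel_left, norm_smul, Real.norm_of_nonneg (by positivity)] at h2
    have h3 : ‖(ε : ℂ) ^ (5 * k) * (A (0, ξ + (2 * Real.pi * ε) • τ) * moment (fun _ => 1) τ)
        - (ε : ℂ) ^ (5 * k) * A (0, ξ) * moment (fun _ => 1) τ‖
        ≤ max L 0 * (2 * Real.pi) * C₂ * (ε ^ (5 * k + 1) / (1 + ‖τ‖) ^ (d + 1)) := by
      rw [show (ε : ℂ) ^ (5 * k) * (A (0, ξ + (2 * Real.pi * ε) • τ) * moment (fun _ => 1) τ)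
        - (ε : ℂ) ^ (5 * k) * A (0, ξ) * moment (fun _ => 1) τ = (ε : ℂ) ^ (5 * k) *
          ((A (0, ξ + (2 * Real.pi * ε) • τ) - A (0, ξ)) * moment (fun _ => 1) τ) by ring,
        norm_mul, norm_mul, norm_pow, Complex.norm_real, Real.norm_of_nonneg hε.le]
      calc _ ≤ ε ^ (5 * k) * ((max L 0 * (2 * Real.pi * ε * ‖τ‖)) * (C₂ / (1 + ‖τ‖) ^ (d + 2))) := by
            gcongr
            exact hC₂ τ
        _ = max L 0 * (2 * Real.pi) * C₂ * (ε ^ (5 * k + 1) * (‖τ‖ / (1 + ‖τ‖) ^ (d + 2))) := by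
            ring
        _ ≤ max L 0 * (2 * Real.pi) * C₂ * (ε ^ (5 * k + 1) * (1 / (1 + ‖τ‖) ^ (d + 1))) := by
            gcongr ?_ * (?_ * ?_)
            rw [div_le_div_iff₀ (by positivity) (by positivity), one_mul, pow_succ _ (d + 1),
              mul_comm]
            gcongr
            linarith
        _ = _ := by ring
    calc _ ≤ C₁ * ε ^ (5 * k + 1) / (1 + ‖τ‖) ^ (d + 1)
          + max L 0 * (2 * Real.pi) * C₂ * (ε ^ (5 * k + 1) / (1 + ‖τ‖) ^ (d + 1)) :=
          (norm_sub_le_norm_sub_add_norm_sub _ _ _).trans (add_le_add h1 h3)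
      _ = (C₁ + max L 0 * (2 * Real.pi) * C₂) * (ε ^ (5 * k + 1) / (1 + ‖τ‖) ^ (d + 1)) := by ring
      _ ≤ _ := by
          refine mul_le_mul_of_nonneg_right ?_ (by positivity)
          have : 0 ≤ ‖A (0, ξ)‖ * C₃ := by positivity
          linarith
  · rw [norm_mul, norm_mul, norm_pow, Complex.norm_real, Real.norm_of_nonneg hε.le]
    calc _ ≤ ε ^ (5 * k) * ‖A (0, ξ)‖ * (C₃ * (ε ^ 1 / (1 + ‖τ‖) ^ (d + 1))) := by
          gcongr
          exact hC₃ ε hε τ hτ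
      _ = (‖A (0, ξ)‖ * C₃) * (ε ^ (5 * k + 1) / (1 + ‖τ‖) ^ (d + 1)) := by ring
      _ ≤ _ := by
          refine mul_le_mul_of_nonneg_right ?_ (by positivity)
          have : 0 ≤ C₁ + max L 0 * (2 * Real.pi) * C₂ := by positivity
          linarith

lemma isApprox_zero {r : ℝ} (hr : 0 < r) {W A : Coord d × Coord d → ℂ}
    (hW : IsPerturbation r W) {k : ℕ} (hA : IsConic r (-k) A) {ξ : Coord d} (hξ : ‖ξ‖ = 1)
    {m : ℕ} (hm : m ≤ 5 * k) : IsApprox W A ξ m fun _ _ => 0 := by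
  obtain ⟨C₁, hC₁0, ε₁, hε₁, hC₁⟩ := isApprox_const hr hW hA hξ
  obtain ⟨C₂, hC₂0, hC₂⟩ := exists_moment_bound (d := d) (m := fun _ => 1) contDiff_const (d + 1)
  refine ⟨C₁ + ‖A (0, ξ)‖ * C₂, by positivity, min ε₁ 1, by positivity,
    fun ε hε hε0 τ => ⟨fun hτ => ?_, fun hτ => by rw [norm_zero]; positivity⟩⟩
  have h1 := (hC₁ ε hε (hε0.trans (min_le_left _ _)) τ).1 hτ
  have he1 : ε ≤ 1 := hε0.trans (min_le_right _ _)
  have h2 : ‖(ε : ℂ) ^ (5 * k) * A (0, ξ) * moment (fun _ => 1) τ‖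
      ≤ ‖A (0, ξ)‖ * C₂ * (ε ^ m / (1 + ‖τ‖) ^ (d + 1)) := by
    rw [norm_mul, norm_mul, norm_pow, Complex.norm_real, Real.norm_of_nonneg hε.le]
    calc _ ≤ ε ^ m * ‖A (0, ξ)‖ * (C₂ / (1 + ‖τ‖) ^ (d + 1)) := by
          gcongr ?_ * _ * ?_
          · exact pow_le_pow_of_le_one hε.le he1 hm
          · exact hC₂ τ
      _ = _ := by ring
  have h3 : C₁ * (ε ^ (5 * k + 1) / (1 + ‖τ‖) ^ (d + 1)) ≤ C₁ * (ε ^ m / (1 + ‖τ‖) ^ (d + 1)) := by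
    gcongr C₁ * (?_ / _)
    exact pow_le_pow_of_le_one hε.le he1 (by lia)
  rw [sub_zero, add_mul]
  have h4 := norm_add_le (packetIntegral W A ξ ε τ - (ε : ℂ) ^ (5 * k) * A (0, ξ) *
    moment (fun _ => 1) τ) ((ε : ℂ) ^ (5 * k) * A (0, ξ) * moment (fun _ => 1) τ)
  rw [sub_add_cancel] at h4
  linarith

lemma freq_ne_zero {ξ : Coord d} (hξ : ‖ξ‖ = 1) {ε : ℝ} (hε : 0 < ε) {τ : Coord d}
    (hτ : 4 * Real.pi * ε * ‖τ‖ ≤ 1) : freq ξ ε τ ≠ 0 := by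
  obtain ⟨-, h, -⟩ := norm_freq_base hξ hε hτ
  have h1 : ξ + (2 * Real.pi * ε) • τ ≠ 0 := by
    intro h0
    rw [h0, norm_zero] at h
    norm_num at h
  exact smul_ne_zero (by positivity) h1

/-- Since the principal symbol is `1` on the whole ball, it disappears from the amplitude and leaves
`V` alone. Near `ξ` the cut-off coefficients are the true ones, so the expansion applies; far away
only the decay of the moments and the bound `C₀` are used. -/
lemma isApprox_mainTerm {r : ℝ} (hr : 0 < r) {W V a₀ : Coord d × Coord d → ℂ}
    (hW : IsPerturbation r W) (hV : IsConic r 0 V) (hV1 : ∀ p : Coord d, p ≠ 0 → V (0, p) = 1)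
    (ha₀ : ∀ z ∈ Metric.ball (0 : Coord d) r, ∀ p : Coord d, p ≠ 0 → a₀ (z, p) = 1)
    {ξ : Coord d} (hξ : ‖ξ‖ = 1) {g : Fin d → Fin d → Coord d → ℂ} {h : Fin d → Coord d → ℂ}
    {C₀ : ℝ} (hC₀ : 0 ≤ C₀) (hg : ∀ a b p, ‖p - ξ‖ ≤ 1 / 2 → g a b p = hessCoeff W a b p)
    (hh : ∀ b p, ‖p - ξ‖ ≤ 1 / 2 → h b p = gradCoeff V b p)
    (hgC : ∀ a b p, ‖g a b p‖ ≤ C₀) (hhC : ∀ b p, ‖h b p‖ ≤ C₀) :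
    IsApprox W (fun x => V x * a₀ x) ξ 6 (mainTerm g h ξ) := by
  obtain ⟨C₁, hC₁0, ε₁, hε₁, hC₁⟩ := exists_near_expansion hr hW hV hV1 hξ (d + 1)
  obtain ⟨C₂, hC₂0, hC₂⟩ := exists_moment_far_bound (d := d) (m := fun _ => 1) contDiff_const 6
  choose C₃ hC₃0 hC₃ using fun a b => exists_moment_far_bound (d := d)
    ((contDiff_coord a).mul (contDiff_coord b)) 6
  choose C₄ hC₄0 hC₄ using fun b => exists_moment_far_bound (d := d) (contDiff_coord b) 6
  have n3 : 0 ≤ ∑ b, ∑ a, C₀ * C₃ a b :=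
    Finset.sum_nonneg fun b _ => Finset.sum_nonneg fun a _ => mul_nonneg hC₀ (hC₃0 a b)
  have n4 : 0 ≤ ∑ b, C₀ * C₄ b := Finset.sum_nonneg fun b _ => mul_nonneg hC₀ (hC₄0 b)
  refine ⟨C₁ + (C₂ + (∑ b, ∑ a, C₀ * C₃ a b) + ∑ b, C₀ * C₄ b), by positivity,
    min ε₁ (min 1 (r / 2)), by positivity, fun ε hε hε0 τ => ⟨fun hτ => ?_, fun hτ => ?_⟩⟩
  · have h1 := hC₁ ε hε (hε0.trans (min_le_left _ _)) τ hτ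
    obtain ⟨hζ, -, -⟩ := norm_freq_base hξ hε hτ
    rw [mem_closedBall_iff_norm] at hζ
    have h2 : packetIntegral W (fun x => V x * a₀ x) ξ ε τ = ∫ u, osc τ u *
        (Complex.exp (Complex.I * W (ε ^ 4 • u, freq ξ ε τ)) *
          (V (ε ^ 4 • u, freq ξ ε τ) * (unitBump d u : ℂ))) := by
      refine integral_congr_ae (ae_of_all _ fun u => ?_)
      by_cases hu : u ∈ Metric.closedBall (0 : Coord d) 1
      · have hu' := norm_smul_le_of_mem_unitBall (R := r / 2) hε
          (hε0.trans ((min_le_right _ _).trans (min_le_left _ _)))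
          (hε0.trans ((min_le_right _ _).trans (min_le_right _ _))) hu
        simp only
        rw [ha₀ _ (by simp only [Metric.mem_ball, dist_zero_right]; linarith) _
          (freq_ne_zero hξ hε hτ), mul_one]
      · simp [unitBump_eq_zero hu]
    rw [h2, mainTerm]
    simp_rw [hg _ _ _ hζ, hh _ _ hζ]
    calc _ ≤ C₁ * (ε ^ 6 / (1 + ‖τ‖) ^ (d + 1)) := h1.trans (le_of_eq (by ring))
      _ ≤ _ := by
        refine mul_le_mul_of_nonneg_right ?_ (by positivity)
        linarith
  · have he1 : ε ≤ 1 := hε0.trans ((min_le_right _ _).trans (min_le_left _ _))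
    set X : ℝ := ε ^ 6 / (1 + ‖τ‖) ^ (d + 1) with hX
    have hX0 : 0 ≤ X := by positivity
    have t1 : ‖moment (fun _ => 1) τ‖ ≤ C₂ * X := hC₂ ε hε τ hτ
    have t2 : ‖Complex.I * (ε : ℂ) ^ 3 * ∑ b, ∑ a, g a b (ξ + (2 * Real.pi * ε) • τ) *
        moment (fun u => (u a : ℂ) * (u b : ℂ)) τ‖ ≤ (∑ b, ∑ a, C₀ * C₃ a b) * X := by
      rw [norm_mul, norm_mul, norm_pow, Complex.norm_I, Complex.norm_real,
        Real.norm_of_nonneg hε.le, one_mul, Finset.sum_mul]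
      refine (mul_le_of_le_one_left (norm_nonneg _) (pow_le_one₀ hε.le he1)).trans ?_
      refine (norm_sum_le _ _).trans (Finset.sum_le_sum fun b _ => ?_)
      rw [Finset.sum_mul]
      refine (norm_sum_le _ _).trans (Finset.sum_le_sum fun a _ => ?_)
      rw [norm_mul]
      exact (mul_le_mul (hgC a b _) (hC₃ a b ε hε τ hτ) (norm_nonneg _) hC₀).trans (le_of_eq (by ring))
    have t3 : ‖(ε : ℂ) ^ 4 * ∑ b, h b (ξ + (2 * Real.pi * ε) • τ) *
        moment (fun u => (u b : ℂ)) τ‖ ≤ (∑ b, C₀ * C₄ b) * X := by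
      rw [norm_mul, norm_pow, Complex.norm_real, Real.norm_of_nonneg hε.le, Finset.sum_mul]
      refine (mul_le_of_le_one_left (norm_nonneg _) (pow_le_one₀ hε.le he1)).trans ?_
      refine (norm_sum_le _ _).trans (Finset.sum_le_sum fun b _ => ?_)
      rw [norm_mul]
      exact (mul_le_mul (hhC b _) (hC₄ b ε hε τ hτ) (norm_nonneg _) hC₀).trans (le_of_eq (by ring))
    rw [mainTerm]
    refine (norm_add₃_le).trans ?_
    have : 0 ≤ C₁ * X := by positivity
    linarith

end PacketAsymptotics

/-! ### Wave packets and the kernel in centred coordinates -/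

section LocalOperators

variable {d : ℕ}

/-- Change of variables adapted to wave packets. -/
lemma integral_integral_eq_freq {F : Coord d → Coord d → ℂ} (hF : Continuous F.uncurry)
    {R R' : ℝ} (hF0 : ∀ z p, F z p ≠ 0 → ‖z‖ ≤ R ∧ ‖p‖ ≤ R') (ξ : Coord d) {ε : ℝ} (hε : 0 < ε) :
    (((2 * Real.pi) ^ d : ℝ) : ℂ)⁻¹ * ∫ z, ∫ p, F z p
      = ∫ τ, ∫ u, F (ε ^ 4 • u) (freq ξ ε τ) ∧
    Integrable (fun τ => ∫ u, F (ε ^ 4 • u) (freq ξ ε τ)) := by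
  have hpi := Real.pi_pos
  have hfreq : ∀ τ, freq ξ ε τ = (ε ^ 5)⁻¹ • ξ + (2 * Real.pi * (ε ^ 4)⁻¹) • τ := fun τ => by
    rw [freq, smul_add, smul_smul]
    congr 2
    field_simp
  set G : Coord d → Coord d → ℂ := fun τ u => F (ε ^ 4 • u) (freq ξ ε τ) with hG
  have hGc : Continuous G.uncurry := by
    have : G.uncurry = F.uncurry ∘ fun x : Coord d × Coord d => (ε ^ 4 • x.2, freq ξ ε x.1) := rfl
    rw [this]
    refine hF.comp ?_
    unfold freq
    fun_prop
  have hGs : HasCompactSupport G.uncurry := by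
    refine HasCompactSupport.intro ((isCompact_closedBall (0 : Coord d)
      ((R' + ‖(ε ^ 5)⁻¹ • ξ‖) / (2 * Real.pi * (ε ^ 4)⁻¹))).prod
      (isCompact_closedBall (0 : Coord d) (R / ε ^ 4))) ?_
    rintro ⟨τ, u⟩ hx
    by_contra hne
    obtain ⟨h1, h2⟩ := hF0 _ _ hne
    refine hx ⟨?_, ?_⟩
    · rw [mem_closedBall_zero_iff, le_div_iff₀ (by positivity), mul_comm,
        ← Real.norm_of_nonneg (show 0 ≤ 2 * Real.pi * (ε ^ 4)⁻¹ by positivity), ← norm_smul]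
      rw [hfreq] at h2
      have := norm_sub_le ((ε ^ 5)⁻¹ • ξ + (2 * Real.pi * (ε ^ 4)⁻¹) • τ) ((ε ^ 5)⁻¹ • ξ)
      rw [add_sub_cancel_left] at this
      linarith
    · rw [mem_closedBall_zero_iff, le_div_iff₀ (by positivity), mul_comm,
        ← Real.norm_of_nonneg (show 0 ≤ ε ^ 4 by positivity), ← norm_smul]
      simpa using h1
  have hGi : Integrable G.uncurry ((volume : Measure (Coord d)).prod volume) :=
    hGc.integrable_of_hasCompactSupport hGs
  refine ⟨?_, hGi.integral_prod_left⟩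
  -- The substitutions contribute `(2πε⁻⁴)^{-d}` in the frequency and `ε^{-4d}` in the position;
  -- their product is the prefactor `(2π)^{-d}`.
  rw [integral_integral_swap_of_hasCompactSupport hGc hGs]
  have e1 : ∀ z, ∫ τ, F z (freq ξ ε τ) = (((2 * Real.pi * (ε ^ 4)⁻¹) ^ d : ℝ) : ℂ)⁻¹ * ∫ p, F z p := by
    intro z
    simp_rw [hfreq]
    rw [Measure.integral_comp_smul (μ := volume)
      (f := fun p => F z ((ε ^ 5)⁻¹ • ξ + p)) (R := 2 * Real.pi * (ε ^ 4)⁻¹),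
      integral_add_left_eq_self (μ := volume) (F z) ((ε ^ 5)⁻¹ • ξ), finrank_euclideanSpace_fin,
      abs_of_nonneg (by positivity), Complex.real_smul, Complex.ofReal_inv]
  simp_rw [hG, e1, integral_const_mul]
  rw [Measure.integral_comp_smul (μ := volume) (f := fun z => ∫ p, F z p) (R := ε ^ 4),
    finrank_euclideanSpace_fin, abs_of_nonneg (by positivity), Complex.real_smul, ← mul_assoc]
  congr 1
  have : (ε : ℂ) ≠ 0 := by exact_mod_cast hε.ne'
  have : (Real.pi : ℂ) ≠ 0 := by exact_mod_cast hpi.ne'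
  push_cast
  field_simp
  rw [← mul_pow]
  congr 1
  field_simp

/-- The wave packet at the origin with frequency `ε⁻⁵ ξ` and width `ε⁴`. -/
def packet (ξ : Coord d) (ε : ℝ) (z : Coord d) : ℂ :=
  (unitBump d ((ε ^ 4)⁻¹ • z) : ℂ) * Complex.exp (Complex.I * (((ε ^ 5)⁻¹ * inner ℝ z ξ : ℝ) : ℂ))

lemma contDiff_packet (ξ : Coord d) (ε : ℝ) : ContDiff ℝ ∞ (packet ξ ε) := by
  unfold packet
  have h1 : ContDiff ℝ ∞ fun z : Coord d => unitBump d ((ε ^ 4)⁻¹ • z) :=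
    (unitBump d).contDiff.comp (contDiff_const_smul _)
  have h2 : ContDiff ℝ ∞ fun z : Coord d => (ε ^ 5)⁻¹ * inner ℝ z ξ :=
    contDiff_const.mul (contDiff_id.inner ℝ contDiff_const)
  exact (Complex.ofRealCLM.contDiff.comp h1).mul
    (contDiff_const.mul (Complex.ofRealCLM.contDiff.comp h2)).cexp

lemma packet_zero (ξ : Coord d) (ε : ℝ) : packet ξ ε 0 = 1 := by
  simp [packet, unitBump_zero]

lemma norm_packet (ξ : Coord d) (ε : ℝ) (z : Coord d) :
    ‖packet ξ ε z‖ = unitBump d ((ε ^ 4)⁻¹ • z) := by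
  rw [packet, norm_mul, mul_comm Complex.I, Complex.norm_exp_ofReal_mul_I, mul_one,
    Complex.norm_real, Real.norm_of_nonneg (unitBump d).nonneg]

lemma norm_le_of_packet_ne_zero {ξ : Coord d} {ε : ℝ} (hε : 0 < ε) {z : Coord d}
    (h : packet ξ ε z ≠ 0) : ‖z‖ ≤ ε ^ 4 := by
  by_contra hz
  refine h ?_
  rw [packet, unitBump_eq_zero, Complex.ofReal_zero, zero_mul]
  rw [mem_closedBall_zero_iff, norm_smul, Real.norm_of_nonneg (by positivity), inv_mul_le_iff₀
    (by positivity), mul_one]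
  exact hz

lemma integral_norm_packet (ξ : Coord d) {ε : ℝ} (hε : 0 < ε) :
    ∫ z, ‖packet ξ ε z‖ = ε ^ (4 * d) * ∫ u, unitBump d u := by
  simp_rw [norm_packet]
  rw [Measure.integral_comp_smul (μ := volume) (f := fun u => unitBump d u),
    finrank_euclideanSpace_fin, abs_of_nonneg (by positivity), smul_eq_mul]
  congr 1
  rw [inv_pow, inv_inv, pow_mul]

/-- In the rescaled variables `z·p = ε⁻¹ u·ξ + 2π u·τ`. The first summand is the phase of the packet
and cancels, and the second is the Fourier character. -/
lemma exp_mul_packet (W : ℂ) (ξ : Coord d) {ε : ℝ} (hε : 0 < ε) (τ u : Coord d) :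
    Complex.exp (Complex.I * (W - ((inner ℝ (ε ^ 4 • u) (freq ξ ε τ) : ℝ) : ℂ))) *
      packet ξ ε (ε ^ 4 • u) = osc τ u * (Complex.exp (Complex.I * W) * (unitBump d u : ℂ)) := by
  have h0 : (ε : ℂ) ≠ 0 := by exact_mod_cast hε.ne'
  rw [packet, osc, smul_smul, inv_mul_cancel₀ (by positivity), one_smul]
  rw [show ∀ a b c e f : ℂ, Complex.exp a * (b * Complex.exp c) = Complex.exp e *
    (Complex.exp f * b) ↔ Complex.exp (a + c) * b = Complex.exp (e + f) * b by
      intro a b c e f; rw [Complex.exp_add, Complex.exp_add]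
      constructor <;> intro h <;> linear_combination h]
  congr 2
  simp only [freq, inner_smul_left, inner_smul_right, inner_add_right, RCLike.conj_to_real]
  push_cast
  field_simp
  ring

/-- The kernel `K (z, p)`, in coordinates centred at a point, of an operator
`f ↦ (2π)⁻ᵈ ∫∫ K f dz dp` regularised by means of `ψ (θ H)`: at high frequencies it is
`e^{i (W - z·p)} V ∑ aₖ` up to an integrable remainder. -/
structure IsLocalKernel (r : ℝ) (W V : Coord d × Coord d → ℂ) (H : Coord d × Coord d → ℝ)
    (a : ℕ → Coord d × Coord d → ℂ) (K : Coord d × Coord d → ℂ) : Prop where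
  pos : 0 < r
  perturbation : IsPerturbation r W
  weight : IsConic r 0 V
  weight_zero : ∀ p : Coord d, p ≠ 0 → V (0, p) = 1
  length : IsConicLength r H
  continuousOn_length : ContinuousOn H (Metric.ball 0 r ×ˢ univ)
  symbol : ∀ k : ℕ, IsConic r (-k) (a k)
  continuousOn : ContinuousOn K (Metric.ball 0 r ×ˢ univ)
  expansion : ∃ R₀ : ℝ, 1 ≤ R₀ ∧ ∃ C : ℝ, ∀ z p : Coord d, ‖z‖ ≤ r / 2 → R₀ ≤ ‖p‖ →
    ‖K (z, p) - Complex.exp (Complex.I * (W (z, p) - ((inner ℝ z p : ℝ) : ℂ))) *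
      (V (z, p) * ∑ k ∈ Finset.range (d + 2), a k (z, p))‖ ≤ C / ‖p‖ ^ (d + 2)

/-- Minimum over a compact piece of the unit sphere bundle, extended by homogeneity. -/
lemma IsConicLength.exists_lower_bound {r : ℝ} (hr : 0 < r) {H : Coord d × Coord d → ℝ}
    (hH : IsConicLength r H) :
    ∃ c : ℝ, 0 < c ∧ ∀ z p : Coord d, ‖z‖ ≤ r / 2 → p ≠ 0 → c * ‖p‖ ≤ H (z, p) := by
  have hcomp : IsCompact (Metric.closedBall (0 : Coord d) (r / 2) ×ˢ
      Metric.sphere (0 : Coord d) 1) := (isCompact_closedBall _ _).prod (isCompact_sphere _ _)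
  have hsub : Metric.closedBall (0 : Coord d) (r / 2) ×ˢ Metric.sphere (0 : Coord d) 1
      ⊆ conicDomain (Coord d) r := by
    rintro ⟨z, p⟩ ⟨hz, hp⟩
    refine ⟨Metric.closedBall_subset_ball (by linarith) hz, ?_⟩
    rintro rfl
    simp at hp
  obtain ⟨c, hc, hcH⟩ : ∃ c : ℝ, 0 < c ∧ ∀ x ∈ Metric.closedBall (0 : Coord d) (r / 2) ×ˢ
      Metric.sphere (0 : Coord d) 1, c ≤ H x := by
    rcases (Metric.closedBall (0 : Coord d) (r / 2) ×ˢ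
      Metric.sphere (0 : Coord d) 1).eq_empty_or_nonempty with he | hne
    · exact ⟨1, one_pos, by simp [he]⟩
    · obtain ⟨x, hx, hmin⟩ := hcomp.exists_isMinOn hne (hH.smooth.continuousOn.mono hsub)
      exact ⟨H x, hH.pos x.1 (hsub hx).1 x.2 (hsub hx).2, hmin⟩
  refine ⟨c, hc, fun z p hz hp => ?_⟩
  have hz' : z ∈ Metric.ball (0 : Coord d) r := by
    rw [mem_ball_zero_iff]; linarith
  have hp' : 0 < ‖p‖ := norm_pos_iff.2 hp
  have h1 := hH.homogeneous z hz' (‖p‖⁻¹ • p) (smul_ne_zero (by positivity) hp) ‖p‖ hp'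
  rw [smul_smul, mul_inv_cancel₀ hp'.ne', one_smul] at h1
  rw [h1, mul_comm]
  gcongr
  refine hcH _ ⟨by simpa using hz, ?_⟩
  rw [mem_sphere_zero_iff_norm, norm_smul, norm_inv, norm_norm, inv_mul_cancel₀ hp'.ne']

end LocalOperators

/-! ### Asymptotics of the regularised kernel, frequency by frequency -/

section LocalOperators

variable {d : ℕ}

lemma norm_integral_le_of_unitBump {C : ℝ} {f : Coord d → ℂ}
    (h : ∀ u, ‖f u‖ ≤ C * unitBump d u) : ‖∫ u, f u‖ ≤ C * ∫ u, unitBump d u := by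
  rw [← integral_const_mul]
  exact norm_integral_le_of_norm_le ((unitBump d).integrable.const_mul C) (ae_of_all _ h)

/-- The kernel is controlled only on the support of the bump; elsewhere the packet factor vanishes
and no bound is required. -/
lemma norm_mul_mul_le {x y z : ℂ} {A B β : ℝ} (hx : ‖x‖ ≤ A) (hz : ‖z‖ = β)
    (hy : β ≠ 0 → ‖y‖ ≤ B) : ‖x * y * z‖ ≤ A * B * β := by
  rw [norm_mul, norm_mul, hz]
  by_cases h : β = 0
  · simp [h]
  · exact mul_le_mul_of_nonneg_right (mul_le_mul hx (hy h) (norm_nonneg _)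
      ((norm_nonneg _).trans hx)) (hz ▸ norm_nonneg z)

/-- The regularised contribution of the frequency `τ`. -/
def packetKernelIntegral (H : Coord d × Coord d → ℝ) (K : Coord d × Coord d → ℂ) (ψ : ℝ → ℝ)
    (ξ : Coord d) (ε θ : ℝ) (τ : Coord d) : ℂ :=
  ∫ u, (ψ (θ * H (ε ^ 4 • u, freq ξ ε τ)) : ℂ) * K (ε ^ 4 • u, freq ξ ε τ) *
    packet ξ ε (ε ^ 4 • u)

/-- The packet integrals of the kernel which is regularised by means of `ψ`. -/
def regularizedIntegral (H : Coord d × Coord d → ℝ) (W A : Coord d × Coord d → ℂ) (ψ : ℝ → ℝ)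
    (ξ : Coord d) (ε θ : ℝ) (τ : Coord d) : ℂ :=
  ∫ u, osc τ u * (Complex.exp (Complex.I * W (ε ^ 4 • u, freq ξ ε τ)) *
    ((ψ (θ * H (ε ^ 4 • u, freq ξ ε τ)) : ℂ) * A (ε ^ 4 • u, freq ξ ε τ) * (unitBump d u : ℂ)))

/-- The regularised integrals of a homogeneous amplitude. -/
lemma exists_regularized_bound {r : ℝ} (hr : 0 < r) {W A : Coord d × Coord d → ℂ}
    (hW : IsPerturbation r W) {k : ℕ} (hA : IsConic r (-k) A) {H : Coord d × Coord d → ℝ}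
    (hH : IsConicLength r H) (hHc : ContinuousOn H (Metric.ball 0 r ×ˢ univ))
    {ψ : ℝ → ℝ} (hψ : ContDiff ℝ ∞ ψ) (hψc : HasCompactSupport ψ)
    (hψ1 : ∀ᶠ t in 𝓝 0, ψ t = 1) {ξ : Coord d} (hξ : ‖ξ‖ = 1) {m : ℕ} {T : ℝ → Coord d → ℂ}
    (hT : IsApprox W A ξ m T) :
    ∃ C : ℝ, 0 ≤ C ∧ ∃ ε₀ : ℝ, 0 < ε₀ ∧ ∀ ε : ℝ, 0 < ε → ε ≤ ε₀ → ∀ᶠ θ in 𝓝[>] (0 : ℝ),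
      ∀ τ : Coord d, 1 ≤ ‖freq ξ ε τ‖ →
        ‖regularizedIntegral H W A ψ ξ ε θ τ - T ε τ‖ ≤ C * (ε ^ m / (1 + ‖τ‖) ^ (d + 1)) := by
  have hpi := Real.pi_pos
  obtain ⟨C₁, hC₁, ε₁, hε₁, h₁⟩ := hT
  obtain ⟨C₂, hC₂, ε₂, hε₂, h₂⟩ := exists_far_bound hr hW hA hH hψ hψc hξ (d + 1 + m)
  refine ⟨C₁ + C₂ * (2 ^ (d + 1 + m) * (4 * Real.pi) ^ m), by positivity,
    min (min ε₁ ε₂) (min (min 1 (r / 2)) (1 / (4 * Real.pi))), by positivity, fun ε hε hε0 => ?_⟩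
  have hεε₁ : ε ≤ ε₁ := hε0.trans ((min_le_left _ _).trans (min_le_left _ _))
  have hεε₂ : ε ≤ ε₂ := hε0.trans ((min_le_left _ _).trans (min_le_right _ _))
  have hε1 : ε ≤ 1 := hε0.trans ((min_le_right _ _).trans ((min_le_left _ _).trans
    (min_le_left _ _)))
  have hεr : ε ≤ r / 2 := hε0.trans ((min_le_right _ _).trans ((min_le_left _ _).trans
    (min_le_right _ _)))
  have hεπ : ε ≤ 1 / (4 * Real.pi) := hε0.trans ((min_le_right _ _).trans (min_le_right _ _))
  -- the regularisation is trivial at frequencies near `ξ`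
  obtain ⟨δ, hδ, hδ1⟩ := Metric.eventually_nhds_iff.1 hψ1
  obtain ⟨L, hL⟩ := (((isCompact_closedBall (0 : Coord d) (r / 2)).prod
    (isCompact_closedBall (0 : Coord d) ((ε ^ 5)⁻¹ * (3 / 2)))).bddAbove_image
    (hHc.mono (prod_mono (Metric.closedBall_subset_ball (by linarith)) (subset_univ _))).norm)
  have hev : ∀ᶠ θ in 𝓝[>] (0 : ℝ), θ * (max L 0 + 1) < δ := by
    have : Tendsto (fun θ : ℝ => θ * (max L 0 + 1)) (𝓝[>] 0) (𝓝 (0 * (max L 0 + 1))) :=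
      (tendsto_id.mono_left nhdsWithin_le_nhds).mul_const _
    rw [zero_mul] at this
    exact this.eventually (gt_mem_nhds hδ)
  filter_upwards [hev, self_mem_nhdsWithin] with θ hθδ hθ τ hp
  have hθ0 : 0 < θ := hθ
  set X : ℝ := ε ^ m / (1 + ‖τ‖) ^ (d + 1) with hX
  have hX0 : 0 ≤ X := by positivity
  rcases le_total (4 * Real.pi * ε * ‖τ‖) 1 with hτ | hτ
  · have h3 : regularizedIntegral H W A ψ ξ ε θ τ = packetIntegral W A ξ ε τ := by
      refine integral_congr_ae (ae_of_all _ fun u => ?_)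
      by_cases hu : u ∈ Metric.closedBall (0 : Coord d) 1
      · have hu' := norm_smul_le_of_mem_unitBall hε hε1 hεr hu
        obtain ⟨-, -, hf⟩ := norm_freq_base hξ hε hτ
        have hf' : ‖freq ξ ε τ‖ ≤ (ε ^ 5)⁻¹ * (3 / 2) := by
          rw [freq, norm_smul, Real.norm_of_nonneg (by positivity)]
          gcongr
        have hHL : ‖H (ε ^ 4 • u, freq ξ ε τ)‖ ≤ L :=
          hL ⟨_, ⟨by simpa using hu', by simpa using hf'⟩, rfl⟩
        have : ψ (θ * H (ε ^ 4 • u, freq ξ ε τ)) = 1 := by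
          refine hδ1 ?_
          rw [dist_zero_right, norm_mul, Real.norm_of_nonneg hθ0.le]
          refine lt_of_le_of_lt ?_ hθδ
          gcongr
          exact hHL.trans ((le_max_left _ _).trans (by linarith))
        simp [this]
      · simp [unitBump_eq_zero hu]
    rw [h3]
    refine ((h₁ ε hε hεε₁ τ).1 hτ).trans (mul_le_mul_of_nonneg_right ?_ hX0)
    exact le_add_of_nonneg_right (by positivity)
  · have h3 := (h₁ ε hε hεε₁ τ).2 hτ
    have h4 := h₂ ε hε hεε₂ θ hθ0 τ hτ hp
    have hτ1 : 1 ≤ ‖τ‖ := by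
      rw [le_div_iff₀ (by positivity)] at hεπ
      have := norm_nonneg τ
      nlinarith
    -- Of the `d + 1 + m` powers of decay, `d + 1` are kept for integrability and `m` are exchanged
    -- for `ε^m`; `‖τ‖ ≥ 1` allows `‖τ‖` to be compared with `1 + ‖τ‖`.
    have h5 : C₂ / ‖τ‖ ^ (d + 1 + m) ≤ C₂ * (2 ^ (d + 1 + m) * (4 * Real.pi) ^ m) * X := by
      calc C₂ / ‖τ‖ ^ (d + 1 + m) ≤ C₂ / ((1 + ‖τ‖) / 2) ^ (d + 1 + m) := by
            gcongr
            linarith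
        _ = C₂ * 2 ^ (d + 1 + m) * (1 / (1 + ‖τ‖) ^ m) * (1 / (1 + ‖τ‖) ^ (d + 1)) := by
            rw [div_pow, pow_add (1 + ‖τ‖)]
            field_simp
        _ ≤ C₂ * 2 ^ (d + 1 + m) * ((4 * Real.pi) ^ m * ε ^ m) * (1 / (1 + ‖τ‖) ^ (d + 1)) := by
            gcongr
            exact one_div_pow_le_of_far hε hτ m
        _ = _ := by rw [hX]; ring
    calc _ ≤ ‖regularizedIntegral H W A ψ ξ ε θ τ‖ + ‖T ε τ‖ := norm_sub_le _ _
      _ ≤ C₂ * (2 ^ (d + 1 + m) * (4 * Real.pi) ^ m) * X + C₁ * X := add_le_add (h4.trans h5) h3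
      _ = _ := by ring

/-- Pointwise asymptotics of the contributions of the frequencies `τ`. -/
lemma IsLocalKernel.exists_pointwise_bound {r : ℝ} {W V : Coord d × Coord d → ℂ}
    {H : Coord d × Coord d → ℝ} {a : ℕ → Coord d × Coord d → ℂ} {K : Coord d × Coord d → ℂ}
    (h : IsLocalKernel r W V H a K) {ψ : ℝ → ℝ} (hψ : ContDiff ℝ ∞ ψ) (hψc : HasCompactSupport ψ)
    (hψ1 : ∀ᶠ t in 𝓝 0, ψ t = 1) {ξ : Coord d} (hξ : ‖ξ‖ = 1) {m : ℕ} {T : ℕ → ℝ → Coord d → ℂ}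
    (hT : ∀ k, IsApprox W (fun x => V x * a k x) ξ m (T k)) :
    ∃ C : ℝ, 0 ≤ C ∧ ∃ ε₀ : ℝ, 0 < ε₀ ∧ ∀ ε : ℝ, 0 < ε → ε ≤ ε₀ → ∀ᶠ θ in 𝓝[>] (0 : ℝ),
      ∀ τ : Coord d, ‖packetKernelIntegral H K ψ ξ ε θ τ - ∑ k ∈ Finset.range (d + 2), T k ε τ‖
        ≤ C * (1 / (1 + ‖freq ξ ε τ‖) ^ (d + 2) + ε ^ m / (1 + ‖τ‖) ^ (d + 1)) := by
  have hpi := Real.pi_pos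
  have hr := h.pos
  obtain ⟨R₀, hR₀, C₀, hK⟩ := h.expansion
  have hA : ∀ k : ℕ, IsConic r (-k) fun x => V x * a k x := fun k => by
    simpa using h.weight.mul (h.symbol k)
  choose C₁ hC₁ ε₁ hε₁ h₁ using fun k => exists_regularized_bound hr h.perturbation (hA k) h.length
    h.continuousOn_length hψ hψc hψ1 hξ (hT k)
  choose C₂ hC₂ ε₂ hε₂ h₂ using fun k => hT k
  obtain ⟨Cψ, hCψ⟩ : ∃ C, ∀ t, ‖ψ t‖ ≤ C := hψc.exists_bound_of_continuous hψ.continuous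
  have hCψ0 : 0 ≤ Cψ := (norm_nonneg _).trans (hCψ 0)
  obtain ⟨L, hL⟩ := (((isCompact_closedBall (0 : Coord d) (r / 2)).prod
    (isCompact_closedBall (0 : Coord d) R₀)).bddAbove_image
    (h.continuousOn.mono (prod_mono (Metric.closedBall_subset_ball (by linarith))
      (subset_univ _))).norm)
  set v : ℝ := ∫ u, unitBump d u with hv
  have hv0 : 0 ≤ v := integral_nonneg fun u => (unitBump d).nonneg
  -- a common bound for `ε`
  obtain ⟨e, he, hee⟩ : ∃ e : ℝ, 0 < e ∧ ∀ k ∈ Finset.range (d + 2), e ≤ ε₁ k ∧ e ≤ ε₂ k := by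
    refine ⟨(Finset.range (d + 2)).inf' (by simp) fun k => min (ε₁ k) (ε₂ k), ?_, fun k hk => ?_⟩
    · rw [Finset.lt_inf'_iff]
      exact fun k _ => lt_min (hε₁ k) (hε₂ k)
    · have := Finset.inf'_le (fun k => min (ε₁ k) (ε₂ k)) hk
      exact ⟨this.trans (min_le_left _ _), this.trans (min_le_right _ _)⟩
  set D₁ : ℝ := ∑ k ∈ Finset.range (d + 2), C₁ k with hD₁
  set D₂ : ℝ := ∑ k ∈ Finset.range (d + 2), C₂ k with hD₂
  have hD₁0 : 0 ≤ D₁ := Finset.sum_nonneg fun k _ => hC₁ k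
  have hD₂0 : 0 ≤ D₂ := Finset.sum_nonneg fun k _ => hC₂ k
  -- For `‖p‖ < R₀` only boundedness of the kernel is used, and the factor `(1 + R₀)^{d+2}`
  -- compensates `1/(1 + ‖p‖)^{d+2}`.
  set B₁ : ℝ := Cψ * max L 0 * v * (1 + R₀) ^ (d + 2) with hB₁
  set B₂ : ℝ := Cψ * max C₀ 0 * v * 2 ^ (d + 2) with hB₂
  have hB₁0 : 0 ≤ B₁ := by
    have : 0 ≤ (1 + R₀) ^ (d + 2) := by positivity
    exact mul_nonneg (mul_nonneg (mul_nonneg hCψ0 (le_max_right _ _)) hv0) this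
  have hB₂0 : 0 ≤ B₂ :=
    mul_nonneg (mul_nonneg (mul_nonneg hCψ0 (le_max_right _ _)) hv0) (by positivity)
  refine ⟨D₁ + D₂ + B₁ + B₂, by linarith, min (min e (1 / (2 * R₀))) (min 1 (r / 2)),
    by positivity, fun ε hε hε0 => ?_⟩
  have hεe : ε ≤ e := hε0.trans ((min_le_left _ _).trans (min_le_left _ _))
  have hεR : ε ≤ 1 / (2 * R₀) := hε0.trans ((min_le_left _ _).trans (min_le_right _ _))
  have hε1 : ε ≤ 1 := hε0.trans ((min_le_right _ _).trans (min_le_left _ _))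
  have hεr : ε ≤ r / 2 := hε0.trans ((min_le_right _ _).trans (min_le_right _ _))
  have hev : ∀ᶠ θ in 𝓝[>] (0 : ℝ), ∀ k ∈ Finset.range (d + 2), ∀ τ : Coord d,
      1 ≤ ‖freq ξ ε τ‖ →
        ‖regularizedIntegral H W (fun x => V x * a k x) ψ ξ ε θ τ - T k ε τ‖
          ≤ C₁ k * (ε ^ m / (1 + ‖τ‖) ^ (d + 1)) := by
    rw [Filter.eventually_all_finset]
    exact fun k hk => h₁ k ε hε (hεe.trans (hee k hk).1)
  filter_upwards [hev] with θ hθ τ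
  set X : ℝ := ε ^ m / (1 + ‖τ‖) ^ (d + 1) with hX
  set Y : ℝ := 1 / (1 + ‖freq ξ ε τ‖) ^ (d + 2) with hY
  have hX0 : 0 ≤ X := by positivity
  have hY0 : 0 ≤ Y := by positivity
  have hsupp : ∀ u, unitBump d u ≠ 0 → ‖ε ^ 4 • u‖ ≤ r / 2 := fun u hu =>
    norm_smul_le_of_mem_unitBall hε hε1 hεr (by_contra fun hc => hu (unitBump_eq_zero hc))
  have hpk : ∀ u, ‖packet ξ ε (ε ^ 4 • u)‖ = unitBump d u := fun u => by
    rw [norm_packet, smul_smul, inv_mul_cancel₀ (by positivity), one_smul]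
  have key : ∀ B f : ℝ, 0 ≤ f → B ≤ Cψ * f → B * v ≤ Cψ * f * v := fun B f _ hb =>
    mul_le_mul_of_nonneg_right hb hv0
  rcases lt_or_ge ‖freq ξ ε τ‖ R₀ with hp | hp
  · -- low frequencies
    have hfar : 1 ≤ 4 * Real.pi * ε * ‖τ‖ := by
      rw [freq, norm_smul, Real.norm_of_nonneg (by positivity), inv_mul_lt_iff₀ (by positivity)]
        at hp
      -- A low frequency `p` forces `‖ξ + 2πετ‖ < 1/2`; as `‖ξ‖ = 1`, such a `τ` is far and the
      -- approximations `T k` are themselves small.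
      have h3 : ε ^ 5 * R₀ ≤ 1 / 2 := by
        rw [le_div_iff₀ (by positivity)] at hεR
        have : ε ^ 5 ≤ ε := by
          calc ε ^ 5 ≤ ε ^ 1 := pow_le_pow_of_le_one hε.le hε1 (by norm_num)
            _ = ε := pow_one ε
        nlinarith
      have h4 := norm_sub_le (ξ + (2 * Real.pi * ε) • τ) ((2 * Real.pi * ε) • τ)
      rw [add_sub_cancel_right, hξ, norm_smul, Real.norm_of_nonneg (by positivity)] at h4
      linarith
    have h5 : ‖packetKernelIntegral H K ψ ξ ε θ τ‖ ≤ B₁ * Y := by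
      have : ‖packetKernelIntegral H K ψ ξ ε θ τ‖ ≤ Cψ * max L 0 * v := by
        refine norm_integral_le_of_unitBump fun u => ?_
        refine norm_mul_mul_le ((Complex.norm_real _).trans_le (hCψ _)) (hpk u) fun hu => ?_
        exact (hL ⟨_, ⟨by simpa using hsupp u hu, by simpa using hp.le⟩, rfl⟩).trans
          (le_max_left _ _)
      refine this.trans ?_
      rw [hB₁, mul_assoc (Cψ * max L 0 * v)]
      refine le_mul_of_one_le_right (mul_nonneg (mul_nonneg hCψ0 (le_max_right _ _)) hv0) ?_
      rw [hY, mul_one_div, le_div_iff₀ (by positivity), one_mul]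
      gcongr
    have h6 : ‖∑ k ∈ Finset.range (d + 2), T k ε τ‖ ≤ D₂ * X := by
      rw [hD₂, Finset.sum_mul]
      exact (norm_sum_le _ _).trans (Finset.sum_le_sum fun k hk =>
        (h₂ k ε hε (hεe.trans (hee k hk).2) τ).2 hfar)
    refine (norm_sub_le _ _).trans ((add_le_add h5 h6).trans ?_)
    have := mul_nonneg hB₂0 hY0
    have := mul_nonneg hD₂0 hY0
    have := mul_nonneg hD₁0 hY0
    have := mul_nonneg hB₂0 hX0
    have := mul_nonneg hB₁0 hX0
    have := mul_nonneg hD₁0 hX0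
    linarith
  · -- high frequencies
    set p := freq ξ ε τ with hpdef
    have hp0 : 0 < ‖p‖ := by linarith
    have h1p : 1 ≤ ‖p‖ := by linarith
    have hp' : p ≠ 0 := norm_pos_iff.1 hp0
    set Q : Coord d → ℂ := fun u => ∑ k ∈ Finset.range (d + 2),
      osc τ u * (Complex.exp (Complex.I * W (ε ^ 4 • u, p)) *
        ((ψ (θ * H (ε ^ 4 • u, p)) : ℂ) * (V (ε ^ 4 • u, p) * a k (ε ^ 4 • u, p)) *
          (unitBump d u : ℂ))) with hQ
    -- continuity of the integrands
    have hin : ∀ u : Coord d, u ∈ Metric.closedBall (0 : Coord d) 1 →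
        ε ^ 4 • u ∈ Metric.ball (0 : Coord d) r := fun u hu => by
      have := norm_smul_le_of_mem_unitBall hε hε1 hεr hu
      rw [mem_ball_zero_iff]
      linarith
    have hcontH : ContinuousOn (fun u : Coord d => H (ε ^ 4 • u, p))
        (Metric.closedBall (0 : Coord d) 1) :=
      h.continuousOn_length.comp (f := fun u : Coord d => (ε ^ 4 • u, p))
        (by fun_prop) fun u hu => ⟨hin u hu, mem_univ _⟩
    have hcontK : ContinuousOn (fun u : Coord d => K (ε ^ 4 • u, p))
        (Metric.closedBall (0 : Coord d) 1) :=
      h.continuousOn.comp (f := fun u : Coord d => (ε ^ 4 • u, p))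
        (by fun_prop) fun u hu => ⟨hin u hu, mem_univ _⟩
    have hcontψ : ContinuousOn (fun u : Coord d => (ψ (θ * H (ε ^ 4 • u, p)) : ℂ))
        (Metric.closedBall (0 : Coord d) 1) :=
      Complex.continuous_ofReal.comp_continuousOn
        (hψ.continuous.comp_continuousOn (hcontH.const_mul θ))
    have hconic : ∀ {l : ℤ} {f : Coord d × Coord d → ℂ}, IsConic r l f →
        ContinuousOn (fun u : Coord d => f (ε ^ 4 • u, p)) (Metric.closedBall (0 : Coord d) 1) :=
      fun hf => hf.smooth.continuousOn.comp (f := fun u : Coord d => (ε ^ 4 • u, p))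
        (by fun_prop) fun u hu => ⟨hin u hu, hp'⟩
    have hbc : Continuous fun u : Coord d => (unitBump d u : ℂ) :=
      Complex.continuous_ofReal.comp (unitBump d).continuous
    have hint : ∀ f : Coord d → ℂ, ContinuousOn f (Metric.closedBall (0 : Coord d) 1) →
        (∀ u, unitBump d u = 0 → f u = 0) → Integrable f := fun f hf h0 =>
      (integrableOn_iff_integrable_of_support_subset fun u hu => by_contra fun hc =>
        hu (h0 u (unitBump_eq_zero hc))).1 (hf.integrableOn_compact (isCompact_closedBall _ _))
    have hQk : ∀ k, Integrable fun u => osc τ u * (Complex.exp (Complex.I * W (ε ^ 4 • u, p)) *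
        ((ψ (θ * H (ε ^ 4 • u, p)) : ℂ) * (V (ε ^ 4 • u, p) * a k (ε ^ 4 • u, p)) *
          (unitBump d u : ℂ))) := fun k => by
      refine hint _ ?_ fun u hu => by simp [hu]
      exact (continuous_osc τ).continuousOn.mul
        ((Complex.continuous_exp.comp_continuousOn
          ((hconic h.perturbation.toIsConic).const_mul _)).mul
          ((hcontψ.mul ((hconic h.weight).mul (hconic (h.symbol k)))).mul hbc.continuousOn))
    have hQint : ∫ u, Q u = ∑ k ∈ Finset.range (d + 2),
        regularizedIntegral H W (fun x => V x * a k x) ψ ξ ε θ τ :=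
      integral_finsetSum _ fun k _ => hQk k
    have hJint : Integrable fun u => (ψ (θ * H (ε ^ 4 • u, p)) : ℂ) * K (ε ^ 4 • u, p) *
        packet ξ ε (ε ^ 4 • u) := by
      refine hint _ ?_ fun u hu => ?_
      · exact (hcontψ.mul hcontK).mul
          ((contDiff_packet ξ ε).continuous.comp (continuous_const_smul _)).continuousOn
      · have : packet ξ ε (ε ^ 4 • u) = 0 := norm_eq_zero.1 ((hpk u).trans hu)
        simp [this]
    -- The integrands differ by the remainder of the kernel expansion, which is `O(‖p‖^{-d-2})` on
    -- the support of the bump.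
    have h5 : ‖packetKernelIntegral H K ψ ξ ε θ τ - ∑ k ∈ Finset.range (d + 2),
        regularizedIntegral H W (fun x => V x * a k x) ψ ξ ε θ τ‖ ≤ B₂ * Y := by
      rw [← hQint, packetKernelIntegral,
        ← integral_sub hJint (integrable_finsetSum _ fun k _ => hQk k)]
      have : ∀ u, ‖(ψ (θ * H (ε ^ 4 • u, p)) : ℂ) * K (ε ^ 4 • u, p) * packet ξ ε (ε ^ 4 • u)
          - Q u‖ ≤ Cψ * (max C₀ 0 / ‖p‖ ^ (d + 2)) * unitBump d u := by
        intro u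
        have e1 : Q u = (ψ (θ * H (ε ^ 4 • u, p)) : ℂ) *
            (Complex.exp (Complex.I * (W (ε ^ 4 • u, p) -
              ((inner ℝ (ε ^ 4 • u) p : ℝ) : ℂ))) *
              (V (ε ^ 4 • u, p) * ∑ k ∈ Finset.range (d + 2), a k (ε ^ 4 • u, p))) *
            packet ξ ε (ε ^ 4 • u) := by
          have e2 := exp_mul_packet (W (ε ^ 4 • u, p)) ξ hε τ u
          rw [← hpdef] at e2
          simp only [hQ]
          rw [Finset.mul_sum, Finset.mul_sum, Finset.mul_sum, Finset.sum_mul]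
          refine Finset.sum_congr rfl fun k _ => ?_
          linear_combination (-(ψ (θ * H (ε ^ 4 • u, p)) : ℂ) *
            (V (ε ^ 4 • u, p) * a k (ε ^ 4 • u, p))) * e2
        rw [e1, ← sub_mul, ← mul_sub]
        refine norm_mul_mul_le ((Complex.norm_real _).trans_le (hCψ _)) (hpk u) fun hu => ?_
        exact (hK _ p (hsupp u hu) hp).trans
          (div_le_div_of_nonneg_right (le_max_left _ _) (pow_nonneg hp0.le _))
      refine (norm_integral_le_of_unitBump this).trans ?_
      rw [hB₂, ← hv]
      have : max C₀ 0 / ‖p‖ ^ (d + 2) ≤ max C₀ 0 * 2 ^ (d + 2) * Y := by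
        calc max C₀ 0 / ‖p‖ ^ (d + 2) ≤ max C₀ 0 / ((1 + ‖p‖) / 2) ^ (d + 2) := by
              gcongr
              linarith
          _ = _ := by
            rw [hY, div_pow]
            field_simp
      calc Cψ * (max C₀ 0 / ‖p‖ ^ (d + 2)) * v ≤ Cψ * (max C₀ 0 * 2 ^ (d + 2) * Y) * v :=
            mul_le_mul_of_nonneg_right (mul_le_mul_of_nonneg_left this hCψ0) hv0
        _ = _ := by ring
    have h6 : ‖∑ k ∈ Finset.range (d + 2), regularizedIntegral H W (fun x => V x * a k x) ψ ξ ε θ τ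
        - ∑ k ∈ Finset.range (d + 2), T k ε τ‖ ≤ D₁ * X := by
      rw [← Finset.sum_sub_distrib, hD₁, Finset.sum_mul]
      exact (norm_sum_le _ _).trans (Finset.sum_le_sum fun k hk => hθ k hk τ h1p)
    refine (norm_sub_le_norm_sub_add_norm_sub _ _ _).trans ((add_le_add h5 h6).trans ?_)
    have := mul_nonneg hB₁0 hY0
    have := mul_nonneg hD₂0 hY0
    have := mul_nonneg hD₁0 hY0
    have := mul_nonneg hB₂0 hX0
    have := mul_nonneg hB₁0 hX0
    have := mul_nonneg hD₂0 hX0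
    linarith

end LocalOperators

/-! ### The principal and subprincipal symbols of the identity -/

section LocalOperators

variable {d : ℕ}

lemma freq_eq (ξ : Coord d) {ε : ℝ} (hε : 0 < ε) (τ : Coord d) :
    freq ξ ε τ = (ε ^ 5)⁻¹ • ξ + (2 * Real.pi * (ε ^ 4)⁻¹) • τ := by
  rw [freq, smul_add, smul_smul]
  congr 2
  field_simp

/-- Integrals of functions of the frequency. -/
lemma integral_comp_freq (f : Coord d → ℝ) (ξ : Coord d) {ε : ℝ} (hε : 0 < ε) :
    ∫ τ, f (freq ξ ε τ) = ((2 * Real.pi * (ε ^ 4)⁻¹) ^ d)⁻¹ * ∫ p, f p := by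
  have hpi := Real.pi_pos
  simp_rw [freq_eq ξ hε]
  rw [Measure.integral_comp_smul (μ := volume)
    (f := fun p => f ((ε ^ 5)⁻¹ • ξ + p)) (R := 2 * Real.pi * (ε ^ 4)⁻¹),
    integral_add_left_eq_self (μ := volume) f ((ε ^ 5)⁻¹ • ξ), finrank_euclideanSpace_fin,
    abs_of_nonneg (by positivity), smul_eq_mul]

lemma integrable_comp_freq {f : Coord d → ℝ} (hf : Integrable f) (ξ : Coord d) {ε : ℝ}
    (hε : 0 < ε) : Integrable fun τ => f (freq ξ ε τ) := by
  have hpi := Real.pi_pos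
  simp_rw [freq_eq ξ hε]
  exact (hf.comp_add_left ((ε ^ 5)⁻¹ • ξ)).comp_smul
    (R := 2 * Real.pi * (ε ^ 4)⁻¹) (by positivity)

/-- The operator with kernel `K` is, up to a bounded kernel, the identity at `0`. -/
def IsIdentityModBounded (r : ℝ) (H : Coord d × Coord d → ℝ) (K : Coord d × Coord d → ℂ)
    (ψ : ℝ → ℝ) : Prop :=
  ∃ C : ℝ, ∀ f : Coord d → ℂ, ContDiff ℝ ∞ f → (∀ z, f z ≠ 0 → ‖z‖ ≤ r / 4) →
    ∃ T : ℂ, Tendsto (fun θ : ℝ => (((2 * Real.pi) ^ d : ℝ) : ℂ)⁻¹ *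
        ∫ z, ∫ p, (ψ (θ * H (z, p)) : ℂ) * K (z, p) * f z) (𝓝[>] 0) (𝓝 T) ∧
      ‖T - f 0‖ ≤ C * ∫ z, ‖f z‖

/-- The packet has value `1` at the origin and `L¹` norm `O(ε^{4d})`, so the operator returns `1 +
O(ε^{4d})`. This value is also the limit in `θ` of integrals over `τ`, where the pointwise bounds
are summed: the summand depending on `freq ξ ε τ` integrates to `O(ε^{4d})` by change of variables,
the other one to `O(ε^m)`. -/
theorem IsLocalKernel.exists_norm_one_sub_le {r : ℝ} {W V : Coord d × Coord d → ℂ}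
    {H : Coord d × Coord d → ℝ} {a : ℕ → Coord d × Coord d → ℂ} {K : Coord d × Coord d → ℂ}
    (h : IsLocalKernel r W V H a K) (hd : 2 ≤ d) {ψ : ℝ → ℝ} (hψ : ContDiff ℝ ∞ ψ)
    (hψc : HasCompactSupport ψ) (hψ1 : ∀ᶠ t in 𝓝 0, ψ t = 1)
    (hId : IsIdentityModBounded r H K ψ) {ξ : Coord d} (hξ : ‖ξ‖ = 1) {m : ℕ} (hm : m ≤ 8)
    {T : ℕ → ℝ → Coord d → ℂ} (hT : ∀ k, IsApprox W (fun x => V x * a k x) ξ m (T k))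
    (hTi : ∀ k ε, 0 < ε → Integrable (T k ε)) :
    ∃ C : ℝ, ∃ ε₀ : ℝ, 0 < ε₀ ∧ ∀ ε : ℝ, 0 < ε → ε ≤ ε₀ →
      ‖1 - ∑ k ∈ Finset.range (d + 2), ∫ τ, T k ε τ‖ ≤ C * ε ^ m := by
  have hpi := Real.pi_pos
  have hr := h.pos
  obtain ⟨C, hC, ε₁, hε₁, h₁⟩ := h.exists_pointwise_bound hψ hψc hψ1 hξ hT
  obtain ⟨c, hc, hcH⟩ := h.length.exists_lower_bound hr
  obtain ⟨C₀, hC₀⟩ := hId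
  obtain ⟨Rψ, hRψ⟩ := hψc.isCompact.isBounded.subset_closedBall (0 : ℝ)
  have hI1 := integrable_inv_one_add_norm_pow (d := d) (N := d + 1) (by lia)
  have hI2 := integrable_inv_one_add_norm_pow (d := d) (N := d + 2) (by lia)
  obtain ⟨J₁, hJ₁⟩ : ∃ J : ℝ, J = ∫ τ : Coord d, 1 / (1 + ‖τ‖) ^ (d + 1) := ⟨_, rfl⟩
  obtain ⟨J₂, hJ₂⟩ : ∃ J : ℝ, J = ∫ τ : Coord d, 1 / (1 + ‖τ‖) ^ (d + 2) := ⟨_, rfl⟩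
  obtain ⟨v, hv⟩ : ∃ v : ℝ, v = ∫ u, unitBump d u := ⟨_, rfl⟩
  have hv0 : 0 ≤ v := hv ▸ integral_nonneg fun u => (unitBump d).nonneg
  have hJ₂0 : 0 ≤ J₂ := hJ₂ ▸ integral_nonneg fun u => by positivity
  refine ⟨max C₀ 0 * v + C * (((2 * Real.pi) ^ d)⁻¹ * J₂ + J₁), min ε₁ (min 1 (r / 4)),
    by positivity, fun ε hε hε0 => ?_⟩
  have hεε₁ : ε ≤ ε₁ := hε0.trans (min_le_left _ _)
  have hε1 : ε ≤ 1 := hε0.trans ((min_le_right _ _).trans (min_le_left _ _))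
  have hεr : ε ≤ r / 4 := hε0.trans ((min_le_right _ _).trans (min_le_right _ _))
  have hε4 : ε ^ 4 ≤ r / 4 := by
    calc ε ^ 4 ≤ ε ^ 1 := pow_le_pow_of_le_one hε.le hε1 (by norm_num)
      _ ≤ r / 4 := by rwa [pow_one]
  -- The hypothesis on the dimension enters here: `4d ≥ 8 ≥ m`.
  have hε4d : ε ^ (4 * d) ≤ ε ^ m := pow_le_pow_of_le_one hε.le hε1 (by lia)
  obtain ⟨T₀, hT₀, hT₀1⟩ := hC₀ (packet ξ ε) (contDiff_packet ξ ε)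
    fun z hz => (norm_le_of_packet_ne_zero hε hz).trans hε4
  rw [packet_zero, integral_norm_packet ξ hε, ← hv] at hT₀1
  -- the regularised integrals
  have hreg : ∀ θ : ℝ, 0 < θ → (((2 * Real.pi) ^ d : ℝ) : ℂ)⁻¹ *
      ∫ z, ∫ p, (ψ (θ * H (z, p)) : ℂ) * K (z, p) * packet ξ ε z
      = ∫ τ, packetKernelIntegral H K ψ ξ ε θ τ ∧
      Integrable (packetKernelIntegral H K ψ ξ ε θ) := by
    intro θ hθ
    -- For fixed `θ > 0` the integrand is continuous with compact support: the packet bounds `z`,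
    -- and `ψ(θH)` bounds `p` because `H ≥ c‖p‖`.
    refine integral_integral_eq_freq
      (F := fun z p => (ψ (θ * H (z, p)) : ℂ) * K (z, p) * packet ξ ε z)
      (R := r / 4) (R' := max (Rψ / (θ * c)) 0) ?_ ?_ ξ hε
    · have hco : ContinuousOn (fun x : Coord d × Coord d =>
          (ψ (θ * H (x.1, x.2)) : ℂ) * K (x.1, x.2) * packet ξ ε x.1)
          (Metric.ball 0 r ×ˢ univ) :=
        ((Complex.continuous_ofReal.comp_continuousOn (hψ.continuous.comp_continuousOn
          (h.continuousOn_length.const_mul θ))).mul h.continuousOn).mul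
          ((contDiff_packet ξ ε).continuous.comp continuous_fst).continuousOn
      refine hco.continuous_of_tsupport_subset (Metric.isOpen_ball.prod isOpen_univ) ?_
      refine (closure_minimal (t := Metric.closedBall 0 (r / 4) ×ˢ univ) ?_
        (Metric.isClosed_closedBall.prod isClosed_univ)).trans
        (prod_mono (Metric.closedBall_subset_ball (by linarith)) subset_rfl)
      rintro ⟨z, p⟩ hx
      refine ⟨?_, mem_univ _⟩
      rw [mem_closedBall_zero_iff]
      exact (norm_le_of_packet_ne_zero hε (right_ne_zero_of_mul hx)).trans hε4
    · intro z p hne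
      have hz : ‖z‖ ≤ r / 4 :=
        (norm_le_of_packet_ne_zero hε (right_ne_zero_of_mul hne)).trans hε4
      refine ⟨hz, ?_⟩
      by_cases hp : p = 0
      · simp [hp]
      · have h3 : ψ (θ * H (z, p)) ≠ 0 := by
          exact_mod_cast left_ne_zero_of_mul (left_ne_zero_of_mul hne)
        have h4 := hRψ (subset_tsupport ψ h3)
        rw [mem_closedBall_zero_iff] at h4
        have h5 := (le_abs_self _).trans h4
        have h6 := hcH z p (by linarith) hp
        refine le_max_of_le_left ?_
        rw [le_div_iff₀ (by positivity)]
        nlinarith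
  have hTsum : Integrable fun τ => ∑ k ∈ Finset.range (d + 2), T k ε τ :=
    integrable_finsetSum _ fun k _ => hTi k ε hε
  have hbound : ∀ᶠ θ in 𝓝[>] (0 : ℝ), ‖(((2 * Real.pi) ^ d : ℝ) : ℂ)⁻¹ *
      (∫ z, ∫ p, (ψ (θ * H (z, p)) : ℂ) * K (z, p) * packet ξ ε z)
      - ∑ k ∈ Finset.range (d + 2), ∫ τ, T k ε τ‖
      ≤ C * (((2 * Real.pi) ^ d)⁻¹ * J₂ + J₁) * ε ^ m := by
    filter_upwards [h₁ ε hε hεε₁, self_mem_nhdsWithin] with θ hθ1 hθ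
    obtain ⟨e1, e2⟩ := hreg θ hθ
    rw [e1, ← integral_finsetSum _ fun k _ => hTi k ε hε, ← integral_sub e2 hTsum]
    have i1 : Integrable fun τ : Coord d => 1 / (1 + ‖freq ξ ε τ‖) ^ (d + 2) :=
      integrable_comp_freq (f := fun p => 1 / (1 + ‖p‖) ^ (d + 2)) hI2 ξ hε
    have i2 : Integrable fun τ : Coord d => ε ^ m / (1 + ‖τ‖) ^ (d + 1) := by
      simpa only [mul_one_div] using hI1.const_mul (ε ^ m)
    refine (norm_integral_le_of_norm_le ((i1.add i2).const_mul C) (ae_of_all _ hθ1)).trans ?_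
    rw [integral_const_mul, mul_assoc]
    refine mul_le_mul_of_nonneg_left ?_ hC
    have i3 : ∫ τ : Coord d, ε ^ m / (1 + ‖τ‖) ^ (d + 1) = ε ^ m * J₁ := by
      rw [hJ₁, ← integral_const_mul]
      simp only [mul_one_div]
    have i4 := integral_comp_freq (fun p : Coord d => 1 / (1 + ‖p‖) ^ (d + 2)) ξ hε
    simp only [Pi.add_apply]
    have i5 : ((2 * Real.pi * (ε ^ 4)⁻¹) ^ d)⁻¹ = ((2 * Real.pi) ^ d)⁻¹ * ε ^ (4 * d) := by
      rw [mul_pow, mul_inv, inv_pow, inv_inv, ← pow_mul]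
    rw [integral_add i1 i2, i3, i4, ← hJ₂, i5]
    have i6 : ((2 * Real.pi) ^ d)⁻¹ * J₂ * ε ^ (4 * d) ≤ ((2 * Real.pi) ^ d)⁻¹ * J₂ * ε ^ m :=
      mul_le_mul_of_nonneg_left hε4d (mul_nonneg (by positivity) hJ₂0)
    linarith
  -- The bound does not depend on `θ`, so it survives the removal of the regularisation.
  have hlim := le_of_tendsto ((hT₀.sub_const _).norm) hbound
  calc ‖1 - ∑ k ∈ Finset.range (d + 2), ∫ τ, T k ε τ‖
      ≤ ‖1 - T₀‖ + ‖T₀ - ∑ k ∈ Finset.range (d + 2), ∫ τ, T k ε τ‖ :=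
        norm_sub_le_norm_sub_add_norm_sub _ _ _
    _ ≤ max C₀ 0 * v * ε ^ m + C * (((2 * Real.pi) ^ d)⁻¹ * J₂ + J₁) * ε ^ m := by
        refine add_le_add ?_ hlim
        rw [norm_sub_rev]
        calc _ ≤ C₀ * (ε ^ (4 * d) * v) := hT₀1
          _ ≤ max C₀ 0 * (ε ^ m * v) := by
            refine mul_le_mul (le_max_left _ _) (mul_le_mul_of_nonneg_right hε4d hv0)
              (mul_nonneg (by positivity) hv0) (le_max_right _ _)
          _ = _ := by ring
    _ = _ := by ring

/-- A quantity which is `O(ε)` and does not depend on `ε` vanishes. -/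
lemma eq_zero_of_norm_le_mul {x : ℂ} {C ε₀ : ℝ} (hε₀ : 0 < ε₀)
    (h : ∀ ε : ℝ, 0 < ε → ε ≤ ε₀ → ‖x‖ ≤ C * ε) : x = 0 := by
  have h1 : Tendsto (fun ε : ℝ => C * ε) (𝓝[>] 0) (𝓝 (C * 0)) :=
    (tendsto_id.mono_left nhdsWithin_le_nhds).const_mul _
  rw [mul_zero] at h1
  refine norm_le_zero_iff.1 (ge_of_tendsto h1 ?_)
  filter_upwards [self_mem_nhdsWithin, mem_nhdsWithin_of_mem_nhds (Iic_mem_nhds hε₀)] with ε h2 h3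
  exact h ε h2 h3

/-- The principal symbol of the identity is `1`. -/
theorem IsLocalKernel.principal_eq_one {r : ℝ} {W V : Coord d × Coord d → ℂ}
    {H : Coord d × Coord d → ℝ} {a : ℕ → Coord d × Coord d → ℂ} {K : Coord d × Coord d → ℂ}
    (h : IsLocalKernel r W V H a K) (hd : 2 ≤ d) {ψ : ℝ → ℝ} (hψ : ContDiff ℝ ∞ ψ)
    (hψc : HasCompactSupport ψ) (hψ1 : ∀ᶠ t in 𝓝 0, ψ t = 1)
    (hId : IsIdentityModBounded r H K ψ) {ξ : Coord d} (hξ : ‖ξ‖ = 1) : a 0 (0, ξ) = 1 := by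
  have hr := h.pos
  have hξ0 : ξ ≠ 0 := norm_ne_zero_iff.1 (by rw [hξ]; exact one_ne_zero)
  have hA : ∀ k : ℕ, IsConic r (-k) fun x => V x * a k x := fun k => by
    simpa using h.weight.mul (h.symbol k)
  -- Modulo `ε` only the principal symbol contributes; the components with `k ≥ 1` are `O(ε⁵)`.
  set T : ℕ → ℝ → Coord d → ℂ := fun k ε τ =>
    if k = 0 then a 0 (0, ξ) * moment (fun _ => 1) τ else 0 with hTdef
  have hT : ∀ k, IsApprox W (fun x => V x * a k x) ξ 1 (T k) := by
    intro k
    by_cases hk : k = 0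
    · subst hk
      simpa [hTdef, h.weight_zero ξ hξ0] using isApprox_const hr h.perturbation (hA 0) hξ
    · simpa [hTdef, hk] using isApprox_zero hr h.perturbation (hA k) hξ (m := 1) (by lia)
  have hm1 : Integrable (moment (d := d) fun _ => 1) := integrable_moment_transform contDiff_const
  have hTi : ∀ k ε, 0 < ε → Integrable (T k ε) := by
    intro k ε _
    by_cases hk : k = 0
    · simpa [hTdef, hk] using hm1.const_mul (a 0 (0, ξ))
    · simp [hTdef, hk]
  obtain ⟨C, ε₀, hε₀, hC⟩ := h.exists_norm_one_sub_le hd hψ hψc hψ1 hId hξ (by norm_num) hT hTi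
  have hint : ∀ ε : ℝ, ∑ k ∈ Finset.range (d + 2), ∫ τ, T k ε τ = a 0 (0, ξ) := by
    intro ε
    rw [Finset.sum_eq_single_of_mem 0 (by simp) fun k _ hk => by simp [hTdef, hk]]
    simp only [hTdef, if_true]
    rw [integral_const_mul, integral_moment contDiff_const, mul_one]
  have := eq_zero_of_norm_le_mul (x := 1 - a 0 (0, ξ)) (C := C) hε₀ fun ε h1 h2 => by
    have := hC ε h1 h2
    rwa [hint ε, pow_one] at this
  exact (sub_eq_zero.1 this).symm

/-- The subprincipal symbol of the identity vanishes. -/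
theorem IsLocalKernel.subprincipal_eq_zero {r : ℝ} {W V : Coord d × Coord d → ℂ}
    {H : Coord d × Coord d → ℝ} {a : ℕ → Coord d × Coord d → ℂ} {K : Coord d × Coord d → ℂ}
    (h : IsLocalKernel r W V H a K) (hd : 2 ≤ d) {ψ : ℝ → ℝ} (hψ : ContDiff ℝ ∞ ψ)
    (hψc : HasCompactSupport ψ) (hψ1 : ∀ᶠ t in 𝓝 0, ψ t = 1)
    (hId : IsIdentityModBounded r H K ψ) (hrel : SubprincipalRelation W V)
    (ha₀ : ∀ z ∈ Metric.ball (0 : Coord d) r, ∀ p : Coord d, p ≠ 0 → a 0 (z, p) = 1)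
    {ξ : Coord d} (hξ : ‖ξ‖ = 1) : a 1 (0, ξ) = 0 := by
  have hr := h.pos
  have hξ0 : ξ ≠ 0 := norm_ne_zero_iff.1 (by rw [hξ]; exact one_ne_zero)
  have hA : ∀ k : ℕ, IsConic r (-k) fun x => V x * a k x := fun k => by
    simpa using h.weight.mul (h.symbol k)
  obtain ⟨g, hh, C₀, hC₀, hg, hhg, hgC, hhC, hmain⟩ := exists_mainTerm hr
    h.perturbation.smooth h.weight.smooth hrel hξ
  -- Modulo `ε⁶` the principal part needs its full expansion, the subprincipal one only its leading
  -- term `ε⁵ a 1 (0, ξ)`, and the components with `k ≥ 2` are `O(ε^{10})`.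
  set T : ℕ → ℝ → Coord d → ℂ := fun k ε τ =>
    if k = 0 then mainTerm g hh ξ ε τ else
      if k = 1 then (ε : ℂ) ^ 5 * a 1 (0, ξ) * moment (fun _ => 1) τ else 0 with hTdef
  have hT : ∀ k, IsApprox W (fun x => V x * a k x) ξ 6 (T k) := by
    intro k
    match k with
    | 0 => simpa [hTdef] using isApprox_mainTerm hr h.perturbation h.weight h.weight_zero ha₀ hξ
             hC₀ hg hhg hgC hhC
    | 1 => simpa [hTdef, h.weight_zero ξ hξ0] using isApprox_const hr h.perturbation (hA 1) hξ
    | k + 2 => simpa [hTdef] using isApprox_zero hr h.perturbation (hA (k + 2)) hξ (m := 6) (by lia)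
  have hm1 : Integrable (moment (d := d) fun _ => 1) := integrable_moment_transform contDiff_const
  have hTi : ∀ k ε, 0 < ε → Integrable (T k ε) := by
    intro k ε hε
    match k with
    | 0 => simpa [hTdef] using (hmain ε hε).1
    | 1 => simpa [hTdef] using hm1.const_mul ((ε : ℂ) ^ 5 * a 1 (0, ξ))
    | k + 2 => simp [hTdef]
  obtain ⟨C, ε₀, hε₀, hC⟩ := h.exists_norm_one_sub_le hd hψ hψc hψ1 hId hξ (by norm_num) hT hTi
  have hint : ∀ ε : ℝ, ∑ k ∈ Finset.range (d + 2), ∫ τ, T k ε τ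
      = (∫ τ, mainTerm g hh ξ ε τ) + (ε : ℂ) ^ 5 * a 1 (0, ξ) := by
    intro ε
    rw [show d + 2 = d + 1 + 1 by rfl, Finset.sum_range_succ', Finset.sum_range_succ',
      Finset.sum_eq_zero fun k _ => by simp [hTdef], zero_add, add_comm]
    simp only [hTdef, if_true]
    congr 1
    simp only [zero_add, one_ne_zero, if_false]
    rw [integral_const_mul, integral_moment contDiff_const, mul_one]
  refine eq_zero_of_norm_le_mul (C := C + C₀) hε₀ fun ε h1 h2 => ?_
  have h3 := hC ε h1 h2
  have h4 := (hmain ε h1).2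
  rw [hint] at h3
  have h5 : ‖(ε : ℂ) ^ 5 * a 1 (0, ξ)‖ ≤ (C + C₀) * ε ^ 6 := by
    have : (ε : ℂ) ^ 5 * a 1 (0, ξ) = -((1 - ((∫ τ, mainTerm g hh ξ ε τ) +
        (ε : ℂ) ^ 5 * a 1 (0, ξ))) + ((∫ τ, mainTerm g hh ξ ε τ) - 1)) := by ring
    rw [this, norm_neg, add_mul]
    exact (norm_add_le _ _).trans (add_le_add h3 h4)
  rw [norm_mul, norm_pow, Complex.norm_real, Real.norm_of_nonneg h1.le] at h5
  have h6 : 0 < ε ^ 5 := by positivity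
  refine le_of_mul_le_mul_left ?_ h6
  calc _ ≤ _ := h5
    _ = _ := by ring

end LocalOperators

/-! ### Directional derivatives and their commutation -/

section DirectionalDerivatives

variable {E : Type*} [NormedAddCommGroup E] [NormedSpace ℝ E]
  {E' : Type*} [NormedAddCommGroup E'] [NormedSpace ℝ E']

/-- The derivative of `f` in the direction `v`. -/
def dirDeriv (v : E) (f : E → ℂ) (x : E) : ℂ := fderiv ℝ f x v

lemma contDiffOn_dirDeriv {O : Set E} (hO : IsOpen O) {f : E → ℂ} (hf : ContDiffOn ℝ ∞ f O)
    (v : E) : ContDiffOn ℝ ∞ (dirDeriv v f) O :=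
  (hf.fderiv_of_isOpen hO (m := ∞) (by norm_num)).clm_apply contDiffOn_const

lemma dirDeriv_congr {f g : E → ℂ} {O : Set E} (hO : IsOpen O) (h : EqOn f g O) (v : E) :
    EqOn (dirDeriv v f) (dirDeriv v g) O := fun x hx => by
  rw [dirDeriv, dirDeriv, (h.eventuallyEq_of_mem (hO.mem_nhds hx)).fderiv_eq]

lemma dirDeriv_comm {O : Set E} (hO : IsOpen O) {f : E → ℂ} (hf : ContDiffOn ℝ ∞ f O) (v w : E) :
    EqOn (dirDeriv v (dirDeriv w f)) (dirDeriv w (dirDeriv v f)) O := fun x hx => by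
  have h1 : ContDiffAt ℝ ∞ f x := hf.contDiffAt (hO.mem_nhds hx)
  have h2 : DifferentiableAt ℝ (fderiv ℝ f) x :=
    ((hf.fderiv_of_isOpen hO (m := ∞) (by norm_num)).contDiffAt
      (hO.mem_nhds hx)).differentiableAt (by norm_num)
  have h3 := ((h1.of_le (m := 2) (by norm_cast)).isSymmSndFDerivAt (by simp)) v w
  have h4 : ∀ u : E, fderiv ℝ (fun y => fderiv ℝ f y u) x = (fderiv ℝ (fderiv ℝ f) x).flip u := by
    intro u
    have := fderiv_clm_apply h2 (differentiableAt_const u)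
    rw [this]
    simp
  change fderiv ℝ (fun y => fderiv ℝ f y w) x v = fderiv ℝ (fun y => fderiv ℝ f y v) x w
  rw [h4, h4]
  exact h3

lemma fderiv_comp_apply {f : E → ℂ} {A : E' → E} {L : E' →L[ℝ] E} {x : E'}
    (hf : DifferentiableAt ℝ f (A x)) (hA : HasFDerivAt A L x) (w : E') :
    fderiv ℝ (fun y => f (A y)) x w = fderiv ℝ f (A x) (L w) := by
  have := (hf.hasFDerivAt.comp x hA).fderiv
  change fderiv ℝ (f ∘ A) x w = _
  rw [this]
  rfl

end DirectionalDerivatives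

/-! ### Smoothness of the determinant and its derivative at the identity -/

section Determinants

variable {n : ℕ}

lemma contDiff_det {𝕜 : Type*} [RCLike 𝕜] :
    ContDiff ℝ ∞ fun m : Fin n → Fin n → 𝕜 => (Matrix.of m).det := by
  simp_rw [Matrix.det_apply]
  refine ContDiff.sum fun σ _ => ?_
  refine ContDiff.const_smul _ (contDiff_prod fun i _ => ?_)
  simp only [Matrix.of_apply]
  fun_prop

/-- The derivative of the determinant at the identity is the trace. -/
lemma fderiv_det_one (N : Fin n → Fin n → ℂ) :
    fderiv ℝ (fun m : Fin n → Fin n → ℂ => (Matrix.of m).det) (fun i j => if i = j then 1 else 0) N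
      = ∑ i, N i i := by
  set e : Fin n → Fin n → ℂ := fun i j => if i = j then 1 else 0 with he
  have h1 : HasDerivAt (fun t : ℝ => e + t • N) N 0 := by
    simpa using ((hasDerivAt_id (0 : ℝ)).smul_const N).const_add e
  have h2 : HasDerivAt (fun t : ℝ => (Matrix.of (e + t • N)).det) (fderiv ℝ
      (fun m : Fin n → Fin n → ℂ => (Matrix.of m).det) e N) 0 :=
    HasFDerivAt.comp_hasDerivAt_of_eq (0 : ℝ) (((contDiff_det (n := n) (𝕜 := ℂ)).differentiable
      (by norm_num) e).hasFDerivAt) h1 (by simp)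
  -- `det(1 + tN)` is a polynomial in `t` with linear coefficient `tr N`; dividing twice by the
  -- variable isolates the remainder of order `t²`.
  obtain ⟨q, hq⟩ : ∃ q : Polynomial ℂ, ∀ t : ℝ, (Matrix.of (e + t • N)).det =
      1 + Matrix.trace (Matrix.of N) * (t : ℂ) + q.eval (t : ℂ) * (t : ℂ) ^ 2 := by
    refine ⟨(Matrix.det (1 + (Polynomial.X : Polynomial ℂ) •
      (Matrix.of N).map Polynomial.C)).divX.divX, fun t => ?_⟩
    rw [← Matrix.det_one_add_smul (t : ℂ) (Matrix.of N)]
    rfl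
  simp_rw [hq] at h2
  have h4 : HasDerivAt (fun t : ℝ => 1 + Matrix.trace (Matrix.of N) * (t : ℂ) +
        q.eval (t : ℂ) * (t : ℂ) ^ 2) (Matrix.trace (Matrix.of N)) 0 := by
    have hid : HasDerivAt (fun z : ℂ => z) 1 (((0 : ℝ) : ℂ)) := hasDerivAt_id _
    have := (((hid.const_mul (Matrix.trace (Matrix.of N))).const_add 1).add
      ((q.hasDerivAt (((0 : ℝ) : ℂ))).mul (hid.pow 2))).comp_ofReal
    simpa using this
  rw [h2.unique h4]
  simp [Matrix.trace]

end Determinants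

/-! ### Phase functions in coordinates and their derivatives on the diagonal -/

section LocalPhases

variable {d : ℕ}

/-- The domain of phase functions `Φ (x, y, p)` in coordinates. -/
def phaseDomain (D : Set (Coord d)) : Set (Coord d × Coord d × Coord d) := D ×ˢ D ×ˢ {0}ᶜ

lemma isOpen_phaseDomain {D : Set (Coord d)} (hD : IsOpen D) : IsOpen (phaseDomain D) :=
  hD.prod (hD.prod isOpen_compl_singleton)

/-- Phase functions in coordinates. -/
structure IsLocalPhase (D : Set (Coord d)) (Φ : Coord d × Coord d × Coord d → ℂ) : Prop where
  isOpen : IsOpen D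
  smooth : ContDiffOn ℝ ∞ Φ (phaseDomain D)
  homogeneous : ∀ x ∈ D, ∀ y ∈ D, ∀ p : Coord d, p ≠ 0 → ∀ t : ℝ, 0 < t →
    Φ (x, y, t • p) = (t : ℂ) * Φ (x, y, p)
  linear_part : ∀ y ∈ D, ∀ p : Coord d, p ≠ 0 →
    (fun x => Φ (x, y, p) - ((inner ℝ (x - y) p : ℝ) : ℂ)) =O[𝓝 y] fun x => ‖x - y‖ ^ 2
  im_nonneg : ∀ x ∈ D, ∀ y ∈ D, ∀ p : Coord d, p ≠ 0 → 0 ≤ (Φ (x, y, p)).im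

/-- The standard linear phase. -/
def linearPhase (x : Coord d × Coord d × Coord d) : ℂ := ((inner ℝ (x.1 - x.2.1) x.2.2 : ℝ) : ℂ)

/-- The deviation of a phase from the linear one. -/
def excess (Φ : Coord d × Coord d × Coord d → ℂ) (x : Coord d × Coord d × Coord d) : ℂ :=
  Φ x - linearPhase x

lemma contDiff_linearPhase : ContDiff ℝ ∞ (linearPhase (d := d)) :=
  Complex.ofRealCLM.contDiff.comp
    ((contDiff_fst.sub (contDiff_fst.comp contDiff_snd)).inner ℝ (contDiff_snd.comp contDiff_snd))

/-- The entries `∂_{x_α} ∂_{p_β} Φ`. -/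
def mixedEntry (Φ : Coord d × Coord d × Coord d → ℂ) (α β : Fin d) :
    Coord d × Coord d × Coord d → ℂ :=
  dirDeriv (stdVec α, 0, 0) (dirDeriv (0, 0, stdVec β) Φ)

lemma inner_stdVec (v : Coord d) (α : Fin d) : inner ℝ v (stdVec α) = v α := by
  simp [stdVec, EuclideanSpace.inner_single_right]

lemma mixedEntry_linearPhase (α β : Fin d) :
    mixedEntry (d := d) linearPhase α β = fun _ => if α = β then 1 else 0 := by
  have h1 : dirDeriv (0, 0, stdVec β) (linearPhase (d := d)) =
      fun x => (((x.1 - x.2.1) β : ℝ) : ℂ) := by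
    funext x
    have hd : DifferentiableAt ℝ (linearPhase (d := d)) x :=
      contDiff_linearPhase.differentiable (by norm_num) x
    have hA : HasFDerivAt (fun t : ℝ => x + t • ((0, 0, stdVec β) : Coord d × Coord d × Coord d))
        ((ContinuousLinearMap.id ℝ ℝ).smulRight (0, 0, stdVec β)) 0 := by
      simpa using (((ContinuousLinearMap.id ℝ ℝ).smulRight
        ((0, 0, stdVec β) : Coord d × Coord d × Coord d)).hasFDerivAt (x := 0)).const_add x
    have h2 := fderiv_comp_apply (f := linearPhase (d := d)) (x := (0 : ℝ))
      (by simpa using hd) hA 1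
    simp only [ContinuousLinearMap.smulRight_apply, ContinuousLinearMap.id_apply, one_smul,
      zero_smul, add_zero] at h2
    rw [dirDeriv, ← h2]
    have h3 : (fun t : ℝ => linearPhase (x + t • ((0, 0, stdVec β) : Coord d × Coord d × Coord d)))
        = fun t : ℝ => ((inner ℝ (x.1 - x.2.1) x.2.2 : ℝ) : ℂ) + (t : ℂ) * (((x.1 - x.2.1) β : ℝ) : ℂ) := by
      funext t
      simp only [linearPhase, Prod.fst_add, Prod.snd_add, Prod.smul_fst, Prod.smul_snd, smul_zero,
        add_zero, inner_add_right, inner_smul_right, inner_stdVec]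
      push_cast
      rfl
    rw [h3, fderiv_apply_one_eq_deriv]
    have h4 : HasDerivAt (fun t : ℝ => ((inner ℝ (x.1 - x.2.1) x.2.2 : ℝ) : ℂ) +
        (t : ℂ) * (((x.1 - x.2.1) β : ℝ) : ℂ)) (1 * (((x.1 - x.2.1) β : ℝ) : ℂ)) 0 :=
      ((Complex.ofRealCLM.hasDerivAt (x := (0 : ℝ))).mul_const _).const_add _
    rw [h4.deriv, one_mul]
  have h5 : (fun x : Coord d × Coord d × Coord d => (((x.1 - x.2.1) β : ℝ) : ℂ)) =
      ⇑(Complex.ofRealCLM.comp ((EuclideanSpace.proj (𝕜 := ℝ) β).comp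
        (ContinuousLinearMap.fst ℝ (Coord d) (Coord d × Coord d) -
          (ContinuousLinearMap.fst ℝ (Coord d) (Coord d)).comp
            (ContinuousLinearMap.snd ℝ (Coord d) (Coord d × Coord d))))) := by
    funext x
    simp
  funext x
  rw [mixedEntry, h1, h5, dirDeriv, ContinuousLinearMap.fderiv]
  simp only [stdVec]
  rcases eq_or_ne α β with rfl | hαβ
  · simp
  · simp [hαβ, hαβ.symm]

variable {D : Set (Coord d)} {Φ : Coord d × Coord d × Coord d → ℂ}

namespace IsLocalPhase

lemma contDiffOn_excess (h : IsLocalPhase D Φ) : ContDiffOn ℝ ∞ (excess Φ) (phaseDomain D) :=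
  h.smooth.sub contDiff_linearPhase.contDiffOn

lemma diag_mem {y p : Coord d} (hy : y ∈ D) (hp : p ≠ 0) : (y, y, p) ∈ phaseDomain D :=
  ⟨hy, hy, hp⟩

lemma hasFDerivAt_diag (y p : Coord d) :
    HasFDerivAt (fun x : Coord d × Coord d => (x.1, x.1, x.2))
      ((ContinuousLinearMap.fst ℝ (Coord d) (Coord d)).prod
        ((ContinuousLinearMap.fst ℝ (Coord d) (Coord d)).prod
          (ContinuousLinearMap.snd ℝ (Coord d) (Coord d)))) (y, p) :=
  hasFDerivAt_fst.prodMk (hasFDerivAt_fst.prodMk hasFDerivAt_snd)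

/-- A function which vanishes on the diagonal has no derivative along the diagonal. -/
lemma fderiv_eq_zero_of_diag (hD : IsOpen D) {f : Coord d × Coord d × Coord d → ℂ}
    (hf : ContDiffOn ℝ ∞ f (phaseDomain D)) (h0 : ∀ y ∈ D, ∀ p : Coord d, p ≠ 0 → f (y, y, p) = 0)
    {y p : Coord d} (hy : y ∈ D) (hp : p ≠ 0) (u q : Coord d) :
    fderiv ℝ f (y, y, p) (u, u, q) = 0 := by
  have h1 := fderiv_comp_apply (f := f)
    (A := fun x : Coord d × Coord d => (x.1, x.1, x.2)) (x := (y, p)) (((hf.contDiffAt ((isOpen_phaseDomain hD).mem_nhds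
    (diag_mem hy hp))).differentiableAt (by norm_num))) (hasFDerivAt_diag y p) (u, q)
  have h2 : (fun x : Coord d × Coord d => f (x.1, x.1, x.2)) =ᶠ[𝓝 (y, p)] fun _ => 0 := by
    filter_upwards [(hD.prod isOpen_compl_singleton).mem_nhds
      (show (y, p) ∈ D ×ˢ ({0}ᶜ : Set (Coord d)) from ⟨hy, hp⟩)] with x hx
    exact h0 _ hx.1 _ hx.2
  rw [h2.fderiv_eq] at h1
  simpa using h1.symm

lemma excess_diag (h : IsLocalPhase D Φ) {y p : Coord d} (hy : y ∈ D) (hp : p ≠ 0) :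
    excess Φ (y, y, p) = 0 := by
  simpa [excess, linearPhase] using (h.linear_part y hy p hp).eq_zero_of_norm_pow two_ne_zero

/-- The `x`-derivative vanishes by the bound `O(‖x - y‖²)`, and derivatives along the diagonal
vanish because the excess is zero there. These directions span. -/
lemma fderiv_excess_diag (h : IsLocalPhase D Φ) {y p : Coord d} (hy : y ∈ D) (hp : p ≠ 0) :
    fderiv ℝ (excess Φ) (y, y, p) = 0 := by
  have hdiff : DifferentiableAt ℝ (excess Φ) (y, y, p) :=
    (h.contDiffOn_excess.contDiffAt ((isOpen_phaseDomain h.isOpen).mem_nhds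
      (diag_mem hy hp))).differentiableAt (by norm_num)
  have h1 : ∀ u : Coord d, fderiv ℝ (excess Φ) (y, y, p) (u, 0, 0) = 0 := by
    intro u
    have h2 := fderiv_comp_apply (f := excess Φ) (x := y) hdiff
      (hasFDerivAt_prodMk_left (𝕜 := ℝ) y ((y, p) : Coord d × Coord d)) u
    have h3 : HasFDerivAt (fun x => excess Φ (x, (y, p))) (0 : Coord d →L[ℝ] ℂ) y :=
      (h.linear_part y hy p hp).hasFDerivAt one_lt_two
    rw [h3.fderiv] at h2
    exact h2.symm
  refine ContinuousLinearMap.ext fun x => ?_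
  obtain ⟨u, v, q⟩ := x
  have h4 := fderiv_eq_zero_of_diag h.isOpen h.contDiffOn_excess
    (fun y hy p hp => h.excess_diag hy hp) hy hp v q
  have h5 : ((u, v, q) : Coord d × Coord d × Coord d) = (v, v, q) + (u - v, 0, 0) := by simp
  rw [h5, map_add, h4, h1]
  simp

lemma dirDeriv_excess_diag (h : IsLocalPhase D Φ) {y p : Coord d} (hy : y ∈ D) (hp : p ≠ 0)
    (v : Coord d × Coord d × Coord d) : dirDeriv v (excess Φ) (y, y, p) = 0 := by
  rw [dirDeriv, h.fderiv_excess_diag hy hp]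
  rfl

/-- First derivatives of the excess vanish on the diagonal, hence so do their derivatives along it.
This is what exchanges `∂_y` for `-∂_x` in second derivatives. -/
lemma dirDeriv_dirDeriv_excess_diag (h : IsLocalPhase D Φ) {y p : Coord d} (hy : y ∈ D)
    (hp : p ≠ 0) (v : Coord d × Coord d × Coord d) (u q : Coord d) :
    dirDeriv (u, u, q) (dirDeriv v (excess Φ)) (y, y, p) = 0 :=
  fderiv_eq_zero_of_diag h.isOpen (contDiffOn_dirDeriv (isOpen_phaseDomain h.isOpen) h.contDiffOn_excess v)
    (fun _ hy _ hp => h.dirDeriv_excess_diag hy hp v) hy hp u q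

lemma mixedEntry_eq (h : IsLocalPhase D Φ) (α β : Fin d) {x : Coord d × Coord d × Coord d}
    (hx : x ∈ phaseDomain D) :
    mixedEntry Φ α β x = mixedEntry (excess Φ) α β x + if α = β then 1 else 0 := by
  have hO := isOpen_phaseDomain h.isOpen
  have hl : ∀ v, ContDiffOn ℝ ∞ (dirDeriv v (linearPhase (d := d))) (phaseDomain D) :=
    fun v => contDiffOn_dirDeriv hO contDiff_linearPhase.contDiffOn v
  have he : ∀ v, ContDiffOn ℝ ∞ (dirDeriv v (excess Φ)) (phaseDomain D) :=
    fun v => contDiffOn_dirDeriv hO h.contDiffOn_excess v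
  have hda : ∀ {f : Coord d × Coord d × Coord d → ℂ}, ContDiffOn ℝ ∞ f (phaseDomain D) →
      ∀ {x}, x ∈ phaseDomain D → DifferentiableAt ℝ f x := fun hf _ hx =>
    (hf.contDiffAt (hO.mem_nhds hx)).differentiableAt (by norm_num)
  have h1 : EqOn (dirDeriv (0, 0, stdVec β) Φ) (fun x => dirDeriv (0, 0, stdVec β) (excess Φ) x +
      dirDeriv (0, 0, stdVec β) linearPhase x) (phaseDomain D) := by
    intro x hx
    have h2 : Φ = fun x => excess Φ x + linearPhase x := by funext x; simp [excess]
    simp only [dirDeriv]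
    conv_lhs => rw [h2]
    rw [fderiv_fun_add (hda h.contDiffOn_excess hx) (hda contDiff_linearPhase.contDiffOn hx)]
    rfl
  have h3 := congrFun (mixedEntry_linearPhase (d := d) α β) x
  rw [← h3, mixedEntry, mixedEntry, mixedEntry, dirDeriv_congr hO h1 _ hx]
  simp only [dirDeriv]
  have := fderiv_fun_add (hda (he (0, 0, stdVec β)) hx) (hda (hl (0, 0, stdVec β)) hx)
  simp only [dirDeriv] at this
  rw [this]
  rfl

/-- The linear phase contributes the identity matrix. For the excess, the `p`-direction is tangent
to the diagonal, along which the first `x`-derivative vanishes. -/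
lemma mixedEntry_diag (h : IsLocalPhase D Φ) {y p : Coord d} (hy : y ∈ D) (hp : p ≠ 0)
    (α β : Fin d) : mixedEntry Φ α β (y, y, p) = if α = β then 1 else 0 := by
  rw [h.mixedEntry_eq α β (diag_mem hy hp), mixedEntry,
    dirDeriv_comm (isOpen_phaseDomain h.isOpen) h.contDiffOn_excess _ _ (diag_mem hy hp),
    h.dirDeriv_dirDeriv_excess_diag hy hp, zero_add]

lemma contDiffOn_mixedEntry (h : IsLocalPhase D Φ) (α β : Fin d) :
    ContDiffOn ℝ ∞ (mixedEntry Φ α β) (phaseDomain D) :=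
  contDiffOn_dirDeriv (isOpen_phaseDomain h.isOpen)
    (contDiffOn_dirDeriv (isOpen_phaseDomain h.isOpen) h.smooth _) _

end IsLocalPhase

end LocalPhases

/-! ### The phase and the weight in centred coordinates, and the subprincipal relation -/

section CentredPhases

variable {d : ℕ}

/-- The deviation from the linear phase, in coordinates centred at `x₀`. -/
def centredPhase (Φ : Coord d × Coord d × Coord d → ℂ) (x₀ : Coord d) (x : Coord d × Coord d) : ℂ :=
  excess Φ (x₀, x₀ + x.1, x.2)

/-- `det Φ_{x p}`. -/
def localDet (Φ : Coord d × Coord d × Coord d → ℂ) (x : Coord d × Coord d × Coord d) : ℂ :=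
  (Matrix.of fun α β => mixedEntry Φ α β x).det

/-- `ρ(x₀)^{-1/2} ρ(x₀ + z)^{1/2}`. -/
def densityRatio (ρ : Coord d → ℝ) (x₀ z : Coord d) : ℝ :=
  ρ x₀ ^ (-(1 / 2) : ℝ) * ρ (x₀ + z) ^ (1 / 2 : ℝ)

/-- `ρ(x₀)^{-1/2} ρ(x₀ + z)^{1/2} (det Φ_{x p})^{1/2}` at `x = x₀`, `y = x₀ + z`. -/
def localWeight (ρ : Coord d → ℝ) (Φ : Coord d × Coord d × Coord d → ℂ) (x₀ : Coord d)
    (x : Coord d × Coord d) : ℂ :=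
  (densityRatio ρ x₀ x.1 : ℂ) * Complex.exp (Complex.log (localDet Φ (x₀, x₀ + x.1, x.2)) / 2)

variable {D : Set (Coord d)} {Φ : Coord d × Coord d × Coord d → ℂ}

lemma hasFDerivAt_shift (x₀ : Coord d) (x : Coord d × Coord d) :
    HasFDerivAt (fun x : Coord d × Coord d => (x₀, x₀ + x.1, x.2))
      ((0 : Coord d × Coord d →L[ℝ] Coord d).prod
        ((ContinuousLinearMap.fst ℝ (Coord d) (Coord d)).prod
          (ContinuousLinearMap.snd ℝ (Coord d) (Coord d)))) x :=
  (hasFDerivAt_const x₀ x).prodMk ((hasFDerivAt_fst.const_add x₀).prodMk hasFDerivAt_snd)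

lemma contDiff_shift (x₀ : Coord d) :
    ContDiff ℝ ∞ fun x : Coord d × Coord d => (x₀, x₀ + x.1, x.2) := by fun_prop

namespace IsLocalPhase

lemma differentiableAt (h : IsLocalPhase D Φ) {f : Coord d × Coord d × Coord d → ℂ}
    (hf : ContDiffOn ℝ ∞ f (phaseDomain D)) {x : Coord d × Coord d × Coord d}
    (hx : x ∈ phaseDomain D) : DifferentiableAt ℝ f x :=
  (hf.contDiffAt ((isOpen_phaseDomain h.isOpen).mem_nhds hx)).differentiableAt (by norm_num)

/-- A `p`-derivative of a function homogeneous of degree one in `p` is homogeneous of degree zero.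
-/
lemma dirDeriv_smul (h : IsLocalPhase D Φ) {t : ℝ} (ht : 0 < t) (q : Coord d)
    {x y p : Coord d} (hx : x ∈ D) (hy : y ∈ D) (hp : p ≠ 0) :
    dirDeriv (0, 0, q) Φ (x, y, t • p) = dirDeriv (0, 0, q) Φ (x, y, p) := by
  set L : Coord d × Coord d × Coord d →L[ℝ] Coord d × Coord d × Coord d :=
    (ContinuousLinearMap.fst ℝ _ _).prod (((ContinuousLinearMap.fst ℝ _ _).comp
      (ContinuousLinearMap.snd ℝ _ _)).prod (t • ((ContinuousLinearMap.snd ℝ _ _).comp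
      (ContinuousLinearMap.snd ℝ _ _)))) with hL
  have hLx : ∀ x y p : Coord d, L (x, y, p) = (x, y, t • p) := fun x y p => rfl
  have htp : t • p ≠ 0 := smul_ne_zero ht.ne' hp
  have h1 := fderiv_comp_apply (f := Φ) (A := L) (x := (x, y, p))
    (h.differentiableAt h.smooth (by rw [hLx]; exact ⟨hx, hy, htp⟩)) L.hasFDerivAt (0, 0, q)
  have h2 : (fun x => Φ (L x)) =ᶠ[𝓝 (x, y, p)] fun x => (t : ℂ) * Φ x := by
    filter_upwards [(isOpen_phaseDomain h.isOpen).mem_nhds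
      (show (x, y, p) ∈ phaseDomain D from ⟨hx, hy, hp⟩)] with x hx
    exact h.homogeneous _ hx.1 _ hx.2.1 _ hx.2.2 t ht
  have h3 : HasFDerivAt (fun x => (t : ℂ) * Φ x) ((t : ℂ) • fderiv ℝ Φ (x, y, p)) (x, y, p) :=
    (h.differentiableAt h.smooth (show (x, y, p) ∈ phaseDomain D from ⟨hx, hy, hp⟩)).hasFDerivAt.const_mul
      (t : ℂ)
  rw [h2.fderiv_eq, h3.fderiv, hLx, hLx] at h1
  have h4 : ((0, 0, t • q) : Coord d × Coord d × Coord d) = t • (0, 0, q) := by simp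
  rw [h4, map_smul, Complex.real_smul] at h1
  exact (mul_left_cancel₀ (by exact_mod_cast ht.ne') h1).symm

lemma localDet_smul (h : IsLocalPhase D Φ) {t : ℝ} (ht : 0 < t)
    {x y p : Coord d} (hx : x ∈ D) (hy : y ∈ D) (hp : p ≠ 0) :
    localDet Φ (x, y, t • p) = localDet Φ (x, y, p) := by
  have htp : t • p ≠ 0 := smul_ne_zero ht.ne' hp
  unfold localDet
  congr 2
  funext α β
  have hf := contDiffOn_dirDeriv (isOpen_phaseDomain h.isOpen) h.smooth (0, 0, stdVec β)
  have e : ∀ q : Coord d, q ≠ 0 → mixedEntry Φ α β (x, y, q) =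
      fderiv ℝ (fun x' => dirDeriv (0, 0, stdVec β) Φ (x', y, q)) x (stdVec α) := by
    intro q hq
    have := fderiv_comp_apply (f := dirDeriv (0, 0, stdVec β) Φ) (x := x)
      (h.differentiableAt hf (show (x, (y, q)) ∈ phaseDomain D from ⟨hx, hy, hq⟩))
      (hasFDerivAt_prodMk_left (𝕜 := ℝ) x ((y, q) : Coord d × Coord d)) (stdVec α)
    rw [this]
    rfl
  rw [e _ htp, e _ hp]
  have : (fun x' => dirDeriv (0, 0, stdVec β) Φ (x', y, t • p)) =ᶠ[𝓝 x]
      fun x' => dirDeriv (0, 0, stdVec β) Φ (x', y, p) := by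
    filter_upwards [h.isOpen.mem_nhds hx] with x' hx'
    exact h.dirDeriv_smul ht _ hx' hy hp
  rw [this.fderiv_eq]

lemma localDet_diag (h : IsLocalPhase D Φ) {y p : Coord d} (hy : y ∈ D) (hp : p ≠ 0) :
    localDet Φ (y, y, p) = 1 := by
  simp_rw [localDet, h.mixedEntry_diag hy hp]
  exact Matrix.det_one

lemma contDiffOn_localDet (h : IsLocalPhase D Φ) : ContDiffOn ℝ ∞ (localDet Φ) (phaseDomain D) :=
  contDiff_det.comp_contDiffOn (contDiffOn_pi.2 fun α => contDiffOn_pi.2 fun β =>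
    h.contDiffOn_mixedEntry α β)

/-- Near a point of the diagonal, `det Φ_{x p}` is close to `1`. -/
lemma exists_radius (h : IsLocalPhase D Φ) {x₀ : Coord d} (hx₀ : x₀ ∈ D) :
    ∃ r : ℝ, 0 < r ∧ ∀ z ∈ Metric.ball (0 : Coord d) r, x₀ + z ∈ D ∧
      ∀ p : Coord d, p ≠ 0 → localDet Φ (x₀, x₀ + z, p) ∈ Complex.slitPlane := by
  -- Compactness of the unit sphere gives a radius independent of the direction of `p`; homogeneity
  -- of degree zero extends the conclusion to all `p ≠ 0`.
  have h1 : ∀ᶠ z in 𝓝 (0 : Coord d), ∀ p ∈ Metric.sphere (0 : Coord d) 1,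
      localDet Φ (x₀, x₀ + z, p) ∈ Complex.slitPlane := by
    refine (isCompact_sphere (0 : Coord d) 1).eventually_forall_of_forall_eventually
      (P := fun z p => localDet Φ (x₀, x₀ + z, p) ∈ Complex.slitPlane) fun p hp => ?_
    have hp0 : p ≠ 0 := by
      rintro rfl
      simp at hp
    have hc : ContinuousAt (fun z : Coord d × Coord d => localDet Φ (x₀, x₀ + z.1, z.2)) (0, p) := by
      refine ContinuousAt.comp (g := localDet Φ) (f := fun z : Coord d × Coord d =>
        (x₀, x₀ + z.1, z.2)) ?_ (contDiff_shift x₀).continuous.continuousAt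
      refine (h.contDiffOn_localDet.continuousOn).continuousAt
        ((isOpen_phaseDomain h.isOpen).mem_nhds ⟨hx₀, by simpa using hx₀, hp0⟩)
    refine hc.eventually_mem (Complex.isOpen_slitPlane.mem_nhds ?_)
    simp only [add_zero]
    rw [h.localDet_diag hx₀ hp0]
    exact Complex.one_mem_slitPlane
  have h2 : ∀ᶠ z in 𝓝 (0 : Coord d), x₀ + z ∈ D := by
    have : Tendsto (fun z : Coord d => x₀ + z) (𝓝 0) (𝓝 (x₀ + 0)) :=
      (continuous_const_add x₀).tendsto 0
    rw [add_zero] at this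
    exact this.eventually (h.isOpen.mem_nhds hx₀)
  obtain ⟨r, hr, hr1⟩ := Metric.eventually_nhds_iff_ball.1 (h1.and h2)
  refine ⟨r, hr, fun z hz => ⟨(hr1 z hz).2, fun p hp => ?_⟩⟩
  have hp' : 0 < ‖p‖ := norm_pos_iff.2 hp
  rw [← h.localDet_smul (inv_pos.2 hp') hx₀ (hr1 z hz).2 hp]
  refine (hr1 z hz).1 _ ?_
  rw [mem_sphere_zero_iff_norm, norm_smul, norm_inv, norm_norm, inv_mul_cancel₀ hp'.ne']

variable {x₀ : Coord d} {r : ℝ}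

lemma shift_mem (hx₀ : x₀ ∈ D) (hr : ∀ z ∈ Metric.ball (0 : Coord d) r, x₀ + z ∈ D)
    {x : Coord d × Coord d} (hx : x ∈ conicDomain (Coord d) r) :
    (x₀, x₀ + x.1, x.2) ∈ phaseDomain D := ⟨hx₀, hr _ hx.1, hx.2⟩

/-- Second-order vanishing is that of the excess on the diagonal, and the imaginary part is that of
the phase, because the linear phase is real. -/
theorem isPerturbation (h : IsLocalPhase D Φ) (hx₀ : x₀ ∈ D)
    (hr : ∀ z ∈ Metric.ball (0 : Coord d) r, x₀ + z ∈ D) :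
    IsPerturbation r (centredPhase Φ x₀) where
  smooth := h.contDiffOn_excess.comp (contDiff_shift x₀).contDiffOn fun _ hx => shift_mem hx₀ hr hx
  homogeneous z hz p hp t ht := by
    simp only [centredPhase, excess, linearPhase, h.homogeneous _ hx₀ _ (hr z hz) p hp t ht,
      inner_smul_right, zpow_one]
    push_cast
    ring
  eq_zero p hp := by simpa [centredPhase] using h.excess_diag hx₀ hp
  hasFDerivAt p hp := by
    have h1 : HasFDerivAt (excess Φ) (0 : Coord d × Coord d × Coord d →L[ℝ] ℂ) (x₀, x₀ + 0, p) := by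
      rw [add_zero, ← h.fderiv_excess_diag hx₀ hp]
      exact (h.differentiableAt h.contDiffOn_excess (diag_mem hx₀ hp)).hasFDerivAt
    have h2 : HasFDerivAt (fun z : Coord d => (x₀, x₀ + z, p)) ((0 : Coord d →L[ℝ] Coord d).prod
        ((ContinuousLinearMap.id ℝ (Coord d)).prod 0)) 0 :=
      (hasFDerivAt_const x₀ 0).prodMk (((hasFDerivAt_id (0 : Coord d)).const_add x₀).prodMk
        (hasFDerivAt_const p 0))
    have h3 := HasFDerivAt.comp (g := excess Φ) (0 : Coord d) h1 h2
    rw [ContinuousLinearMap.zero_comp] at h3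
    exact h3
  im_nonneg z hz p hp := by
    simpa [centredPhase, excess, linearPhase] using h.im_nonneg _ hx₀ _ (hr z hz) p hp

lemma contDiffOn_densityRatio {ρ : Coord d → ℝ} (hρ : ContDiffOn ℝ ∞ ρ D)
    (hρ0 : ∀ x ∈ D, 0 < ρ x) (hr : ∀ z ∈ Metric.ball (0 : Coord d) r, x₀ + z ∈ D) :
    ContDiffOn ℝ ∞ (densityRatio ρ x₀) (Metric.ball 0 r) := by
  refine contDiffOn_const.mul (ContDiffOn.rpow_const_of_ne ?_ fun z hz => (hρ0 _ (hr z hz)).ne')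
  exact hρ.comp (f := fun z => x₀ + z) (by fun_prop) hr

/-- On the ball the determinant avoids the cut of the logarithm, so the principal branch of its
square root is smooth; degree zero is inherited from the determinant. -/
theorem isConic_localWeight (h : IsLocalPhase D Φ) (hx₀ : x₀ ∈ D)
    (hr : ∀ z ∈ Metric.ball (0 : Coord d) r, x₀ + z ∈ D)
    (hdet : ∀ z ∈ Metric.ball (0 : Coord d) r, ∀ p : Coord d, p ≠ 0 →
      localDet Φ (x₀, x₀ + z, p) ∈ Complex.slitPlane)
    {ρ : Coord d → ℝ} (hρ : ContDiffOn ℝ ∞ ρ D) (hρ0 : ∀ x ∈ D, 0 < ρ x) :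
    IsConic r 0 (localWeight ρ Φ x₀) where
  smooth := by
    have h1 : ContDiffOn ℝ ∞ (fun x : Coord d × Coord d => localDet Φ (x₀, x₀ + x.1, x.2))
        (conicDomain (Coord d) r) :=
      h.contDiffOn_localDet.comp (contDiff_shift x₀).contDiffOn fun _ hx => shift_mem hx₀ hr hx
    have h2 : ContDiffOn ℝ ∞ (fun x : Coord d × Coord d => Complex.log
        (localDet Φ (x₀, x₀ + x.1, x.2))) (conicDomain (Coord d) r) := fun x hx =>
      ContDiffAt.comp_contDiffWithinAt (g := Complex.log) x
        ((Complex.contDiffAt_log (hdet x.1 hx.1 x.2 hx.2)).restrict_scalars ℝ) (h1 x hx)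
    have h3 : ContDiffOn ℝ ∞ (fun x : Coord d × Coord d => densityRatio ρ x₀ x.1)
        (conicDomain (Coord d) r) :=
      (contDiffOn_densityRatio hρ hρ0 hr).comp contDiff_fst.contDiffOn fun x hx => hx.1
    exact (Complex.ofRealCLM.contDiff.comp_contDiffOn h3).mul (h2.div_const 2).cexp
  homogeneous z hz p hp t ht := by
    simp [localWeight, h.localDet_smul ht hx₀ (hr z hz) hp]

lemma densityRatio_zero {ρ : Coord d → ℝ} (hρ0 : 0 < ρ x₀) : densityRatio ρ x₀ 0 = 1 := by
  rw [densityRatio, add_zero, ← Real.rpow_add hρ0]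
  norm_num

lemma localWeight_zero (h : IsLocalPhase D Φ) (hx₀ : x₀ ∈ D) {ρ : Coord d → ℝ}
    (hρ0 : 0 < ρ x₀) {p : Coord d} (hp : p ≠ 0) : localWeight ρ Φ x₀ (0, p) = 1 := by
  rw [localWeight, densityRatio_zero hρ0, add_zero, h.localDet_diag hx₀ hp]
  simp

/-- The Hessian of the phase on the diagonal. -/
lemma hessCoeff_centredPhase (h : IsLocalPhase D Φ) (hr0 : 0 < r) (hx₀ : x₀ ∈ D)
    (hr : ∀ z ∈ Metric.ball (0 : Coord d) r, x₀ + z ∈ D) (a b : Fin d) {p : Coord d} (hp : p ≠ 0) :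
    hessCoeff (centredPhase Φ x₀) a b p =
      -2⁻¹ * dirDeriv (0, stdVec b, 0) (dirDeriv (stdVec a, 0, 0) (excess Φ)) (x₀, x₀, p) := by
  have hO := isOpen_phaseDomain h.isOpen
  have hmem : ((0 : Coord d), p) ∈ conicDomain (Coord d) r := zero_mem_conicDomain hr0 hp
  have hb := contDiffOn_dirDeriv hO h.contDiffOn_excess (0, stdVec b, 0)
  have h1 : (fun x => fderiv ℝ (centredPhase Φ x₀) x (stdVec b, 0)) =ᶠ[𝓝 (0, p)]
      fun x => dirDeriv (0, stdVec b, 0) (excess Φ) (x₀, x₀ + x.1, x.2) := by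
    filter_upwards [(isOpen_conicDomain (E := Coord d) r).mem_nhds hmem] with x hx
    exact fderiv_comp_apply (f := excess Φ)
      (A := fun x : Coord d × Coord d => (x₀, x₀ + x.1, x.2)) (x := x)
      (h.differentiableAt h.contDiffOn_excess (shift_mem hx₀ hr hx)) (hasFDerivAt_shift x₀ x) _
  have h2 : fderiv ℝ (fun x => fderiv ℝ (centredPhase Φ x₀) x (stdVec b, 0)) (0, p) (stdVec a, 0)
      = dirDeriv (0, stdVec a, 0) (dirDeriv (0, stdVec b, 0) (excess Φ)) (x₀, x₀, p) := by
    rw [h1.fderiv_eq, fderiv_comp_apply (f := dirDeriv (0, stdVec b, 0) (excess Φ))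
      (A := fun x : Coord d × Coord d => (x₀, x₀ + x.1, x.2)) (x := ((0 : Coord d), p))
      (h.differentiableAt hb (shift_mem hx₀ hr hmem)) (hasFDerivAt_shift x₀ _)]
    simp only [add_zero]
    rfl
  -- Differentiating `∂_{y_b}` of the excess along the diagonal direction `e_a` gives zero, so
  -- `∂_{y_a}` may be replaced by `-∂_{x_a}`.
  have h3 := h.dirDeriv_dirDeriv_excess_diag hx₀ hp (0, stdVec b, 0) (stdVec a) 0
  have h4 : ((stdVec a, stdVec a, 0) : Coord d × Coord d × Coord d) =
    (0, stdVec a, 0) + (stdVec a, 0, 0) := by simp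
  rw [dirDeriv, h4, map_add] at h3
  rw [hessCoeff, h2, dirDeriv_comm hO h.contDiffOn_excess (0, stdVec b, 0) _ (diag_mem hx₀ hp)]
  simp only [dirDeriv] at h3 ⊢
  linear_combination 2⁻¹ * h3

/-- The Hessian formula is differentiated in `p_a` and the derivatives are commuted. Repeating the
index `a` selects the diagonal entries of `Φ_{xp}`, so that summation over `a` will give the trace.
-/
lemma fderiv_hessCoeff_centredPhase (h : IsLocalPhase D Φ) (hr0 : 0 < r) (hx₀ : x₀ ∈ D)
    (hr : ∀ z ∈ Metric.ball (0 : Coord d) r, x₀ + z ∈ D) (a b : Fin d) {p : Coord d} (hp : p ≠ 0) :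
    fderiv ℝ (hessCoeff (centredPhase Φ x₀) a b) p (stdVec a) =
      -2⁻¹ * dirDeriv (0, stdVec b, 0) (mixedEntry Φ a a) (x₀, x₀, p) := by
  have hO := isOpen_phaseDomain h.isOpen
  have ha := contDiffOn_dirDeriv hO h.contDiffOn_excess (stdVec a, 0, 0)
  have hba := contDiffOn_dirDeriv hO ha (0, stdVec b, 0)
  have h1 : hessCoeff (centredPhase Φ x₀) a b =ᶠ[𝓝 p] fun p => -2⁻¹ *
      dirDeriv (0, stdVec b, 0) (dirDeriv (stdVec a, 0, 0) (excess Φ)) (x₀, x₀, p) := by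
    filter_upwards [isOpen_compl_singleton.mem_nhds hp] with p hp
    exact h.hessCoeff_centredPhase hr0 hx₀ hr a b hp
  have hA : HasFDerivAt (fun p : Coord d => (x₀, x₀, p)) ((0 : Coord d →L[ℝ] Coord d).prod
        ((0 : Coord d →L[ℝ] Coord d).prod (ContinuousLinearMap.id ℝ (Coord d)))) p :=
    (hasFDerivAt_const x₀ p).prodMk ((hasFDerivAt_const x₀ p).prodMk (hasFDerivAt_id p))
  have hdiff := h.differentiableAt hba (diag_mem hx₀ hp)
  have hdiff' : DifferentiableAt ℝ (fun p => dirDeriv (0, stdVec b, 0)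
      (dirDeriv (stdVec a, 0, 0) (excess Φ)) (x₀, x₀, p)) p :=
    DifferentiableAt.comp (g := dirDeriv (0, stdVec b, 0) (dirDeriv (stdVec a, 0, 0) (excess Φ))) p
      hdiff hA.differentiableAt
  rw [h1.fderiv_eq, fderiv_const_mul hdiff', smul_apply, smul_eq_mul,
    fderiv_comp_apply (f := dirDeriv (0, stdVec b, 0) (dirDeriv (stdVec a, 0, 0) (excess Φ)))
      (A := fun p : Coord d => (x₀, x₀, p)) hdiff hA]
  congr 1
  have h2 : fderiv ℝ (dirDeriv (0, stdVec b, 0) (dirDeriv (stdVec a, 0, 0) (excess Φ))) (x₀, x₀, p)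
      (0, 0, stdVec a) = dirDeriv (0, stdVec b, 0) (dirDeriv (0, 0, stdVec a)
        (dirDeriv (stdVec a, 0, 0) (excess Φ))) (x₀, x₀, p) :=
    dirDeriv_comm hO ha _ _ (diag_mem hx₀ hp)
  have h3 : EqOn (mixedEntry Φ a a) (fun x => dirDeriv (0, 0, stdVec a)
        (dirDeriv (stdVec a, 0, 0) (excess Φ)) x + 1) (phaseDomain D) := by
    intro x hx
    rw [h.mixedEntry_eq a a hx, mixedEntry, dirDeriv_comm hO h.contDiffOn_excess _ _ hx, if_pos rfl]
  rw [dirDeriv_congr hO h3 _ (diag_mem hx₀ hp)]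
  refine h2.trans ?_
  rw [dirDeriv, dirDeriv, fderiv_add_const]

/-- Jacobi's formula at the identity matrix, which is the value of `Φ_{xp}` on the diagonal. -/
lemma dirDeriv_localDet_diag (h : IsLocalPhase D Φ) (hx₀ : x₀ ∈ D) {p : Coord d} (hp : p ≠ 0)
    (v : Coord d × Coord d × Coord d) :
    dirDeriv v (localDet Φ) (x₀, x₀, p) = ∑ a, dirDeriv v (mixedEntry Φ a a) (x₀, x₀, p) := by
  have h1 : HasFDerivAt (fun x : Coord d × Coord d × Coord d => fun α β => mixedEntry Φ α β x)
      (ContinuousLinearMap.pi fun α => ContinuousLinearMap.pi fun β =>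
        fderiv ℝ (mixedEntry Φ α β) (x₀, x₀, p)) (x₀, x₀, p) :=
    hasFDerivAt_pi.2 fun α => hasFDerivAt_pi.2 fun β =>
      (h.differentiableAt (h.contDiffOn_mixedEntry α β) (diag_mem hx₀ hp)).hasFDerivAt
  have h2 := fderiv_comp_apply (f := fun m : Fin d → Fin d → ℂ => (Matrix.of m).det)
    ((contDiff_det (n := d) (𝕜 := ℂ)).differentiable (by norm_num) _) h1 v
  have h3 : (fun α β => mixedEntry Φ α β (x₀, x₀, p)) = fun α β => if α = β then 1 else 0 := by
    funext α β
    exact h.mixedEntry_diag hx₀ hp α β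
  rw [h3, fderiv_det_one] at h2
  exact h2

/-- The divergence of the Hessian coefficients is `-½ ∂_{y_b} det Φ_{xp}`, and the square root in
the weight has gradient `+½ ∂_{y_b} det Φ_{xp}`. The remaining constant `β b` is the gradient of the
density ratio, which does not involve `p`. This is the reason for the exponent in the weight. -/
theorem subprincipalRelation (h : IsLocalPhase D Φ) (hr0 : 0 < r) (hx₀ : x₀ ∈ D)
    (hr : ∀ z ∈ Metric.ball (0 : Coord d) r, x₀ + z ∈ D) {ρ : Coord d → ℝ}
    (hρ : ContDiffOn ℝ ∞ ρ D) (hρ0 : ∀ x ∈ D, 0 < ρ x) :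
    SubprincipalRelation (centredPhase Φ x₀) (localWeight ρ Φ x₀) := by
  refine ⟨fun b => (fderiv ℝ (densityRatio ρ x₀) 0 (stdVec b) : ℂ), fun p hp b => ?_⟩
  simp_rw [h.fderiv_hessCoeff_centredPhase hr0 hx₀ hr _ b hp]
  rw [← Finset.mul_sum, ← h.dirDeriv_localDet_diag hx₀ hp]
  have h1 : HasFDerivAt (densityRatio ρ x₀) (fderiv ℝ (densityRatio ρ x₀) 0) ((0 : Coord d), p).1 :=
    (((contDiffOn_densityRatio hρ hρ0 hr).contDiffAt (Metric.ball_mem_nhds _ hr0)).differentiableAt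
      (by norm_num)).hasFDerivAt
  have h2 : HasFDerivAt (fun x : Coord d × Coord d => (densityRatio ρ x₀ x.1 : ℂ))
      (Complex.ofRealCLM.comp ((fderiv ℝ (densityRatio ρ x₀) 0).comp
        (ContinuousLinearMap.fst ℝ (Coord d) (Coord d)))) (0, p) :=
    Complex.ofRealCLM.hasFDerivAt.comp _ (h1.comp ((0 : Coord d), p) hasFDerivAt_fst)
  have h3 : DifferentiableAt ℝ (localDet Φ) (x₀, x₀ + ((0 : Coord d), p).1, p) := by
    refine h.differentiableAt h.contDiffOn_localDet ?_
    simpa using diag_mem hx₀ hp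
  have h4 : HasFDerivAt (fun x : Coord d × Coord d => localDet Φ (x₀, x₀ + x.1, x.2)) _ (0, p) :=
    HasFDerivAt.comp (g := localDet Φ) ((0 : Coord d), p) h3.hasFDerivAt
      (hasFDerivAt_shift x₀ (0, p))
  have h5 : localDet Φ (x₀, x₀ + ((0 : Coord d), p).1, ((0 : Coord d), p).2) = 1 := by
    simpa using h.localDet_diag hx₀ hp
  -- The derivative `½` of the square root at `1` matches the factor `½` in `hessCoeff`.
  have h6 : HasDerivAt (fun w : ℂ => Complex.exp (Complex.log w / 2)) 2⁻¹
      (localDet Φ (x₀, x₀ + ((0 : Coord d), p).1, ((0 : Coord d), p).2)) := by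
    rw [h5]
    have := ((Complex.hasDerivAt_log Complex.one_mem_slitPlane).div_const 2).cexp
    simpa using this
  have h7 := h2.mul (h6.comp_hasFDerivAt ((0 : Coord d), p) h4)
  have h8 : gradCoeff (localWeight ρ Φ x₀) b p = _ :=
    congrArg (fun L => L (stdVec b, 0)) h7.fderiv
  rw [h8]
  simp only [add_apply, smul_apply, Function.comp_apply, h5, densityRatio_zero (hρ0 x₀ hx₀)]
  simp [dirDeriv]
  ring

end IsLocalPhase

end CentredPhases

/-! ### Covectors and coordinate fields in charts -/

section Charts

variable {d : ℕ} {M : Type*} [TopologicalSpace M] [ChartedSpace (Coord d) M]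
  [IsManifold 𝓘(ℝ, Coord d) ∞ M]

/-- The matrix of the derivative of the chart at `c`, in the coordinates of the chart at `y`. -/
def toChart (c y : M) : Coord d →L[ℝ] Coord d := tangentCoordChange 𝓘(ℝ, Coord d) y c y

/-- The inverse of `toChart c y`. -/
def fromChart (c y : M) : Coord d →L[ℝ] Coord d := tangentCoordChange 𝓘(ℝ, Coord d) c y y

lemma fromChart_toChart {c y : M} (hy : y ∈ (extChartAt 𝓘(ℝ, Coord d) c).source) (v : Coord d) :
    fromChart c y (toChart c y v) = v := by
  rw [fromChart, toChart, tangentCoordChange_comp ⟨⟨mem_extChartAt_source y, hy⟩,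
    mem_extChartAt_source y⟩, tangentCoordChange_self (mem_extChartAt_source y)]

lemma toChart_fromChart {c y : M} (hy : y ∈ (extChartAt 𝓘(ℝ, Coord d) c).source) (v : Coord d) :
    toChart c y (fromChart c y v) = v := by
  rw [fromChart, toChart, tangentCoordChange_comp ⟨⟨hy, mem_extChartAt_source y⟩, hy⟩,
    tangentCoordChange_self hy]

lemma fromChart_fromChart {c c' y : M} (hy : y ∈ (extChartAt 𝓘(ℝ, Coord d) c).source)
    (hy' : y ∈ (extChartAt 𝓘(ℝ, Coord d) c').source) (v : Coord d) :
    fromChart c' y v = fromChart c y (tangentCoordChange 𝓘(ℝ, Coord d) c' c y v) := by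
  rw [fromChart, fromChart, tangentCoordChange_comp ⟨⟨hy', hy⟩, mem_extChartAt_source y⟩]

lemma toChart_self (c : M) : toChart c c = ContinuousLinearMap.id ℝ (Coord d) :=
  ContinuousLinearMap.ext fun _ => tangentCoordChange_self (mem_extChartAt_source c)

lemma isOpen_chartDomain (c : M) : IsOpen (chartDomain d c) := isOpen_extChartAt_target c

lemma chartPoint_mem {c : M} {y : Coord d} (hy : y ∈ chartDomain d c) :
    chartPoint c y ∈ (extChartAt 𝓘(ℝ, Coord d) c).source :=
  (extChartAt 𝓘(ℝ, Coord d) c).map_target hy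

lemma mfderiv_extChartAt_eq {c y : M} (hy : y ∈ (extChartAt 𝓘(ℝ, Coord d) c).source) :
    mfderiv 𝓘(ℝ, Coord d) 𝓘(ℝ, Coord d) (extChartAt 𝓘(ℝ, Coord d) c) y = toChart c y := by
  have h1 : MDifferentiableAt 𝓘(ℝ, Coord d) 𝓘(ℝ, Coord d) (extChartAt 𝓘(ℝ, Coord d) c) y :=
    mdifferentiableAt_extChartAt (by simpa using hy)
  rw [h1.mfderiv, toChart, tangentCoordChange_def]
  rfl

lemma chartCovector_eq {c : M} {y : Coord d} (hy : y ∈ chartDomain d c) (p : Coord d) :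
    chartCovector c y p = ⟨chartPoint c y, (innerSL ℝ p).comp (toChart c (chartPoint c y))⟩ := by
  rw [chartCovector, mfderiv_extChartAt_eq (chartPoint_mem hy)]

lemma chartVector_eq {c : M} {y : Coord d} (hy : y ∈ chartDomain d c) (α : Fin d) :
    chartVector c y α = fromChart c (chartPoint c y) (stdVec α) := by
  have h1 : MDifferentiableAt 𝓘(ℝ, Coord d) 𝓘(ℝ, Coord d) (extChartAt 𝓘(ℝ, Coord d) c).symm y :=
    ((contMDiffOn_extChartAt_symm (n := ∞) c).contMDiffAt
      ((isOpen_chartDomain c).mem_nhds hy)).mdifferentiableAt (by norm_num)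
  have h2 : mfderiv 𝓘(ℝ, Coord d) 𝓘(ℝ, Coord d) (extChartAt 𝓘(ℝ, Coord d) c).symm y =
      fromChart c (chartPoint c y) := by
    rw [h1.mfderiv, fromChart, tangentCoordChange_def, chartPoint,
      (extChartAt 𝓘(ℝ, Coord d) c).right_inv hy]
    rfl
  rw [chartVector, h2]
  rfl

end Charts

/-! ### Smoothness of the coordinate maps into the tangent and cotangent bundles -/

section ChartSmoothness

variable {d : ℕ} {M : Type*} [TopologicalSpace M] [ChartedSpace (Coord d) M]
  [IsManifold 𝓘(ℝ, Coord d) ∞ M]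

lemma contMDiffOn_chartPoint (c : M) :
    ContMDiffOn 𝓘(ℝ, Coord d) 𝓘(ℝ, Coord d) ∞ (chartPoint c) (chartDomain d c) :=
  contMDiffOn_extChartAt_symm c

/-- The coordinate vector fields are smooth. -/
lemma contMDiffOn_fromChart (c : M) (w : Coord d) :
    ContMDiffOn 𝓘(ℝ, Coord d) (𝓘(ℝ, Coord d).prod 𝓘(ℝ, Coord d)) ∞
      (fun y => TotalSpace.mk' (Coord d) (E := (TangentSpace 𝓘(ℝ, Coord d) : M → Type _))
        (chartPoint c y) (fromChart c (chartPoint c y) w)) (chartDomain d c) := by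
  rw [(trivializationAt (Coord d) (TangentSpace 𝓘(ℝ, Coord d)) c).contMDiffOn_iff]
  · refine ⟨contMDiffOn_chartPoint c, contMDiffOn_const (c := w) |>.congr fun y hy => ?_⟩
    rw [TangentBundle.trivializationAt_apply]
    exact toChart_fromChart (chartPoint_mem hy) w
  · intro y hy
    rw [TangentBundle.trivializationAt_source]
    simpa using chartPoint_mem hy

/-- `(y, p) ↦ ∑ p_α dx^α` is smooth. -/
lemma contMDiffOn_chartCovector (c : M) :
    ContMDiffOn (𝓘(ℝ, Coord d × Coord d)) (cotangentModel d) ∞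
      (fun x : Coord d × Coord d => chartCovector c x.1 x.2) (chartDomain d c ×ˢ univ) := by
  rw [(trivializationAt (Coord d →L[ℝ] ℝ)
    (fun y : M => TangentSpace 𝓘(ℝ, Coord d) y →L[ℝ] ℝ) c).contMDiffOn_iff]
  · refine ⟨(contMDiffOn_chartPoint c).comp contDiff_fst.contMDiff.contMDiffOn fun x hx => hx.1, ?_⟩
    have h1 : ContMDiffOn 𝓘(ℝ, Coord d × Coord d) 𝓘(ℝ, Coord d →L[ℝ] ℝ) ∞
        (fun x : Coord d × Coord d => innerSL ℝ x.2) (chartDomain d c ×ˢ univ) :=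
      ((innerSL ℝ).contDiff.comp contDiff_snd).contMDiff.contMDiffOn
    refine h1.congr fun x hx => ?_
    -- The trivialization at `c` composes the covector with the inverse of the chart derivative,
    -- which leaves `innerSL ℝ p`.
    rw [hom_trivializationAt_apply, chartCovector_eq hx.1]
    have h2 : chartPoint c x.1 ∈ (chartAt (Coord d) c).source := by
      simpa using chartPoint_mem hx.1
    refine ContinuousLinearMap.ext fun v => ?_
    simp only [ContinuousLinearMap.inCoordinates]
    rw [TangentBundle.symmL_trivializationAt_eq_core h2]
    have := toChart_fromChart (chartPoint_mem hx.1) v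
    refine Eq.trans ?_ (congrArg (innerSL ℝ x.2) this)
    change (Bundle.Trivial.trivialization M ℝ).continuousLinearMapAt ℝ (chartPoint c x.1) _ = _
    rw [Bundle.Trivial.continuousLinearMapAt_trivialization]
    rfl
  · intro x hx
    rw [hom_trivializationAt_source]
    refine ⟨?_, mem_univ _⟩
    have h2 := chartPoint_mem hx.1
    rw [extChartAt_source] at h2
    exact h2

end ChartSmoothness

/-! ### The metric, the density and the length of covectors in a chart -/

section ChartMetric

variable {d : ℕ}

/-- The matrix of a linear map. -/
def mat (L : Coord d →L[ℝ] Coord d) : Matrix (Fin d) (Fin d) ℝ :=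
  Matrix.of fun i j => L (stdVec j) i

lemma mat_eq_toMatrix (L : Coord d →L[ℝ] Coord d) :
    mat L = LinearMap.toMatrix (EuclideanSpace.basisFun (Fin d) ℝ).toBasis
      (EuclideanSpace.basisFun (Fin d) ℝ).toBasis (L : Coord d →ₗ[ℝ] Coord d) := by
  ext i j
  simp [mat, LinearMap.toMatrix_apply, stdVec]

lemma det_mat (L : Coord d →L[ℝ] Coord d) : (mat L).det = LinearMap.det (L : Coord d →ₗ[ℝ] Coord d) := by
  rw [mat_eq_toMatrix, LinearMap.det_toMatrix]

lemma mat_mul_mat_eq_one {L L' : Coord d →L[ℝ] Coord d} (h : ∀ v, L (L' v) = v) :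
    mat L * mat L' = 1 := by
  rw [mat_eq_toMatrix, mat_eq_toMatrix, ← LinearMap.toMatrix_comp]
  have : (L : Coord d →ₗ[ℝ] Coord d) ∘ₗ (L' : Coord d →ₗ[ℝ] Coord d) = LinearMap.id :=
    LinearMap.ext h
  rw [this, LinearMap.toMatrix_id]

lemma sum_apply_smul_stdVec (L : Coord d →L[ℝ] Coord d) (ν : Fin d) :
    ∑ b, mat L b ν • (stdVec b : Coord d) = L (stdVec ν) :=
  sum_smul_stdVec (L (stdVec ν))

lemma bilin_sum_sum (B : Coord d →L[ℝ] Coord d →L[ℝ] ℝ) (x y : Fin d → ℝ) :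
    B (∑ a, x a • (stdVec a : Coord d)) (∑ b, y b • (stdVec b : Coord d)) =
      ∑ a, ∑ b, x a * y b * B (stdVec a) (stdVec b) := by
  simp only [map_sum, map_smul, sum_apply, smul_apply, smul_eq_mul, Finset.mul_sum]
  rw [Finset.sum_comm]
  exact Finset.sum_congr rfl fun a _ => Finset.sum_congr rfl fun b _ => by ring

/-- The matrix of a bilinear form after a linear change of coordinates. -/
lemma bilin_comp (B : Coord d →L[ℝ] Coord d →L[ℝ] ℝ) (L : Coord d →L[ℝ] Coord d) :
    (Matrix.of fun μ ν => B (L (stdVec μ)) (L (stdVec ν))) =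
      (mat L).transpose * (Matrix.of fun μ ν => B (stdVec μ) (stdVec ν)) * mat L := by
  ext μ ν
  rw [Matrix.of_apply, ← sum_apply_smul_stdVec, ← sum_apply_smul_stdVec, bilin_sum_sum]
  simp only [Matrix.mul_apply, Matrix.transpose_apply, Matrix.of_apply, Finset.sum_mul]
  rw [Finset.sum_comm]
  exact Finset.sum_congr rfl fun a _ => Finset.sum_congr rfl fun b _ => by ring

variable {M : Type*} [TopologicalSpace M] [ChartedSpace (Coord d) M]
  [IsManifold 𝓘(ℝ, Coord d) ∞ M]

/-- The metric tensor at `y`, as a bilinear form on `ℝ^d`. -/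
def metricAt (g : RiemMetric d M) (y : M) : Coord d →L[ℝ] Coord d →L[ℝ] ℝ := g.inner y

/-- The matrix `g_{μν}` in the chart at `c`. -/
def chartGram (g : RiemMetric d M) (c : M) (y : Coord d) : Matrix (Fin d) (Fin d) ℝ :=
  Matrix.of fun μ ν => metricAt g (chartPoint c y) (fromChart c (chartPoint c y) (stdVec μ))
    (fromChart c (chartPoint c y) (stdVec ν))

lemma posDef_metric (g : RiemMetric d M) (y : M) {L : Coord d →L[ℝ] Coord d}
    (hL : Function.Injective L) :
    (Matrix.of fun μ ν => metricAt g y (L (stdVec μ)) (L (stdVec ν))).PosDef := by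
  refine Matrix.PosDef.of_dotProduct_mulVec_pos ?_ fun x hx => ?_
  · ext μ ν
    simp only [Matrix.conjTranspose_apply, Matrix.of_apply, star_trivial]
    exact g.symm y _ _
  · set v : Coord d := ∑ a, x a • stdVec a with hv
    have hvx : ∀ a, v a = x a := fun a => by
      simp [hv, stdVec, Finset.sum_apply, Pi.single_apply]
    have hv0 : L v ≠ 0 := by
      intro h0
      refine hx (funext fun a => ?_)
      rw [← hvx a, hL (h0.trans (map_zero L).symm)]
      rfl
    have h1 : metricAt g y (L v) (L v) = star x ⬝ᵥ
        (Matrix.of fun μ ν => metricAt g y (L (stdVec μ)) (L (stdVec ν))).mulVec x := by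
      rw [hv]
      simp only [map_sum, map_smul, sum_apply, smul_apply, smul_eq_mul, Matrix.mulVec, dotProduct,
        Matrix.of_apply, Finset.mul_sum, star_trivial]
      rw [Finset.sum_comm]
      exact Finset.sum_congr rfl fun a _ => Finset.sum_congr rfl fun b _ => by ring
    rw [← h1]
    exact g.pos y (L v) hv0

lemma posDef_gram (g : RiemMetric d M) (y : M) : (gram g y).PosDef :=
  posDef_metric g y (L := ContinuousLinearMap.id ℝ _) Function.injective_id

variable {c : M} {y : Coord d}

lemma posDef_chartGram (g : RiemMetric d M) (hy : y ∈ chartDomain d c) :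
    (chartGram g c y).PosDef :=
  posDef_metric g _ (Function.LeftInverse.injective (g := toChart c (chartPoint c y))
    fun v => toChart_fromChart (chartPoint_mem hy) v)

lemma chartGram_eq (g : RiemMetric d M) (c : M) (y : Coord d) :
    chartGram g c y = (mat (fromChart c (chartPoint c y))).transpose * gram g (chartPoint c y) *
      mat (fromChart c (chartPoint c y)) :=
  bilin_comp _ _

lemma rho_eq (g : RiemMetric d M) (hy : y ∈ chartDomain d c) :
    rho g c y = Real.sqrt (chartGram g c y).det := by
  rw [rho]
  simp_rw [chartVector_eq hy]
  rfl

lemma rho_pos (g : RiemMetric d M) (hy : y ∈ chartDomain d c) : 0 < rho g c y := by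
  rw [rho_eq g hy]
  exact Real.sqrt_pos.2 (posDef_chartGram g hy).det_pos

/-- The chart density is separated into a Jacobian and a factor depending only on the point, so that
Jacobians can be cancelled under changes of chart and in the fibres. -/
lemma rho_eq_abs_det (g : RiemMetric d M) (hy : y ∈ chartDomain d c) :
    rho g c y = |(fromChart (d := d) c (chartPoint c y)).det| *
      Real.sqrt (gram g (chartPoint c y)).det := by
  rw [rho_eq g hy, chartGram_eq, Matrix.det_mul, Matrix.det_mul, Matrix.det_transpose, det_mat,
    ← Real.sqrt_sq_eq_abs, ← Real.sqrt_mul (sq_nonneg _)]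
  congr 1
  rw [ContinuousLinearMap.det]
  ring

/-- Invariance of the length: components of covectors change by the transposed matrix, the inverse
Gram matrix by the inverse congruence. -/
lemma covectorLength_chartCovector (g : RiemMetric d M) (hy : y ∈ chartDomain d c) (p : Coord d) :
    covectorLength g (chartCovector c y p) =
      Real.sqrt (dotProduct p ((chartGram g c y)⁻¹.mulVec p)) := by
  have hAB := mat_mul_mat_eq_one fun v => toChart_fromChart (chartPoint_mem hy) v
  have hBA := mat_mul_mat_eq_one fun v => fromChart_toChart (chartPoint_mem hy) v
  rw [chartCovector_eq hy, covectorLength]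
  have h1 : (fun α => ((innerSL ℝ p).comp (toChart c (chartPoint c y))) (stdVec α)) =
      (mat (toChart c (chartPoint c y))).transpose.mulVec p := by
    funext α
    simp [Matrix.mulVec, dotProduct, mat, PiLp.inner_apply]
  simp only
  change Real.sqrt (dotProduct (fun α => ((innerSL ℝ p).comp (toChart c (chartPoint c y)))
    (stdVec α)) ((gram g (chartPoint c y))⁻¹.mulVec fun α =>
      ((innerSL ℝ p).comp (toChart c (chartPoint c y))) (stdVec α))) = _
  rw [h1, chartGram_eq, Matrix.mul_inv_rev, Matrix.mul_inv_rev, Matrix.inv_eq_left_inv hAB,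
    ← Matrix.transpose_nonsing_inv, Matrix.inv_eq_left_inv hAB, Matrix.mulVec_mulVec]
  congr 1
  rw [Matrix.dotProduct_mulVec, Matrix.dotProduct_mulVec, Matrix.vecMul_mulVec,
    Matrix.transpose_transpose]

end ChartMetric

/-! ### Smoothness of the metric quantities in a chart -/

section ChartMetricSmoothness

variable {d : ℕ} {M : Type*} [TopologicalSpace M] [ChartedSpace (Coord d) M]
  [IsManifold 𝓘(ℝ, Coord d) ∞ M]

lemma contDiffOn_chartGram (g : RiemMetric d M) (c : M) (μ ν : Fin d) :
    ContDiffOn ℝ ∞ (fun y => chartGram g c y μ ν) (chartDomain d c) := by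
  have h1 : ContMDiffOn 𝓘(ℝ, Coord d) (𝓘(ℝ, Coord d).prod 𝓘(ℝ)) ∞
      (fun y : Coord d => TotalSpace.mk' ℝ (E := Bundle.Trivial M ℝ) (chartPoint c y)
        (g.inner (chartPoint c y) (fromChart c (chartPoint c y) (stdVec μ))
          (fromChart c (chartPoint c y) (stdVec ν)))) (chartDomain d c) := by
    apply ContMDiffOn.clm_bundle_apply₂ (F₁ := Coord d) (F₂ := Coord d)
    · exact g.contMDiff.comp_contMDiffOn (contMDiffOn_chartPoint c)
    · exact contMDiffOn_fromChart c (stdVec μ)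
    · exact contMDiffOn_fromChart c (stdVec ν)
  refine ContMDiffOn.contDiffOn fun y hy => ?_
  have h2 := h1 y hy
  rw [contMDiffWithinAt_totalSpace] at h2
  exact h2.2

lemma contDiffOn_det_chartGram (g : RiemMetric d M) (c : M) :
    ContDiffOn ℝ ∞ (fun y => (chartGram g c y).det) (chartDomain d c) :=
  contDiff_det.comp_contDiffOn (contDiffOn_pi.2 fun μ => contDiffOn_pi.2 fun ν =>
    contDiffOn_chartGram g c μ ν)

lemma contDiffOn_rho (g : RiemMetric d M) (c : M) :
    ContDiffOn ℝ ∞ (rho g c) (chartDomain d c) :=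
  ((contDiffOn_det_chartGram g c).sqrt fun _ hy => (posDef_chartGram g hy).det_pos.ne').congr
    fun _ hy => rho_eq g hy

lemma contDiffOn_inv_chartGram (g : RiemMetric d M) (c : M) (μ ν : Fin d) :
    ContDiffOn ℝ ∞ (fun y => (chartGram g c y)⁻¹ μ ν) (chartDomain d c) := by
  have h1 : ContDiffOn ℝ ∞ (fun y => (chartGram g c y).adjugate μ ν) (chartDomain d c) := by
    -- Cofactors are determinants with one row replaced by a basis vector, so smoothness reduces to
    -- that of the determinant.
    have h2 : ∀ y, (chartGram g c y).adjugate μ ν = (Matrix.of fun α β => if α = ν then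
        (Pi.single μ 1 : Fin d → ℝ) β else chartGram g c y α β).det := fun y => by
      rw [Matrix.adjugate_apply]
      congr 1
      ext α β
      simp [Matrix.updateRow_apply]
    simp_rw [h2]
    refine contDiff_det.comp_contDiffOn (contDiffOn_pi.2 fun α => contDiffOn_pi.2 fun β => ?_)
    by_cases hα : α = ν
    · simp only [hα, if_true]
      exact contDiffOn_const
    · simp only [hα, if_false]
      exact contDiffOn_chartGram g c α β
  have h2 : ContDiffOn ℝ ∞ (fun y => ((chartGram g c y).det)⁻¹) (chartDomain d c) :=
    (contDiffOn_det_chartGram g c).inv fun _ hy => (posDef_chartGram g hy).det_pos.ne'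
  refine (h2.mul h1).congr fun y _ => ?_
  rw [Matrix.inv_def, Matrix.smul_apply, Ring.inverse_eq_inv', smul_eq_mul]

/-- The square of the length of a covector in coordinates. -/
def lengthSq (g : RiemMetric d M) (c : M) (x : Coord d × Coord d) : ℝ :=
  ∑ μ, x.2 μ * ∑ ν, (chartGram g c x.1)⁻¹ μ ν * x.2 ν

lemma covectorLength_eq_sqrt (g : RiemMetric d M) {c : M} {y : Coord d} (hy : y ∈ chartDomain d c)
    (p : Coord d) : covectorLength g (chartCovector c y p) = Real.sqrt (lengthSq g c (y, p)) :=
  covectorLength_chartCovector g hy p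

lemma contDiffOn_lengthSq (g : RiemMetric d M) (c : M) :
    ContDiffOn ℝ ∞ (lengthSq g c) (chartDomain d c ×ˢ univ) := by
  have h1 : ∀ μ : Fin d, ContDiff ℝ ∞ fun x : Coord d × Coord d => x.2 μ := fun μ => by fun_prop
  refine ContDiffOn.sum fun μ _ => (h1 μ).contDiffOn.mul (ContDiffOn.sum fun ν _ => ?_)
  exact ((contDiffOn_inv_chartGram g c μ ν).comp contDiff_fst.contDiffOn fun x hx => hx.1).mul
    (h1 ν).contDiffOn

lemma lengthSq_pos (g : RiemMetric d M) {c : M} {y : Coord d} (hy : y ∈ chartDomain d c)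
    {p : Coord d} (hp : p ≠ 0) : 0 < lengthSq g c (y, p) := by
  have h1 : (p : Fin d → ℝ) ≠ 0 := fun h => hp (by ext i; exact congrFun h i)
  have := (posDef_chartGram g hy).inv.dotProduct_mulVec_pos h1
  simpa [lengthSq, dotProduct, Matrix.mulVec] using this

lemma lengthSq_smul (g : RiemMetric d M) (c : M) (y : Coord d) (t : ℝ) (p : Coord d) :
    lengthSq g c (y, t • p) = t ^ 2 * lengthSq g c (y, p) := by
  simp only [lengthSq, PiLp.smul_apply, smul_eq_mul, Finset.mul_sum]
  exact Finset.sum_congr rfl fun _ _ => Finset.sum_congr rfl fun _ _ => by ring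

lemma covectorLength_smul (g : RiemMetric d M) {c : M} {y : Coord d} (hy : y ∈ chartDomain d c)
    {t : ℝ} (ht : 0 ≤ t) (p : Coord d) : covectorLength g (chartCovector c y (t • p)) =
      t * covectorLength g (chartCovector c y p) := by
  rw [covectorLength_eq_sqrt g hy, covectorLength_eq_sqrt g hy, lengthSq_smul,
    Real.sqrt_mul (sq_nonneg t), Real.sqrt_sq ht]

/-- The length of covectors in coordinates centred at `x₀`. -/
def centredLength (g : RiemMetric d M) (c : M) (x₀ : Coord d) (x : Coord d × Coord d) : ℝ :=
  covectorLength g (chartCovector c (x₀ + x.1) x.2)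

variable {c : M} {x₀ : Coord d} {r : ℝ}

lemma continuousOn_centredLength (g : RiemMetric d M)
    (hr : ∀ z ∈ Metric.ball (0 : Coord d) r, x₀ + z ∈ chartDomain d c) :
    ContinuousOn (centredLength g c x₀) (Metric.ball 0 r ×ˢ univ) := by
  have h1 : ContinuousOn (fun x : Coord d × Coord d => Real.sqrt (lengthSq g c (x₀ + x.1, x.2)))
      (Metric.ball 0 r ×ˢ univ) :=
    Real.continuous_sqrt.comp_continuousOn ((contDiffOn_lengthSq g c).continuousOn.comp
      (f := fun x : Coord d × Coord d => (x₀ + x.1, x.2)) (by fun_prop)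
      fun x hx => ⟨hr _ hx.1, mem_univ _⟩)
  exact h1.congr fun x hx => covectorLength_eq_sqrt g (hr _ hx.1) _

lemma isConicLength_centredLength (g : RiemMetric d M)
    (hr : ∀ z ∈ Metric.ball (0 : Coord d) r, x₀ + z ∈ chartDomain d c) :
    IsConicLength r (centredLength g c x₀) where
  smooth := by
    have h1 : ContDiffOn ℝ ∞ (fun x : Coord d × Coord d => lengthSq g c (x₀ + x.1, x.2))
        (conicDomain (Coord d) r) := (contDiffOn_lengthSq g c).comp
      (f := fun x : Coord d × Coord d => (x₀ + x.1, x.2)) (by fun_prop)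
      fun x hx => ⟨hr _ hx.1, mem_univ _⟩
    exact (h1.sqrt fun x hx => (lengthSq_pos g (hr _ hx.1) hx.2).ne').congr
      fun x hx => covectorLength_eq_sqrt g (hr _ hx.1) _
  homogeneous z hz p _ t ht := covectorLength_smul g (hr z hz) ht.le p
  pos z hz p hp := by
    rw [centredLength, covectorLength_eq_sqrt g (hr z hz)]
    exact Real.sqrt_pos.2 (lengthSq_pos g (hr z hz) hp)

lemma centredLength_zero (g : RiemMetric d M) {z : Coord d} (hz : x₀ + z ∈ chartDomain d c) :
    centredLength g c x₀ (z, 0) = 0 := by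
  have := covectorLength_smul g hz le_rfl 0
  simpa [centredLength] using this

/-! ### Integration over the fibres -/

lemma det_adjoint (A : Coord d →L[ℝ] Coord d) :
    (ContinuousLinearMap.adjoint A).det = A.det := by
  have : mat (ContinuousLinearMap.adjoint A) = (mat A).transpose := by
    ext i j
    rw [Matrix.transpose_apply, mat, mat, Matrix.of_apply, Matrix.of_apply, ← inner_stdVec,
      ContinuousLinearMap.adjoint_inner_left, real_inner_comm, inner_stdVec]
  rw [ContinuousLinearMap.det, ContinuousLinearMap.det, ← det_mat, ← det_mat, this,
    Matrix.det_transpose]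

lemma integral_comp_adjoint {A : Coord d →L[ℝ] Coord d} (hA : A.det ≠ 0) (G : Coord d → ℂ) :
    ∫ p, G p = ((|A.det| : ℝ) : ℂ) * ∫ p, G (ContinuousLinearMap.adjoint A p) := by
  have hinj : Function.Bijective (ContinuousLinearMap.adjoint A) := by
    have h1 : IsUnit (LinearMap.det (ContinuousLinearMap.adjoint A : Coord d →ₗ[ℝ] Coord d)) := by
      rw [isUnit_iff_ne_zero]
      change (ContinuousLinearMap.adjoint A).det ≠ 0
      rwa [det_adjoint]
    have h2 := (LinearMap.isUnit_iff_isUnit_det _).2 h1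
    exact (Module.End.isUnit_iff _).1 h2
  have h3 := integral_image_eq_integral_abs_det_fderiv_smul (volume : Measure (Coord d))
    MeasurableSet.univ (fun x _ => (ContinuousLinearMap.adjoint A).hasFDerivAt.hasFDerivWithinAt)
    (hinj.1.injOn) G
  rw [image_univ, hinj.2.range_eq, setIntegral_univ, setIntegral_univ, det_adjoint] at h3
  rw [h3, ← integral_const_mul]
  simp only [Complex.real_smul]

lemma det_mul_det {y : M} (hy : y ∈ (extChartAt 𝓘(ℝ, Coord d) c).source) :
    (fromChart (d := d) c y).det * (toChart (d := d) c y).det = 1 := by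
  have := congrArg Matrix.det (mat_mul_mat_eq_one fun v : Coord d => fromChart_toChart hy v)
  rwa [Matrix.det_mul, det_mat, det_mat, Matrix.det_one] at this

/-- The components of a covector in the two coordinate systems differ by the adjoint of `toChart`,
and its Jacobian cancels the one in `rho`. Thus `ρ dy` times `dη/ρ` is the canonical `dy dη` of the
chart. -/
lemma rho_mul_fibreIntegral (g : RiemMetric d M) {y : Coord d} (hy : y ∈ chartDomain d c)
    (F : Cotangent d M → ℂ) :
    (rho g c y : ℂ) * fibreIntegral g (chartPoint c y) F =
      (((2 * Real.pi) ^ d : ℝ) : ℂ)⁻¹ * ∫ p, F (chartCovector c y p) := by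
  have hdet := det_mul_det (chartPoint_mem hy)
  have hA : (toChart (d := d) c (chartPoint c y)).det ≠ 0 := fun h => by simp [h] at hdet
  have h1 := integral_comp_adjoint hA fun p => F ⟨chartPoint c y, (innerSL ℝ p : Coord d →L[ℝ] ℝ)⟩
  have h2 : ∀ p : Coord d, (innerSL ℝ (ContinuousLinearMap.adjoint
      (toChart (d := d) c (chartPoint c y)) p) : Coord d →L[ℝ] ℝ) =
      (innerSL ℝ p).comp (toChart c (chartPoint c y)) := fun p => by
    ext v
    simp [ContinuousLinearMap.adjoint_inner_left]
  have h4 : (fun p : Coord d => F ⟨chartPoint c y, (innerSL ℝ (ContinuousLinearMap.adjoint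
      (toChart (d := d) c (chartPoint c y)) p) : Coord d →L[ℝ] ℝ)⟩) =
      fun p => F (chartCovector c y p) := by
    funext p
    rw [chartCovector_eq hy]
    exact congrArg (fun L : Coord d →L[ℝ] ℝ => F ⟨chartPoint c y, L⟩) (h2 p)
  have h1 : ∫ p : Coord d, F ⟨chartPoint c y, (innerSL ℝ p : Coord d →L[ℝ] ℝ)⟩ =
      ((|(toChart (d := d) c (chartPoint c y)).det| : ℝ) : ℂ) *
        ∫ p, F (chartCovector c y p) := by
    rw [← h4]
    exact h1
  have hs : 0 < Real.sqrt (gram g (chartPoint c y)).det := Real.sqrt_pos.2 (posDef_gram g _).det_pos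
  have h3 : |(fromChart (d := d) c (chartPoint c y)).det| * |(toChart (d := d) c (chartPoint c y)).det| = 1 := by
    rw [← abs_mul, hdet, abs_one]
  rw [fibreIntegral, h1, rho_eq_abs_det g hy]
  have hs' : (Real.sqrt (gram g (chartPoint c y)).det : ℂ) ≠ 0 := by exact_mod_cast hs.ne'
  have h3' : ((|(fromChart (d := d) c (chartPoint c y)).det| : ℝ) : ℂ) *
      ((|(toChart (d := d) c (chartPoint c y)).det| : ℝ) : ℂ) = 1 := by exact_mod_cast h3
  push_cast at h3' ⊢
  rw [mul_inv]
  have := mul_inv_cancel₀ hs'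
  linear_combination ((2 * (Real.pi : ℂ)) ^ d)⁻¹ * (∫ p, F (chartCovector c y p)) *
    (Real.sqrt (gram g (chartPoint c y)).det * (Real.sqrt (gram g (chartPoint c y)).det : ℂ)⁻¹ * h3'
      + this)

end ChartMetricSmoothness

/-! ### The Riemannian measure in a chart -/

section RiemannianMeasure

variable {d : ℕ} {M : Type*} [TopologicalSpace M] [ChartedSpace (Coord d) M]
  [IsManifold 𝓘(ℝ, Coord d) ∞ M] [MeasurableSpace M] [BorelSpace M]

/-- The measure `ρ(y) dy` of the chart at `c`. -/
def chartMeasure (g : RiemMetric d M) (c : M) : Measure M :=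
  Measure.map (chartPoint c)
    ((volume.restrict (chartDomain d c)).withDensity fun y => ENNReal.ofReal (rho g c y))

lemma continuousOn_chartPoint (c : M) : ContinuousOn (chartPoint (d := d) c) (chartDomain d c) :=
  continuousOn_extChartAt_symm c

lemma aemeasurable_chartPoint (g : RiemMetric d M) (c : M) :
    AEMeasurable (chartPoint (d := d) c)
      ((volume.restrict (chartDomain d c)).withDensity fun y => ENNReal.ofReal (rho g c y)) :=
  ((continuousOn_chartPoint c).aemeasurable (isOpen_chartDomain c).measurableSet).mono_ac
    (withDensity_absolutelyContinuous _ _)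

lemma chartMeasure_apply (g : RiemMetric d M) (c : M) {s : Set M} (hs : MeasurableSet s) :
    chartMeasure g c s =
      ∫⁻ y in chartPoint c ⁻¹' s ∩ chartDomain d c, ENNReal.ofReal (rho g c y) := by
  rw [chartMeasure, Measure.map_apply_of_aemeasurable (aemeasurable_chartPoint g c) hs,
    withDensity_apply', Measure.restrict_restrict' (isOpen_chartDomain c).measurableSet]

lemma measurableEmbedding_chartPoint (c : M) :
    MeasurableEmbedding ((chartDomain d c).domRestrict (chartPoint (d := d) c)) := by
  have h1 := ((chartAt (Coord d) c).symm.isOpenEmbedding_restrict).measurableEmbedding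
  have h2 : chartDomain d c = (chartAt (Coord d) c).symm.source := by
    simp [chartDomain, mfld_simps]
  have h3 : chartPoint (d := d) c = (chartAt (Coord d) c).symm := by
    funext y
    simp [chartPoint, mfld_simps]
  rw [h2, h3]
  exact h1

lemma measurableSet_chartPoint_preimage (c : M) {s : Set M} (hs : MeasurableSet s) :
    MeasurableSet (chartPoint (d := d) c ⁻¹' s ∩ chartDomain d c) := by
  have h1 := ((isOpen_chartDomain (d := d) c).measurableSet).subtype_image
    ((measurableEmbedding_chartPoint (d := d) c).measurable hs)
  convert h1 using 1
  ext y
  simp [and_comm]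

/-- Two charts give the same measure on the common part of their domains. -/
lemma chartMeasure_eq_of_subset (g : RiemMetric d M) {c c' : M} {s : Set M}
    (hs : MeasurableSet s) (hc : s ⊆ (extChartAt 𝓘(ℝ, Coord d) c).source)
    (hc' : s ⊆ (extChartAt 𝓘(ℝ, Coord d) c').source) :
    chartMeasure g c s = chartMeasure g c' s := by
  rw [chartMeasure_apply g c hs, chartMeasure_apply g c' hs]
  have himage : chartPoint c ⁻¹' s ∩ chartDomain d c =
      (extChartAt 𝓘(ℝ, Coord d) c ∘ (extChartAt 𝓘(ℝ, Coord d) c').symm) ''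
        (chartPoint c' ⁻¹' s ∩ chartDomain d c') := by
    ext y
    constructor
    · rintro ⟨hys, hy⟩
      have hm : chartPoint c' (extChartAt 𝓘(ℝ, Coord d) c' (chartPoint c y)) = chartPoint c y :=
        (extChartAt 𝓘(ℝ, Coord d) c').left_inv (hc' hys)
      refine ⟨extChartAt 𝓘(ℝ, Coord d) c' (chartPoint c y), ⟨?_, ?_⟩, ?_⟩
      · rw [mem_preimage, hm]; exact hys
      · exact (extChartAt 𝓘(ℝ, Coord d) c').map_source (hc' hys)
      · exact (congrArg (extChartAt 𝓘(ℝ, Coord d) c) hm).trans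
          ((extChartAt 𝓘(ℝ, Coord d) c).right_inv hy)
    · rintro ⟨z, ⟨hzs, hz⟩, rfl⟩
      have hm : chartPoint c (extChartAt 𝓘(ℝ, Coord d) c (chartPoint c' z)) = chartPoint c' z :=
        (extChartAt 𝓘(ℝ, Coord d) c).left_inv (hc hzs)
      refine ⟨?_, (extChartAt 𝓘(ℝ, Coord d) c).map_source (hc hzs)⟩
      rw [mem_preimage]
      exact hm.symm ▸ hzs
  have hinj : InjOn (extChartAt 𝓘(ℝ, Coord d) c ∘ (extChartAt 𝓘(ℝ, Coord d) c').symm)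
      (chartPoint c' ⁻¹' s ∩ chartDomain d c') := by
    refine ((extChartAt 𝓘(ℝ, Coord d) c).injOn.comp
      (((extChartAt 𝓘(ℝ, Coord d) c').symm.injOn).mono fun y hy => hy.2) fun y hy => hc hy.1)
  have hderiv : ∀ y ∈ chartPoint c' ⁻¹' s ∩ chartDomain d c',
      HasFDerivWithinAt (extChartAt 𝓘(ℝ, Coord d) c ∘ (extChartAt 𝓘(ℝ, Coord d) c').symm)
        (tangentCoordChange 𝓘(ℝ, Coord d) c' c (chartPoint c' y))
        (chartPoint c' ⁻¹' s ∩ chartDomain d c') y := by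
    intro y hy
    have h1 := hasFDerivWithinAt_tangentCoordChange (I := 𝓘(ℝ, Coord d)) (x := c') (y := c)
      (z := chartPoint c' y) ⟨hc' hy.1, hc hy.1⟩
    rw [chartPoint, (extChartAt 𝓘(ℝ, Coord d) c').right_inv hy.2] at h1
    exact h1.mono fun z _ => by simp
  rw [himage, lintegral_image_eq_lintegral_abs_det_fderiv_mul volume
    (measurableSet_chartPoint_preimage c' hs) hderiv hinj]
  refine setLIntegral_congr_fun (measurableSet_chartPoint_preimage c' hs) fun y hy => ?_
  have hm : chartPoint c (extChartAt 𝓘(ℝ, Coord d) c (chartPoint c' y)) = chartPoint c' y :=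
    (extChartAt 𝓘(ℝ, Coord d) c).left_inv (hc hy.1)
  have hmem : extChartAt 𝓘(ℝ, Coord d) c (chartPoint c' y) ∈ chartDomain d c :=
    (extChartAt 𝓘(ℝ, Coord d) c).map_source (hc hy.1)
  -- The chain rule for the charts: the Jacobian of the change of charts is exactly the quotient of
  -- the two densities.
  have h3 : fromChart (d := d) c' (chartPoint c' y) = (fromChart c (chartPoint c' y)).comp
      (tangentCoordChange 𝓘(ℝ, Coord d) c' c (chartPoint c' y)) :=
    ContinuousLinearMap.ext fun v => fromChart_fromChart (hc hy.1) (hc' hy.1) v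
  have h4 : (fromChart (d := d) c' (chartPoint c' y)).det =
      (fromChart (d := d) c (chartPoint c' y)).det *
        (tangentCoordChange 𝓘(ℝ, Coord d) c' c (chartPoint c' y)).det := by
    rw [h3]
    exact LinearMap.det_comp _ _
  change ENNReal.ofReal _ * ENNReal.ofReal (rho g c
    (extChartAt 𝓘(ℝ, Coord d) c (chartPoint c' y))) = _
  rw [← ENNReal.ofReal_mul (abs_nonneg _), rho_eq_abs_det g hmem, rho_eq_abs_det g hy.2, hm, h4,
    abs_mul]
  congr 1
  ring

lemma measurableSet_chartSource (c : M) :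
    MeasurableSet (extChartAt 𝓘(ℝ, Coord d) c).source :=
  (isOpen_extChartAt_source c).measurableSet

lemma chartMeasure_inter_source (g : RiemMetric d M) (c : M) {s : Set M} (hs : MeasurableSet s) :
    chartMeasure g c (s ∩ (extChartAt 𝓘(ℝ, Coord d) c).source) = chartMeasure g c s := by
  rw [chartMeasure_apply g c hs, chartMeasure_apply g c (hs.inter (measurableSet_chartSource c))]
  congr 2
  ext y
  exact ⟨fun h => ⟨h.1.1, h.2⟩, fun h => ⟨⟨h.1, chartPoint_mem h.2⟩, h.2⟩⟩

lemma chartMeasure_restrict_source (g : RiemMetric d M) (c : M) :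
    (chartMeasure g c).restrict (extChartAt 𝓘(ℝ, Coord d) c).source = chartMeasure g c :=
  Measure.ext fun s hs => by
    rw [Measure.restrict_apply hs, chartMeasure_inter_source g c hs]

/-- On the domain of one chart every other chart measure is dominated by the measure of this chart,
with equality on overlaps, so the supremum adds nothing there. -/
lemma riemannianMeasure_restrict (g : RiemMetric d M) (c : M) :
    (riemannianMeasure g).restrict (extChartAt 𝓘(ℝ, Coord d) c).source = chartMeasure g c := by
  have hS := measurableSet_chartSource (d := d) c
  apply le_antisymm
  -- The supremum is compared with a single measure; the summand `⊤` outside the chart makes the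
  -- bound trivial there and disappears on restriction.
  · have h1 : riemannianMeasure g ≤ chartMeasure g c +
        (⊤ : Measure M).restrict (extChartAt 𝓘(ℝ, Coord d) c).sourceᶜ := by
      refine iSup_le fun c' => Measure.le_iff.2 fun s hs => ?_
      change chartMeasure g c' s ≤ _
      rw [← measure_inter_add_sdiff s hS, Measure.add_apply, Measure.restrict_apply hs]
      refine add_le_add ?_ (Measure.le_iff'.1 le_top _)
      have hT := measurableSet_chartSource (d := d) c'
      rw [← chartMeasure_inter_source g c' (hs.inter hS),
        ← chartMeasure_eq_of_subset g ((hs.inter hS).inter hT) (fun y hy => hy.1.2)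
          (fun y hy => hy.2)]
      exact measure_mono fun y hy => hy.1.1
    calc (riemannianMeasure g).restrict (extChartAt 𝓘(ℝ, Coord d) c).source
        ≤ (chartMeasure g c + (⊤ : Measure M).restrict
          (extChartAt 𝓘(ℝ, Coord d) c).sourceᶜ).restrict (extChartAt 𝓘(ℝ, Coord d) c).source :=
          Measure.restrict_mono subset_rfl h1
      _ = chartMeasure g c := by
          rw [Measure.restrict_add, chartMeasure_restrict_source, Measure.restrict_restrict hS,
            inter_compl_self, Measure.restrict_empty, add_zero]
  · rw [← chartMeasure_restrict_source g c]
    exact Measure.restrict_mono subset_rfl (le_iSup (fun c => chartMeasure g c) c)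

/-- Passing through the subtype of the chart domain, on which `chartPoint` is a measurable
embedding, avoids any measurability assumption on `G`. -/
lemma integral_chartMeasure (g : RiemMetric d M) (c : M) (G : M → ℂ) :
    ∫ y, G y ∂(chartMeasure g c) =
      ∫ y in chartDomain d c, (rho g c y : ℂ) * G (chartPoint c y) := by
  have hD : MeasurableSet (chartDomain d c) := (isOpen_chartDomain c).measurableSet
  obtain ⟨ν, hν⟩ : ∃ ν, ν = (volume.restrict (chartDomain d c)).withDensity
    fun y => ENNReal.ofReal (rho g c y) := ⟨_, rfl⟩
  have hνD : ν.restrict (chartDomain d c) = ν := by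
    rw [hν, restrict_withDensity hD, Measure.restrict_restrict hD, inter_self]
  have hemb : MeasurableEmbedding (Subtype.val : chartDomain d c → Coord d) :=
    MeasurableEmbedding.subtype_coe hD
  have hmap : Measure.map Subtype.val (Measure.comap (Subtype.val : chartDomain d c → Coord d) ν) =
      ν := by
    rw [map_comap_subtype_coe hD, hνD]
  have h1 : chartMeasure g c = Measure.map ((chartDomain d c).domRestrict (chartPoint c))
      (Measure.comap (Subtype.val : chartDomain d c → Coord d) ν) := by
    have h2 : AEMeasurable (chartPoint (d := d) c) (Measure.map Subtype.val
        (Measure.comap (Subtype.val : chartDomain d c → Coord d) ν)) := by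
      rw [hmap, hν]; exact aemeasurable_chartPoint g c
    have h3 := AEMeasurable.map_map_of_aemeasurable h2 hemb.measurable.aemeasurable
    rw [hmap] at h3
    rw [chartMeasure, ← hν, h3]
    rfl
  have hrho : AEMeasurable (fun y => ENNReal.ofReal (rho g c y))
      (volume.restrict (chartDomain d c)) :=
    ((contDiffOn_rho g c).continuousOn.aemeasurable hD).ennreal_ofReal
  calc ∫ y, G y ∂(chartMeasure g c)
      = ∫ y : chartDomain d c, G (chartPoint c y.1)
          ∂(Measure.comap (Subtype.val : chartDomain d c → Coord d) ν) := by
        rw [h1, (measurableEmbedding_chartPoint c).integral_map]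
        rfl
    _ = ∫ y, G (chartPoint c y) ∂ν := by
        rw [← hemb.integral_map (fun y => G (chartPoint c y)), hmap]
    _ = ∫ y in chartDomain d c, (rho g c y : ℂ) * G (chartPoint c y) := by
        rw [hν, integral_withDensity_eq_integral_toReal_smul₀ hrho
          (Filter.Eventually.of_forall fun _ => ENNReal.ofReal_lt_top)]
        refine setIntegral_congr_fun hD fun y hy => ?_
        rw [ENNReal.toReal_ofReal (rho_pos g hy).le, Complex.real_smul]

/-- The integral over `M` of a function vanishing outside of a chart. -/
lemma integral_riemannianMeasure (g : RiemMetric d M) (c : M) {G : M → ℂ}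
    (hG : ∀ y ∉ (extChartAt 𝓘(ℝ, Coord d) c).source, G y = 0) :
    ∫ y, G y ∂(riemannianMeasure g) =
      ∫ y in chartDomain d c, (rho g c y : ℂ) * G (chartPoint c y) := by
  rw [← integral_chartMeasure, ← riemannianMeasure_restrict]
  exact (setIntegral_eq_integral_of_forall_compl_eq_zero hG).symm

end RiemannianMeasure

/-! ### Phases in a chart -/

section ChartPhase

variable {d : ℕ} {M : Type*} [TopologicalSpace M] [ChartedSpace (Coord d) M]
  [IsManifold 𝓘(ℝ, Coord d) ∞ M]

lemma chartCovector_mem_puncturedCotangent {c : M} {y : Coord d} (hy : y ∈ chartDomain d c)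
    {p : Coord d} (hp : p ≠ 0) : chartCovector c y p ∈ puncturedCotangent d M := by
  rw [chartCovector_eq hy]
  intro h
  refine hp (inner_self_eq_zero (𝕜 := ℝ).1 ?_)
  have h1 := congrArg (fun L : Coord d →L[ℝ] ℝ => L (fromChart c (chartPoint c y) p)) h
  have h2 := toChart_fromChart (chartPoint_mem hy) p
  change inner ℝ p (toChart c (chartPoint c y) (fromChart c (chartPoint c y) p)) = 0 at h1
  rwa [h2] at h1

lemma scale_chartCovector (c : M) (t : ℝ) (y p : Coord d) :
    scale t (chartCovector c y p) = chartCovector c y (t • p) := by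
  have h : ∀ L : Coord d →L[ℝ] Coord d,
      t • ((innerSL ℝ p).comp L) = (innerSL ℝ (t • p)).comp L := fun L => by
    ext v
    simp
  exact congrArg (fun L : Coord d →L[ℝ] ℝ => (⟨chartPoint c y, L⟩ : Cotangent d M)) (h _)

/-- The phase `φ` in the chart at `c`. -/
def chartPhase (φ : M → Cotangent d M → ℂ) (c : M) (x : Coord d × Coord d × Coord d) : ℂ :=
  φ (chartPoint c x.1) (chartCovector c x.2.1 x.2.2)

lemma contMDiffOn_chart_pair (c : M) :
    ContMDiffOn 𝓘(ℝ, Coord d × Coord d × Coord d) ((𝓘(ℝ, Coord d)).prod (cotangentModel d)) ∞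
      (fun x : Coord d × Coord d × Coord d => (chartPoint c x.1, chartCovector c x.2.1 x.2.2))
      (phaseDomain (chartDomain d c)) := by
  refine ContMDiffOn.prodMk ?_ ?_
  · exact (contMDiffOn_chartPoint c).comp contDiff_fst.contMDiff.contMDiffOn fun x hx => hx.1
  · exact (contMDiffOn_chartCovector c).comp contDiff_snd.contMDiff.contMDiffOn
      fun x hx => ⟨hx.2.1, mem_univ _⟩

theorem IsPhase.isLocalPhase {φ : M → Cotangent d M → ℂ} (hφ : IsPhase φ) (c : M) :
    IsLocalPhase (chartDomain d c) (chartPhase φ c) where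
  isOpen := isOpen_chartDomain c
  smooth := ContMDiffOn.contDiffOn <| hφ.smooth.comp (contMDiffOn_chart_pair c)
    fun x hx => ⟨mem_univ _, chartCovector_mem_puncturedCotangent hx.2.1 hx.2.2⟩
  homogeneous x _ y hy p hp t ht := by
    rw [chartPhase, ← scale_chartCovector]
    exact hφ.homogeneous _ _ (chartCovector_mem_puncturedCotangent hy hp) t ht
  linear_part y hy p hp := by
    have h1 := hφ.linear_part c y hy p hp
    have h2 : ∀ x : Coord d, ∑ α : Fin d, (x α - y α) * p α = inner ℝ (x - y) p := fun x => by
      rw [PiLp.inner_apply]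
      exact Finset.sum_congr rfl fun α _ => by simp [mul_comm]
    simp_rw [h2] at h1
    exact h1
  im_nonneg x _ y hy p hp := hφ.im_nonneg _ _ (chartCovector_mem_puncturedCotangent hy hp)

/-- Iterated partial derivatives agree with directional derivatives of the jointly smooth phase. -/
lemma mixedDet_eq_localDet {φ : M → Cotangent d M → ℂ} (hφ : IsPhase φ) {c : M}
    {x y p : Coord d} (hx : x ∈ chartDomain d c) (hy : y ∈ chartDomain d c) (hp : p ≠ 0) :
    mixedDet φ c c x y p = localDet (chartPhase φ c) (x, y, p) := by
  have h := hφ.isLocalPhase c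
  unfold mixedDet localDet
  congr 2
  funext α β
  have hf := contDiffOn_dirDeriv (isOpen_phaseDomain h.isOpen) h.smooth (0, 0, stdVec β)
  have h1 : ∀ x' ∈ chartDomain d c,
      fderiv ℝ (fun p' : Coord d => φ (chartPoint c x') (chartCovector c y p')) p (stdVec β) =
      dirDeriv (0, 0, stdVec β) (chartPhase φ c) (x', y, p) := by
    intro x' hx'
    have hA : HasFDerivAt (fun p' : Coord d => (x', y, p'))
        ((0 : Coord d →L[ℝ] Coord d).prod ((0 : Coord d →L[ℝ] Coord d).prod
          (ContinuousLinearMap.id ℝ (Coord d)))) p :=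
      (hasFDerivAt_const x' p).prodMk ((hasFDerivAt_const y p).prodMk (hasFDerivAt_id p))
    exact fderiv_comp_apply (f := chartPhase φ c) (A := fun p' : Coord d => (x', y, p')) (x := p)
      (h.differentiableAt h.smooth (show (x', y, p) ∈ phaseDomain _ from ⟨hx', hy, hp⟩)) hA (stdVec β)
  have h2 : (fun x' : Coord d =>
      fderiv ℝ (fun p' : Coord d => φ (chartPoint c x') (chartCovector c y p')) p (stdVec β))
      =ᶠ[𝓝 x] fun x' => dirDeriv (0, 0, stdVec β) (chartPhase φ c) (x', y, p) := by
    filter_upwards [(isOpen_chartDomain c).mem_nhds hx] with x' hx' using h1 x' hx'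
  rw [h2.fderiv_eq]
  exact fderiv_comp_apply (f := dirDeriv (0, 0, stdVec β) (chartPhase φ c))
    (A := fun x' : Coord d => (x', y, p)) (x := x)
    (h.differentiableAt hf (show (x, (y, p)) ∈ phaseDomain _ from ⟨hx, hy, hp⟩))
    (hasFDerivAt_prodMk_left (𝕜 := ℝ) x ((y, p) : Coord d × Coord d)) (stdVec α)

end ChartPhase

/-! ### The kernel in a chart -/

/-- The space is the union of two closed sets, the support of `f` and its zero set, and the product
is continuous on each. It applies to the weight, which is controlled only on the support of the
cut-off. -/
lemma continuous_ofReal_mul_of_continuousOn_tsupport {X : Type*} [TopologicalSpace X] {f : X → ℝ}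
    {g : X → ℂ} (hf : Continuous f) (hg : ContinuousOn g (tsupport f)) :
    Continuous fun x => (f x : ℂ) * g x := by
  rw [← continuousOn_univ]
  have h1 : (univ : Set X) = tsupport f ∪ f ⁻¹' {0} := by
    refine (eq_univ_of_forall fun x => ?_).symm
    by_cases hx : f x = 0
    · exact Or.inr hx
    · exact Or.inl (subset_tsupport f hx)
  rw [h1]
  refine ContinuousOn.union_of_isClosed ?_ ?_ (isClosed_tsupport f)
    (isClosed_singleton.preimage hf)
  · exact (Complex.continuous_ofReal.comp hf).continuousOn.mul hg
  · refine (continuousOn_const (c := (0 : ℂ))).congr fun x hx => ?_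
    have : f x = 0 := hx
    simp [this]

section ChartKernel

variable {d : ℕ} {M : Type*} [TopologicalSpace M] [ChartedSpace (Coord d) M]
  [IsManifold 𝓘(ℝ, Coord d) ∞ M]

/-- The covector with components `p` at the point with coordinates `z`, when the coordinates of the
chart at `c` are centred at `c`. -/
def centredCovector (c : M) (x : Coord d × Coord d) : Cotangent d M :=
  chartCovector c (extChartAt 𝓘(ℝ, Coord d) c c + x.1) x.2

lemma centre_mem (c : M) : extChartAt 𝓘(ℝ, Coord d) c c ∈ chartDomain d c :=
  mem_extChartAt_target c

lemma chartPoint_centre (c : M) : chartPoint (d := d) c (extChartAt 𝓘(ℝ, Coord d) c c) = c :=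
  extChartAt_to_inv c

lemma centredCovector_zero_fst (c : M) (p : Coord d) : (centredCovector c (0, p)).1 = c := by
  change chartPoint c (extChartAt 𝓘(ℝ, Coord d) c c + 0) = c
  rw [add_zero, chartPoint_centre]

variable {c : M} {r : ℝ}

lemma contMDiffOn_centredCovector
    (hr : ∀ z ∈ Metric.ball (0 : Coord d) r, extChartAt 𝓘(ℝ, Coord d) c c + z ∈ chartDomain d c) :
    ContMDiffOn 𝓘(ℝ, Coord d × Coord d) (cotangentModel d) ∞ (centredCovector (d := d) c)
      (Metric.ball 0 r ×ˢ univ) := by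
  have h1 : ContDiff ℝ ∞ fun x : Coord d × Coord d => (extChartAt 𝓘(ℝ, Coord d) c c + x.1, x.2) := by
    fun_prop
  exact (contMDiffOn_chartCovector c).comp h1.contMDiff.contMDiffOn
    fun x hx => ⟨hr _ hx.1, mem_univ _⟩

lemma contMDiffOn_centred_pair
    (hr : ∀ z ∈ Metric.ball (0 : Coord d) r, extChartAt 𝓘(ℝ, Coord d) c c + z ∈ chartDomain d c) :
    ContMDiffOn 𝓘(ℝ, Coord d × Coord d) ((𝓘(ℝ, Coord d)).prod (cotangentModel d)) ∞
      (fun x => (c, centredCovector (d := d) c x)) (Metric.ball 0 r ×ˢ univ) :=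
  contMDiffOn_const.prodMk (contMDiffOn_centredCovector hr)

lemma centredCovector_mem
    (hr : ∀ z ∈ Metric.ball (0 : Coord d) r, extChartAt 𝓘(ℝ, Coord d) c c + z ∈ chartDomain d c)
    {x : Coord d × Coord d} (hx : x ∈ conicDomain (Coord d) r) :
    centredCovector c x ∈ puncturedCotangent d M :=
  chartCovector_mem_puncturedCotangent (hr _ hx.1) hx.2

lemma scale_centredCovector (c : M) (t : ℝ) (z p : Coord d) :
    scale t (centredCovector c (z, p)) = centredCovector c (z, t • p) :=
  scale_chartCovector c t _ p

lemma IsPolyhomogeneous.isConic {s : Cotangent d M → ℂ} {sk : ℕ → Cotangent d M → ℂ}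
    (hs : IsPolyhomogeneous s sk)
    (hr : ∀ z ∈ Metric.ball (0 : Coord d) r, extChartAt 𝓘(ℝ, Coord d) c c + z ∈ chartDomain d c)
    (k : ℕ) : IsConic r (-k) fun x => sk k (centredCovector c x) where
  smooth := ContMDiffOn.contDiffOn <| (hs.smooth_component k).comp
    ((contMDiffOn_centredCovector hr).mono (prod_mono subset_rfl (subset_univ _)))
    fun x hx => centredCovector_mem hr hx
  homogeneous z hz p hp t ht := by
    have h := hs.homogeneous k _ (centredCovector_mem hr (x := (z, p)) ⟨hz, hp⟩) t ht
    rwa [scale_centredCovector] at h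

/-- The amplitude of the operator, in centred coordinates. -/
def centredKernel (φ : M → Cotangent d M → ℂ) (s : Cotangent d M → ℂ) (χ : M → Cotangent d M → ℝ)
    (v : M → Cotangent d M → ℂ) (c : M) (x : Coord d × Coord d) : ℂ :=
  Complex.exp (Complex.I * φ c (centredCovector c x)) * s (centredCovector c x) *
    (χ c (centredCovector c x) : ℂ) * v c (centredCovector c x)

variable {g : RiemMetric d M} {φ : M → Cotangent d M → ℂ} {s : Cotangent d M → ℂ}
  {sk : ℕ → Cotangent d M → ℂ} {χ : M → Cotangent d M → ℝ} {v : M → Cotangent d M → ℂ}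

lemma continuousOn_centredKernel (hφ : IsPhase φ) (hs : IsPolyhomogeneous s sk)
    (hχ : IsCutoff g χ) (hv : IsWeight g φ χ v)
    (hr : ∀ z ∈ Metric.ball (0 : Coord d) r, extChartAt 𝓘(ℝ, Coord d) c c + z ∈ chartDomain d c) :
    ContinuousOn (centredKernel φ s χ v c) (Metric.ball 0 r ×ˢ univ) := by
  have h1 : ContinuousOn (centredKernel φ s χ v c) (conicDomain (Coord d) r) := by
    have hsub : conicDomain (Coord d) r ⊆ Metric.ball 0 r ×ˢ univ :=
      prod_mono subset_rfl (subset_univ _)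
    have hpair := (contMDiffOn_centred_pair hr).continuousOn.mono hsub
    have h2 : ContinuousOn (fun x => φ c (centredCovector c x)) (conicDomain (Coord d) r) :=
      hφ.smooth.continuousOn.comp hpair fun x hx => ⟨mem_univ _, centredCovector_mem hr hx⟩
    have h3 : ContinuousOn (fun x => s (centredCovector c x)) (conicDomain (Coord d) r) :=
      hs.smooth.continuousOn.comp ((contMDiffOn_centredCovector hr).continuousOn.mono hsub)
        fun x hx => centredCovector_mem hr hx
    have h4 : ContinuousOn (fun x => (χ c (centredCovector c x) : ℂ) * v c (centredCovector c x))
        (conicDomain (Coord d) r) :=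
      (continuous_ofReal_mul_of_continuousOn_tsupport hχ.smooth.continuous
        hv.continuous).comp_continuousOn hpair
    have h5 : ContinuousOn (fun x => Complex.exp (Complex.I * φ c (centredCovector c x)))
        (conicDomain (Coord d) r) :=
      Complex.continuous_exp.comp_continuousOn (continuousOn_const.mul h2)
    exact ((h5.mul h3).mul h4).congr fun x _ => mul_assoc _ _ _
  intro x hx
  by_cases hp : x.2 = 0
  -- Near the zero section, where phase and symbol are not controlled, the cut-off makes the kernel
  -- vanish identically.
  · have h2 : ∀ᶠ y in 𝓝[Metric.ball 0 r ×ˢ univ] x,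
        centredLength g c (extChartAt 𝓘(ℝ, Coord d) c c) y < 1 / 2 := by
      refine (continuousOn_centredLength g hr x hx).eventually_lt_const ?_
      obtain ⟨z, p⟩ := x
      obtain rfl : p = 0 := hp
      rw [centredLength_zero g (hr z hx.1)]
      norm_num
    have h3 : ∀ y, centredLength g c (extChartAt 𝓘(ℝ, Coord d) c c) y < 1 / 2 →
        centredKernel φ s χ v c y = 0 := fun y hy => by
      have : χ c (centredCovector c y) = 0 := hχ.eq_zero _ _ hy.le
      simp [centredKernel, this]
    refine ContinuousWithinAt.congr_of_eventuallyEq (f := fun _ => (0 : ℂ))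
      continuousWithinAt_const (h2.mono h3) (h3 x ?_)
    exact h2.self_of_nhdsWithin hx
  · exact (h1.continuousAt ((isOpen_conicDomain r).mem_nhds ⟨hx.1, hp⟩)).continuousWithinAt

/-- Near the centre of the chart, the cut-off is `1` for covectors which are not short. -/
lemma IsCutoff.exists_radius (hχ : IsCutoff g χ) (c : M) :
    ∃ r : ℝ, 0 < r ∧ (∀ z ∈ Metric.closedBall (0 : Coord d) r,
        extChartAt 𝓘(ℝ, Coord d) c c + z ∈ chartDomain d c) ∧
      ∀ z ∈ Metric.ball (0 : Coord d) r, ∀ p : Coord d, p ≠ 0 →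
        1 ≤ covectorLength g (centredCovector c (z, p)) → χ c (centredCovector c (z, p)) = 1 := by
  obtain ⟨U, hUo, hUd, hUs, hU1⟩ := hχ.eq_one
  obtain ⟨r₀, hr₀, hball⟩ := Metric.nhds_basis_closedBall.mem_iff.1
    ((isOpen_chartDomain c).mem_nhds (centre_mem (d := d) c))
  have hr : ∀ z ∈ Metric.closedBall (0 : Coord d) r₀,
      extChartAt 𝓘(ℝ, Coord d) c c + z ∈ chartDomain d c := fun z hz =>
    hball (by simpa using hz)
  have hr' : ∀ z ∈ Metric.ball (0 : Coord d) r₀,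
      extChartAt 𝓘(ℝ, Coord d) c c + z ∈ chartDomain d c := fun z hz =>
    hr z (Metric.ball_subset_closedBall hz)
  -- Compactness of the unit sphere gives one radius for all directions, and `U` being conic extends
  -- this to all `p ≠ 0`.
  have h1 : ∀ᶠ z in 𝓝 (0 : Coord d), ∀ p ∈ Metric.sphere (0 : Coord d) 1,
      (c, centredCovector c (z, p)) ∈ U := by
    refine (isCompact_sphere (0 : Coord d) 1).eventually_forall_of_forall_eventually
      (P := fun z p => (c, centredCovector c (z, p)) ∈ U) fun p hp => ?_
    have hp0 : p ≠ 0 := by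
      rintro rfl
      simp at hp
    have hmem : ((0 : Coord d), p) ∈ Metric.ball (0 : Coord d) r₀ ×ˢ (univ : Set (Coord d)) :=
      ⟨Metric.mem_ball_self hr₀, mem_univ _⟩
    have hc : ContinuousAt (fun x : Coord d × Coord d => (c, centredCovector c x)) (0, p) :=
      (contMDiffOn_centred_pair hr').continuousOn.continuousAt
        ((Metric.isOpen_ball.prod isOpen_univ).mem_nhds hmem)
    refine hc.eventually_mem (hUo.mem_nhds ?_)
    have := hUd _ (centredCovector_mem hr' (x := (0, p)) ⟨Metric.mem_ball_self hr₀, hp0⟩)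
    rwa [centredCovector_zero_fst] at this
  obtain ⟨r₁, hr₁, h2⟩ := Metric.eventually_nhds_iff_ball.1 h1
  refine ⟨min r₀ r₁, lt_min hr₀ hr₁,
    fun z hz => hr z (Metric.closedBall_subset_closedBall (min_le_left _ _) hz),
    fun z hz p hp hlen => hU1 _ _ ?_ hlen⟩
  have hp' : 0 < ‖p‖ := norm_pos_iff.2 hp
  have h3 := hUs _ _ (h2 z (Metric.ball_subset_ball (min_le_right _ _) hz) (‖p‖⁻¹ • p) (by
    rw [mem_sphere_zero_iff_norm, norm_smul, norm_inv, norm_norm, inv_mul_cancel₀ hp'.ne'])) ‖p‖ hp'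
  rwa [scale_centredCovector, smul_smul, mul_inv_cancel₀ hp'.ne', one_smul] at h3

/-- A continuous function on a preconnected set whose fourth power is `1` is constant. -/
lemma eqOn_one_of_pow_four {X : Type*} [TopologicalSpace X] {S : Set X} (hS : IsPreconnected S)
    {f : X → ℂ} (hf : ContinuousOn f S) (h4 : ∀ x ∈ S, f x ^ 4 = 1) {x₀ : X} (hx₀ : x₀ ∈ S)
    (h0 : f x₀ = 1) {x : X} (hx : x ∈ S) : f x = 1 := by
  have hfin : {w : ℂ | w ^ 4 = 1}.Finite := by
    have h1 : (Polynomial.X ^ 4 - 1 : Polynomial ℂ) ≠ 0 := by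
      intro h
      have := congrArg (Polynomial.eval 0) h
      simp at this
    refine ((Polynomial.X ^ 4 - 1 : Polynomial ℂ).rootSet_finite ℂ).subset fun w hw => ?_
    rw [Polynomial.mem_rootSet]
    refine ⟨h1, ?_⟩
    have hw' : w ^ 4 = 1 := hw
    simp [hw']
  rw [hS.constant_of_mapsTo hfin.isDiscrete hf (fun x hx => h4 x hx) hx hx₀, h0]

lemma localWeight_ne_zero {ρ : Coord d → ℝ} {Φ : Coord d × Coord d × Coord d → ℂ}
    {x₀ z p : Coord d} (h₀ : 0 < ρ x₀) (h : 0 < ρ (x₀ + z)) : localWeight ρ Φ x₀ (z, p) ≠ 0 := by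
  have h1 : densityRatio ρ x₀ z ≠ 0 := by
    unfold densityRatio
    positivity
  exact mul_ne_zero (by exact_mod_cast h1) (Complex.exp_ne_zero _)

end ChartKernel

/-! ### The weight near the centre and the local kernel of the operator -/

section ChartKernel

variable {d : ℕ} {M : Type*} [TopologicalSpace M] [ChartedSpace (Coord d) M]
  [IsManifold 𝓘(ℝ, Coord d) ∞ M] {c : M} {r : ℝ}
  {g : RiemMetric d M} {φ : M → Cotangent d M → ℂ} {s : Cotangent d M → ℂ}
  {sk : ℕ → Cotangent d M → ℂ} {χ : M → Cotangent d M → ℝ} {v : M → Cotangent d M → ℂ}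

lemma ball_mem (c : M) (hr : ∀ z ∈ Metric.closedBall (0 : Coord d) r,
    extChartAt 𝓘(ℝ, Coord d) c c + z ∈ chartDomain d c) :
    ∀ z ∈ Metric.ball (0 : Coord d) r, extChartAt 𝓘(ℝ, Coord d) c c + z ∈ chartDomain d c :=
  fun z hz => hr z (Metric.ball_subset_closedBall hz)

/-- Near the centre of the chart, the weight is given by the principal branch of the root. -/
lemma IsWeight.eq_localWeight (hφ : IsPhase φ) (hv : IsWeight g φ χ v) (hr0 : 0 < r)
    (hr : ∀ z ∈ Metric.ball (0 : Coord d) r, extChartAt 𝓘(ℝ, Coord d) c c + z ∈ chartDomain d c)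
    (hdet : ∀ z ∈ Metric.ball (0 : Coord d) r, ∀ p : Coord d, p ≠ 0 →
      localDet (chartPhase φ c) (extChartAt 𝓘(ℝ, Coord d) c c, extChartAt 𝓘(ℝ, Coord d) c c + z, p)
        ∈ Complex.slitPlane) {p : Coord d} (hp : p ≠ 0)
    (hone : ∀ z ∈ Metric.closedBall (0 : Coord d) (r / 2), χ c (centredCovector c (z, p)) = 1)
    {z : Coord d} (hz : z ∈ Metric.closedBall (0 : Coord d) (r / 2)) :
    v c (centredCovector c (z, p)) = localWeight (rho g c) (chartPhase φ c)
      (extChartAt 𝓘(ℝ, Coord d) c c) (z, p) := by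
  have hX := centre_mem (d := d) c
  have hsub : Metric.closedBall (0 : Coord d) (r / 2) ⊆ Metric.ball 0 r :=
    Metric.closedBall_subset_ball (by linarith)
  have hne : ∀ z ∈ Metric.closedBall (0 : Coord d) (r / 2), localWeight (rho g c)
      (chartPhase φ c) (extChartAt 𝓘(ℝ, Coord d) c c) (z, p) ≠ 0 := fun z hz =>
    localWeight_ne_zero (rho_pos g hX) (rho_pos g (hr z (hsub hz)))
  have hsupp : ∀ z ∈ Metric.closedBall (0 : Coord d) (r / 2), (c, centredCovector c (z, p)) ∈
      tsupport (fun x : M × Cotangent d M => χ x.1 x.2) := fun z hz => by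
    refine subset_tsupport _ ?_
    rw [Function.mem_support]
    simp only [hone z hz, ne_eq, one_ne_zero, not_false_eq_true]
  have hslice : ContinuousOn (fun z : Coord d => (z, p)) (Metric.closedBall 0 (r / 2)) := by
    fun_prop
  have hconic : IsConic r 0 (localWeight (rho g c) (chartPhase φ c)
      (extChartAt 𝓘(ℝ, Coord d) c c)) :=
    (hφ.isLocalPhase c).isConic_localWeight hX hr hdet (contDiffOn_rho g c) fun _ hy => rho_pos g hy
  -- The quotient of the two branches is continuous on a connected ball, its fourth power is `1`,
  -- and it equals `1` at the centre; hence it is constant.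
  have hcont : ContinuousOn (fun z => v c (centredCovector c (z, p)) / localWeight (rho g c)
      (chartPhase φ c) (extChartAt 𝓘(ℝ, Coord d) c c) (z, p)) (Metric.closedBall 0 (r / 2)) := by
    refine ContinuousOn.div ?_ ?_ hne
    · exact hv.continuous.comp (f := fun z => (c, centredCovector c (z, p)))
        ((contMDiffOn_centred_pair hr).continuousOn.comp hslice fun z hz =>
          ⟨hsub hz, mem_univ _⟩) hsupp
    · exact hconic.smooth.continuousOn.comp hslice fun z hz => ⟨hsub hz, hp⟩
  have hfour : ∀ z ∈ Metric.closedBall (0 : Coord d) (r / 2),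
      (v c (centredCovector c (z, p)) / localWeight (rho g c)
        (chartPhase φ c) (extChartAt 𝓘(ℝ, Coord d) c c) (z, p)) ^ 4 = 1 := by
    intro z hz
    have h1 := hv.fourth_root c c _ hX _ (hr z (hsub hz)) p (by
      rw [chartPoint_centre]
      exact hsupp z hz)
    rw [chartPoint_centre, mixedDet_eq_localDet hφ hX (hr z (hsub hz)) hp] at h1
    obtain ⟨w, hw, hvw⟩ := h1
    have h2 := Complex.slitPlane_ne_zero (hdet z (hsub hz) p hp)
    have h3 : v c (centredCovector c (z, p)) =
        (densityRatio (rho g c) (extChartAt 𝓘(ℝ, Coord d) c c) z : ℂ) * w := hvw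
    have h4 : ∀ D : ℂ, D ≠ 0 → Complex.exp (Complex.log D / 2) ^ 4 = D ^ 2 := fun D hD => by
      rw [← Complex.exp_nat_mul, show ((4 : ℕ) : ℂ) * (Complex.log D / 2) =
        Complex.log D + Complex.log D by push_cast; ring, Complex.exp_add, Complex.exp_log hD, sq]
    rw [div_pow, div_eq_one_iff_eq (pow_ne_zero _ (hne z hz)), h3, localWeight, mul_pow, mul_pow,
      h4 _ h2, hw]
  have hzero : v c (centredCovector c (0, p)) / localWeight (rho g c)
      (chartPhase φ c) (extChartAt 𝓘(ℝ, Coord d) c c) (0, p) = 1 := by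
    rw [(hφ.isLocalPhase c).localWeight_zero hX (rho_pos g hX) hp, div_one]
    have := hv.diagonal _ (centredCovector_mem hr (x := (0, p)) ⟨Metric.mem_ball_self hr0, hp⟩)
    rwa [centredCovector_zero_fst] at this
  have h5 := eqOn_one_of_pow_four (convex_closedBall (0 : Coord d) (r / 2)).isPreconnected hcont
    hfour (Metric.mem_closedBall_self (by linarith)) hzero hz
  exact (div_eq_one_iff_eq (hne z hz)).1 h5

lemma IsConic.exists_bound {V : Coord d × Coord d → ℂ} (hr0 : 0 < r) (hV : IsConic r 0 V) :
    ∃ C : ℝ, 0 ≤ C ∧ ∀ z p : Coord d, ‖z‖ ≤ r / 2 → p ≠ 0 → ‖V (z, p)‖ ≤ C := by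
  have hcomp : IsCompact (Metric.closedBall (0 : Coord d) (r / 2) ×ˢ
      Metric.sphere (0 : Coord d) 1) := (isCompact_closedBall _ _).prod (isCompact_sphere _ _)
  have hsub : Metric.closedBall (0 : Coord d) (r / 2) ×ˢ Metric.sphere (0 : Coord d) 1
      ⊆ conicDomain (Coord d) r := by
    rintro ⟨z, p⟩ ⟨hz, hp⟩
    refine ⟨Metric.closedBall_subset_ball (by linarith) hz, ?_⟩
    rintro rfl
    simp at hp
  obtain ⟨C, hC⟩ := hcomp.exists_bound_of_continuousOn (hV.smooth.continuousOn.mono hsub)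
  refine ⟨max C 0, le_max_right _ _, fun z p hz hp => le_trans ?_ (le_max_left _ _)⟩
  have hp' : 0 < ‖p‖ := norm_pos_iff.2 hp
  have h1 := hV.homogeneous z (by rw [mem_ball_zero_iff]; linarith) p hp ‖p‖⁻¹ (inv_pos.2 hp')
  rw [zpow_zero, one_mul] at h1
  rw [← h1]
  refine hC _ ⟨by simpa using hz, ?_⟩
  rw [mem_sphere_zero_iff_norm, norm_smul, norm_inv, norm_norm, inv_mul_cancel₀ hp'.ne']

lemma IsPolyhomogeneous.exists_remainder_bound (hs : IsPolyhomogeneous s sk)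
    (hr : ∀ z ∈ Metric.closedBall (0 : Coord d) r,
      extChartAt 𝓘(ℝ, Coord d) c c + z ∈ chartDomain d c) (N : ℕ) :
    ∃ C : ℝ, ∀ z p : Coord d, ‖z‖ ≤ r → 1 ≤ ‖p‖ →
      ‖s (centredCovector c (z, p)) - ∑ k ∈ Finset.range N, sk k (centredCovector c (z, p))‖ ≤
        C / ‖p‖ ^ N := by
  obtain ⟨C, hC⟩ := hs.asymptotic N c (Metric.closedBall (extChartAt 𝓘(ℝ, Coord d) c c) r)
    (isCompact_closedBall _ _) (fun y hy => by
      have := hr (y - extChartAt 𝓘(ℝ, Coord d) c c) (by simpa [dist_eq_norm] using hy)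
      simpa using this) 0 0
  refine ⟨C, fun z p hz hp => ?_⟩
  have h1 := hC (extChartAt 𝓘(ℝ, Coord d) c c + z) (by simpa using hz) p hp
  rw [norm_iteratedFDeriv_zero, norm_iteratedFDeriv_zero] at h1
  simpa [centredCovector, zpow_neg, div_eq_mul_inv] using h1

/-- The radius keeps the cut-off equal to `1` on long covectors and the determinant off the cut of
the logarithm. Then, for large `p`, kernel and model differ only by the symbol remainder, multiplied
by an exponential bounded through `Im φ ≥ 0` and by a bounded weight. -/
theorem exists_isLocalKernel (hφ : IsPhase φ) (hs : IsPolyhomogeneous s sk)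
    (hχ : IsCutoff g χ) (hv : IsWeight g φ χ v) (c : M) :
    ∃ r : ℝ, (∀ z ∈ Metric.closedBall (0 : Coord d) r,
        extChartAt 𝓘(ℝ, Coord d) c c + z ∈ chartDomain d c) ∧
      IsLocalKernel r (centredPhase (chartPhase φ c) (extChartAt 𝓘(ℝ, Coord d) c c))
        (localWeight (rho g c) (chartPhase φ c) (extChartAt 𝓘(ℝ, Coord d) c c))
        (centredLength g c (extChartAt 𝓘(ℝ, Coord d) c c))
        (fun k x => sk k (centredCovector c x)) (centredKernel φ s χ v c) := by
  obtain ⟨r₁, hr₁, hclosed, hone⟩ := hχ.exists_radius c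
  have hX := centre_mem (d := d) c
  have hΦ := hφ.isLocalPhase c
  obtain ⟨r₂, hr₂, hdet⟩ := hΦ.exists_radius hX
  obtain ⟨r, hr⟩ : ∃ r, r = min r₁ r₂ := ⟨_, rfl⟩
  have hr0 : 0 < r := hr ▸ lt_min hr₁ hr₂
  have h1 : r ≤ r₁ := hr ▸ min_le_left _ _
  have h2 : r ≤ r₂ := hr ▸ min_le_right _ _
  have hclosed' : ∀ z ∈ Metric.closedBall (0 : Coord d) r,
      extChartAt 𝓘(ℝ, Coord d) c c + z ∈ chartDomain d c := fun z hz =>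
    hclosed z (Metric.closedBall_subset_closedBall h1 hz)
  have hball := ball_mem c hclosed'
  have hdet' : ∀ z ∈ Metric.ball (0 : Coord d) r, ∀ p : Coord d, p ≠ 0 →
      localDet (chartPhase φ c) (extChartAt 𝓘(ℝ, Coord d) c c, extChartAt 𝓘(ℝ, Coord d) c c + z, p)
        ∈ Complex.slitPlane := fun z hz => (hdet z (Metric.ball_subset_ball h2 hz)).2
  have hconic := hΦ.isConic_localWeight hX hball hdet' (contDiffOn_rho g c)
    fun _ hy => rho_pos g hy
  have hlength := isConicLength_centredLength g hball
  refine ⟨r, hclosed', hr0, hΦ.isPerturbation hX hball, hconic,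
    fun p hp => hΦ.localWeight_zero hX (rho_pos g hX) hp, hlength,
    continuousOn_centredLength g hball, hs.isConic hball,
    continuousOn_centredKernel hφ hs hχ hv hball, ?_⟩
  obtain ⟨b, hb, hlow⟩ := hlength.exists_lower_bound hr0
  obtain ⟨B, hB, hVB⟩ := hconic.exists_bound hr0
  obtain ⟨C, hC⟩ := hs.exists_remainder_bound hclosed' (d + 2)
  -- `‖p‖ ≥ b⁻¹` makes the length of the covector at least `1`, so the cut-off is `1`; `‖p‖ ≥ 1` is
  -- needed for the symbol estimate.
  refine ⟨max 1 b⁻¹, le_max_left _ _, B * C, fun z p hz hp => ?_⟩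
  have hp1 : 1 ≤ ‖p‖ := (le_max_left _ _).trans hp
  have hp0 : p ≠ 0 := norm_pos_iff.1 (by linarith)
  have hz' : z ∈ Metric.ball (0 : Coord d) r := by
    rw [mem_ball_zero_iff]; linarith
  have hχ1 : ∀ z ∈ Metric.closedBall (0 : Coord d) (r / 2), χ c (centredCovector c (z, p)) = 1 := by
    intro z hz
    rw [mem_closedBall_zero_iff] at hz
    refine hone z (by rw [mem_ball_zero_iff]; linarith) p hp0 (le_trans ?_ (hlow z p hz hp0))
    have := (le_max_right _ _).trans hp
    rwa [inv_le_iff_one_le_mul₀' hb] at this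
  have hw := hv.eq_localWeight hφ hr0 hball hdet' hp0 hχ1 (mem_closedBall_zero_iff.2 hz)
  have hphase : centredPhase (chartPhase φ c) (extChartAt 𝓘(ℝ, Coord d) c c) (z, p) -
      ((inner ℝ z p : ℝ) : ℂ) = φ c (centredCovector c (z, p)) := by
    have h3 : chartPhase φ c (extChartAt 𝓘(ℝ, Coord d) c c, extChartAt 𝓘(ℝ, Coord d) c c + z, p) =
        φ c (centredCovector c (z, p)) := by
      simp only [chartPhase, chartPoint_centre]
      rfl
    rw [centredPhase, excess, h3, linearPhase]
    simp
  have him : 0 ≤ (φ c (centredCovector c (z, p))).im :=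
    hφ.im_nonneg _ _ (centredCovector_mem hball (x := (z, p)) ⟨hz', hp0⟩)
  have hexp : ‖Complex.exp (Complex.I * φ c (centredCovector c (z, p)))‖ ≤ 1 := by
    rw [Complex.norm_exp, Real.exp_le_one_iff]
    simpa using him
  rw [hphase, centredKernel, hχ1 z (mem_closedBall_zero_iff.2 hz), hw]
  obtain ⟨V, hV⟩ : ∃ V, V = localWeight (rho g c) (chartPhase φ c)
    (extChartAt 𝓘(ℝ, Coord d) c c) (z, p) := ⟨_, rfl⟩
  rw [← hV, show ∀ e a S : ℂ, e * a * ((1 : ℝ) : ℂ) * V - e * (V * S) = e * (V * (a - S)) from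
    fun e a S => by push_cast; ring, norm_mul, norm_mul, mul_div_assoc]
  have hVz : ‖V‖ ≤ B := hV ▸ hVB z p hz hp0
  have hR := hC z p (by linarith) hp1
  calc _ ≤ 1 * (B * (C / ‖p‖ ^ (d + 2))) := by gcongr
    _ = _ := one_mul _

end ChartKernel

/-! ### From functions in a chart to functions on the manifold -/

section ChartExtension

variable {d : ℕ} {M : Type*} [TopologicalSpace M] [ChartedSpace (Coord d) M]
  [IsManifold 𝓘(ℝ, Coord d) ∞ M] {c : M} {r : ℝ}

open Classical in
/-- The function on `M` which is `f` in the centred coordinates of the chart at `c`, and zero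
elsewhere. -/
def chartExtension (c : M) (f : Coord d → ℂ) (y : M) : ℂ :=
  if y ∈ (extChartAt 𝓘(ℝ, Coord d) c).source then
    f (extChartAt 𝓘(ℝ, Coord d) c y - extChartAt 𝓘(ℝ, Coord d) c c) else 0

lemma chartExtension_chartPoint {f : Coord d → ℂ} {y : Coord d} (hy : y ∈ chartDomain d c) :
    chartExtension c f (chartPoint c y) = f (y - extChartAt 𝓘(ℝ, Coord d) c c) := by
  rw [chartExtension, if_pos (chartPoint_mem hy), chartPoint,
    (extChartAt 𝓘(ℝ, Coord d) c).right_inv hy]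

lemma chartExtension_of_notMem {f : Coord d → ℂ} {y : M}
    (hy : y ∉ (extChartAt 𝓘(ℝ, Coord d) c).source) : chartExtension c f y = 0 :=
  if_neg hy

lemma chartExtension_self (c : M) (f : Coord d → ℂ) : chartExtension c f c = f 0 := by
  rw [chartExtension, if_pos (mem_extChartAt_source c), sub_self]

/-- Off the chart domain smoothness holds because the image of `K` is compact, hence closed in a
Hausdorff space, and the extension vanishes outside it. -/
lemma contMDiff_chartExtension [T2Space M] {f : Coord d → ℂ} (hf : ContDiff ℝ ∞ f)
    {K : Set (Coord d)} (hK : IsCompact K)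
    (hKD : ∀ z ∈ K, extChartAt 𝓘(ℝ, Coord d) c c + z ∈ chartDomain d c)
    (hfK : ∀ z, f z ≠ 0 → z ∈ K) :
    ContMDiff 𝓘(ℝ, Coord d) 𝓘(ℝ, ℂ) ∞ (chartExtension c f) := by
  intro m
  by_cases hm : m ∈ (extChartAt 𝓘(ℝ, Coord d) c).source
  · have h1 : ContMDiffAt 𝓘(ℝ, Coord d) 𝓘(ℝ, ℂ) ∞ (fun y => f (extChartAt 𝓘(ℝ, Coord d) c y -
        extChartAt 𝓘(ℝ, Coord d) c c)) m := by
      have h2 : ContDiff ℝ ∞ fun y : Coord d => f (y - extChartAt 𝓘(ℝ, Coord d) c c) :=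
        hf.comp (contDiff_id.sub contDiff_const)
      exact h2.contMDiff.contMDiffAt.comp m (contMDiffAt_extChartAt' (by simpa using hm))
    refine h1.congr_of_eventuallyEq ?_
    filter_upwards [(isOpen_extChartAt_source c).mem_nhds hm] with y hy using if_pos hy
  · have hA : IsCompact ((fun z => chartPoint c (extChartAt 𝓘(ℝ, Coord d) c c + z)) '' K) :=
      hK.image_of_continuousOn ((continuousOn_extChartAt_symm c).comp
        (f := fun z => extChartAt 𝓘(ℝ, Coord d) c c + z) (by fun_prop) hKD)
    have hmA : m ∉ (fun z => chartPoint c (extChartAt 𝓘(ℝ, Coord d) c c + z)) '' K := by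
      rintro ⟨z, hz, rfl⟩
      exact hm (chartPoint_mem (hKD z hz))
    refine (contMDiffAt_const (c := (0 : ℂ))).congr_of_eventuallyEq ?_
    filter_upwards [hA.isClosed.isOpen_compl.mem_nhds hmA] with y hy
    by_contra hne
    by_cases hys : y ∈ (extChartAt 𝓘(ℝ, Coord d) c).source
    · rw [chartExtension, if_pos hys] at hne
      refine hy ⟨_, hfK _ hne, ?_⟩
      simp only [add_sub_cancel]
      exact (extChartAt 𝓘(ℝ, Coord d) c).left_inv hys
    · exact hne (chartExtension_of_notMem hys)

variable [MeasurableSpace M] [BorelSpace M]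

/-- The integral over `M` of a function supported in a ball of the chart, in centred coordinates. -/
lemma integral_riemannianMeasure_centred (g : RiemMetric d M) {G : M → ℂ} {J : Coord d → ℂ}
    (hG : ∀ y ∉ (extChartAt 𝓘(ℝ, Coord d) c).source, G y = 0)
    (hJ : ∀ z, extChartAt 𝓘(ℝ, Coord d) c c + z ∈ chartDomain d c →
      (rho g c (extChartAt 𝓘(ℝ, Coord d) c c + z) : ℂ) *
        G (chartPoint c (extChartAt 𝓘(ℝ, Coord d) c c + z)) = J z)
    (hJ0 : ∀ z, extChartAt 𝓘(ℝ, Coord d) c c + z ∉ chartDomain d c → J z = 0) :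
    ∫ y, G y ∂(riemannianMeasure g) = ∫ z, J z := by
  rw [integral_riemannianMeasure g c hG,
    ← integral_sub_right_eq_self J (extChartAt 𝓘(ℝ, Coord d) c c),
    ← setIntegral_eq_integral_of_forall_compl_eq_zero (s := chartDomain d c)
      (f := fun y => J (y - extChartAt 𝓘(ℝ, Coord d) c c))
      fun y hy => hJ0 _ (by rwa [add_sub_cancel])]
  refine setIntegral_congr_fun (isOpen_chartDomain c).measurableSet fun y hy => ?_
  have := hJ (y - extChartAt 𝓘(ℝ, Coord d) c c) (by rwa [add_sub_cancel])
  rwa [add_sub_cancel] at this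

/-- In coordinates the regularised integrals defining the oscillatory integral are those of the
local kernel. The smoothing error is an integral against a continuous kernel, bounded on the compact
ball, hence controlled by the `L¹` norm. -/
lemma IsOperatorOf.isIdentityModBounded [T2Space M] {g : RiemMetric d M}
    {φ : M → Cotangent d M → ℂ} {s : Cotangent d M → ℂ} {χ : M → Cotangent d M → ℝ}
    {v : M → Cotangent d M → ℂ} {T : C^∞⟮𝓘(ℝ, Coord d), M; 𝓘(ℝ, ℂ), ℂ⟯ → M → ℂ}
    (hT : IsOperatorOf g φ s χ v T) (hId : IsSmoothing g fun f x => T f x - f x)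
    (hr0 : 0 < r) (hr : ∀ z ∈ Metric.closedBall (0 : Coord d) r,
      extChartAt 𝓘(ℝ, Coord d) c c + z ∈ chartDomain d c)
    {ψ : ℝ → ℝ} (hψ : ContDiff ℝ ∞ ψ) (hψc : HasCompactSupport ψ) (hψ1 : ∀ᶠ t in 𝓝 0, ψ t = 1) :
    IsIdentityModBounded r (centredLength g c (extChartAt 𝓘(ℝ, Coord d) c c))
      (centredKernel φ s χ v c) ψ := by
  obtain ⟨k, hk, hkT⟩ := hId
  have hshift : ContinuousOn (fun z : Coord d => extChartAt 𝓘(ℝ, Coord d) c c + z)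
      (Metric.closedBall 0 r) := by fun_prop
  have hkc : ContinuousOn (fun z => (rho g c (extChartAt 𝓘(ℝ, Coord d) c c + z) : ℂ) *
      k (c, chartPoint c (extChartAt 𝓘(ℝ, Coord d) c c + z))) (Metric.closedBall 0 r) := by
    refine ContinuousOn.mul (Complex.continuous_ofReal.comp_continuousOn
      ((contDiffOn_rho g c).continuousOn.comp hshift hr)) (hk.continuous.comp_continuousOn
      (continuousOn_const.prodMk ((continuousOn_extChartAt_symm c).comp hshift hr)))
  obtain ⟨C, hC⟩ := (isCompact_closedBall (0 : Coord d) r).exists_bound_of_continuousOn hkc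
  refine ⟨C, fun f hf hfr => ?_⟩
  have hsupp : ∀ z, f z ≠ 0 → z ∈ Metric.closedBall (0 : Coord d) r := fun z hz => by
    rw [mem_closedBall_zero_iff]
    linarith [hfr z hz]
  have hout : ∀ z, extChartAt 𝓘(ℝ, Coord d) c c + z ∉ chartDomain d c → f z = 0 := fun z hz => by
    by_contra h
    exact hz (hr z (hsupp z h))
  obtain ⟨F, hF⟩ : ∃ F : C^∞⟮𝓘(ℝ, Coord d), M; 𝓘(ℝ, ℂ), ℂ⟯, ∀ y, F y = chartExtension c f y :=
    ⟨⟨chartExtension c f, contMDiff_chartExtension hf (isCompact_closedBall 0 r) hr hsupp⟩,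
      fun _ => rfl⟩
  have hFc : ∀ z, extChartAt 𝓘(ℝ, Coord d) c c + z ∈ chartDomain d c →
      F (chartPoint c (extChartAt 𝓘(ℝ, Coord d) c c + z)) = f z := fun z hz => by
    rw [hF, chartExtension_chartPoint hz, add_sub_cancel_left]
  have hF0 : ∀ y ∉ (extChartAt 𝓘(ℝ, Coord d) c).source, F y = 0 := fun y hy => by
    rw [hF, chartExtension_of_notMem hy]
  refine ⟨T F c, ?_, ?_⟩
  · refine (hT F c ψ hψ hψc hψ1).congr fun θ => ?_
    rw [← integral_const_mul]
    refine integral_riemannianMeasure_centred (c := c) g (fun y hy => ?_) (fun z hz => ?_)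
      fun z hz => ?_
    · rw [fibreIntegral]
      simp only [hF0 y hy, mul_zero, integral_zero]
    · rw [rho_mul_fibreIntegral g hz]
      congr 1
      refine integral_congr_ae (Filter.Eventually.of_forall fun p => ?_)
      have h1 : F (chartCovector c (extChartAt 𝓘(ℝ, Coord d) c c + z) p).1 = f z := hFc z hz
      simp only [h1]
      rw [centredKernel, centredLength, ← mul_assoc]
      rfl
    · simp only [hout z hz, mul_zero, integral_zero]
  · have h1 : T F c - F c = ∫ z, (rho g c (extChartAt 𝓘(ℝ, Coord d) c c + z) : ℂ) *
        k (c, chartPoint c (extChartAt 𝓘(ℝ, Coord d) c c + z)) * f z := by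
      refine (hkT F c).trans ?_
      refine integral_riemannianMeasure_centred (c := c) g (fun y hy => ?_) (fun z hz => ?_)
        fun z hz => ?_
      · rw [hF0 y hy, mul_zero]
      · rw [hFc z hz, mul_assoc]
      · rw [hout z hz, mul_zero]
    rw [hF c, chartExtension_self] at h1
    rw [h1, ← integral_const_mul]
    have hcs : HasCompactSupport f :=
      HasCompactSupport.of_support_subset_isCompact (isCompact_closedBall (0 : Coord d) r)
        fun z hz => hsupp z hz
    refine norm_integral_le_of_norm_le
      ((hf.continuous.integrable_of_hasCompactSupport hcs).norm.const_mul C)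
      (Filter.Eventually.of_forall fun z => ?_)
    by_cases hz : f z = 0
    · simp [hz]
    · rw [norm_mul]
      gcongr
      exact hC z (hsupp z hz)

end ChartExtension

/-! ### Unit covectors in centred coordinates -/

section Covectors

variable {d : ℕ} {M : Type*} [TopologicalSpace M] [ChartedSpace (Coord d) M]
  [IsManifold 𝓘(ℝ, Coord d) ∞ M]

lemma centredCovector_zero (c : M) (p : Coord d) :
    centredCovector c (0, p) = ⟨c, (innerSL ℝ p : Coord d →L[ℝ] ℝ)⟩ := by
  -- The base points agree only propositionally, so the base point is generalised before the
  -- equality is substituted.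
  have h1 : ∀ y : M, y = c → (⟨y, (innerSL ℝ p).comp (toChart c y)⟩ : Cotangent d M) =
      ⟨c, (innerSL ℝ p : Coord d →L[ℝ] ℝ)⟩ := by
    rintro y rfl
    rw [toChart_self]
    rfl
  have h2 := centre_mem (d := d) c
  rw [← add_zero (extChartAt 𝓘(ℝ, Coord d) c c)] at h2
  rw [centredCovector, chartCovector_eq h2]
  exact h1 _ (by rw [add_zero, chartPoint_centre])

/-- Every non-zero covector is a positive multiple of a unit covector in centred coordinates. -/
lemma exists_eq_scale {q : Cotangent d M} (hq : q ∈ puncturedCotangent d M) :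
    ∃ ξ : Coord d, ‖ξ‖ = 1 ∧ ∃ t : ℝ, 0 < t ∧ q = scale t (centredCovector q.1 (0, ξ)) := by
  obtain ⟨y, η⟩ := q
  obtain ⟨p, hp⟩ : ∃ p : Coord d, (innerSL ℝ p : Coord d →L[ℝ] ℝ) = η :=
    (InnerProductSpace.toDual ℝ (Coord d)).surjective η
  have hp0 : p ≠ 0 := by
    rintro rfl
    exact hq (by rw [← hp, map_zero]; rfl)
  have hp' : 0 < ‖p‖ := norm_pos_iff.2 hp0
  refine ⟨‖p‖⁻¹ • p, ?_, ‖p‖, hp', ?_⟩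
  · rw [norm_smul, norm_inv, norm_norm, inv_mul_cancel₀ hp'.ne']
  · rw [scale_centredCovector, smul_smul, mul_inv_cancel₀ hp'.ne', one_smul, centredCovector_zero,
      hp]

end Covectors

end SubprincipalIdentity

end

theorem theorem6p1 {d : ℕ} (hd : 2 ≤ d)
    {M : Type*} [TopologicalSpace M] [ChartedSpace (Coord d) M]
    [IsManifold 𝓘(ℝ, Coord d) ∞ M] [T2Space M] [CompactSpace M] [ConnectedSpace M]
    [MeasurableSpace M] [BorelSpace M]
    (g : RiemMetric d M)
    (φ : M → Cotangent d M → ℂ) (hφ : IsPhase φ)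
    (s : Cotangent d M → ℂ) (sk : ℕ → Cotangent d M → ℂ) (hs : IsPolyhomogeneous s sk)
    (χ : M → Cotangent d M → ℝ) (hχ : IsCutoff g χ)
    (v : M → Cotangent d M → ℂ) (hv : IsWeight g φ χ v)
    (T : C^∞⟮𝓘(ℝ, Coord d), M; 𝓘(ℝ, ℂ), ℂ⟯ → M → ℂ) (hT : IsOperatorOf g φ s χ v T)
    (hId : IsSmoothing g fun f x => T f x - f x) :
    ∀ q ∈ puncturedCotangent d M, sk 1 q = 0 := by
  obtain ⟨ψ, hψ, hψc, hψ1⟩ : ∃ ψ : ℝ → ℝ, ContDiff ℝ ∞ ψ ∧ HasCompactSupport ψ ∧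
      ∀ᶠ t in 𝓝 0, ψ t = 1 := by
    let b : ContDiffBump (0 : ℝ) := ⟨1, 2, one_pos, one_lt_two⟩
    exact ⟨b, b.contDiff, b.hasCompactSupport, b.eventuallyEq_one⟩
  -- The principal symbol is needed on a full neighbourhood in the base, not only at one point,
  -- because its derivatives would enter the expansion at order `ε⁴`.
  have hzero : ∀ q ∈ puncturedCotangent d M, sk 0 q = 1 := by
    intro q hq
    obtain ⟨ξ, hξ, t, ht, hqξ⟩ := exists_eq_scale hq
    obtain ⟨r, hr, hK⟩ := exists_isLocalKernel hφ hs hχ hv q.1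
    have h1 := hK.principal_eq_one hd hψ hψc hψ1
      (hT.isIdentityModBounded hId hK.pos hr hψ hψc hψ1) hξ
    have hmem : centredCovector q.1 (0, ξ) ∈ puncturedCotangent d M :=
      centredCovector_mem (ball_mem q.1 hr) (x := (0, ξ))
        ⟨Metric.mem_ball_self hK.pos, norm_pos_iff.1 (by rw [hξ]; exact one_pos)⟩
    rw [hqξ, hs.homogeneous 0 _ hmem t ht, h1]
    simp
  intro q hq
  obtain ⟨ξ, hξ, t, ht, hqξ⟩ := exists_eq_scale hq
  obtain ⟨r, hr, hK⟩ := exists_isLocalKernel hφ hs hχ hv q.1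
  have hball := ball_mem q.1 hr
  have hmem : centredCovector q.1 (0, ξ) ∈ puncturedCotangent d M :=
    centredCovector_mem hball (x := (0, ξ))
      ⟨Metric.mem_ball_self hK.pos, norm_pos_iff.1 (by rw [hξ]; exact one_pos)⟩
  have h1 := hK.subprincipal_eq_zero hd hψ hψc hψ1
    (hT.isIdentityModBounded hId hK.pos hr hψ hψc hψ1)
    ((hφ.isLocalPhase q.1).subprincipalRelation hK.pos (centre_mem q.1) hball
      (contDiffOn_rho g q.1) fun _ hy => rho_pos g hy)
    (fun z hz p hp => hzero _ (centredCovector_mem hball (x := (z, p)) ⟨hz, hp⟩)) hξ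
  rw [hqξ, hs.homogeneous 1 _ hmem t ht, h1, mul_zero]
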